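/- **Setting.** Consider the plant $\dot z=F(w)z+G(y,v,w)y+D_1(v,w)$, $\dot y=H(w)z+K(y,v,w)y+b(w,v)u+D_2(v,w)$ with $z\in\mathbb R^{n_z}$, $y,u\in\mathbb R$, error $e=y-q(v,w)$, and the exosystem $\dot v=S(\sigma)v$, $v\in\mathbb R^{n_v}$. All functions are smooth, $b^2>0$ everywhere, and $D_1(0,w)=0$, $D_2(0,w)=0$, $q(0,w)=0$. Let $\mathbb V,\mathbb W,\mathbb S$ be compact sets of values of $v,w,\sigma$, where $v(0)\in\mathbb V$ implies $v(t)\in\mathbb V$ for all $t\ge0$ and $\sigma\in\mathbb S$. Write $\mu=(v,\sigma,w)$. Assume: 1. For all $\sigma\in\mathbb S$ the eigenvalues of $S(\sigma)$ are distinct with zero real part. 2. $F(w)$ is Hurwitz for $w\in\mathbb W$, and there is a smooth $\mathbf z(v,\sigma,w)$ with $\mathbf z(0,0,0)=0$ and $\frac{\partial\mathbf z}{\partial v}S(\sigma)v=F(w)\mathbf z+G(q,v,w)q+D_1(v,w)$ for all $v\in\mathbb R^{n_v}$, $\sigma\in\mathbb S$, $w\in\mathbb W$. 3. The function $\mathbf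 u(\mu)=b^{-1}\big(\frac{\partial q}{\partial v}S(\sigma)v-H(w)\mathbf z-K(q,v,w)q-D_2\big)$ is a polynomial in $v$ for all $(w,\sigma)\in\mathbb W\times\mathbb S$. 4. For some $n\ge1$ and distinct real frequencies $\hat\omega_1(\sigma),\dots,\hat\omega_n(\sigma)$, along every solution of the exosystem with $v(0)\in\mathbb V$, $\sigma\in\mathbb S$, $w\in\mathbb W$ one has $\mathbf u=\sum_{i=1}^nC_ie^{\imath\hat\omega_it}$ with all $C_i=C_i(v(0),w,\sigma)\ne0$. Let $a(\sigma)=(a_1,\dots,a_n)$ be the coefficients of $s^n+a_1+a_2s+\dots+a_ns^{n-1}=\prod_i(s-\imath\hat\omega_i(\sigma))$. For a vector $c\in\mathbb R^n$ let $\Phi(c)$ be the companion matrix with last row $-(c_1,\dots,c_n)$. Let $M=\Phi(m)$ be Hurwitz, $N=\mathrm{col}(0,\dots,0,1)$, $\Theta>0$, $\varrho=m-a(\sigma)$. Let $T$ be the inverse of the matrix with rows $\varrho^T[\Phi(a)+I]\Phi(a)^k$, $k=0,\dots,n-1$. Put $\theta(\mu)=T\,\mathrm{col}(\mathbf u,\dot{\mathbf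 u},\dots,\mathbf u^{(n-1)})$, with time derivatives along the exosystem, and $\varpi(\mu)=\varrho^T\theta(\mu)$. Let $\chi(\eta,\vartheta)=\vartheta^T[\Phi(m-\vartheta)+I]\eta$, and let $\chi_s:\mathbb R^{2n}\to\mathbb R$ be a smooth function that equals $\chi$ on a compact set $\mathbb D$ containing all $(\theta(\mu),\varrho)$, $\mu\in\mathbb V\times\mathbb S\times\mathbb W$, and vanishes where $\|\mathrm{col}(\eta,\vartheta)\|^2\ge1+\max_{\mathbb D}\|\mathrm{col}(\eta,\vartheta)\|^2$. With the internal model $\dot\eta=M\eta+N\pi$, $\dot\pi=-\pi+u$, $\dot\vartheta=-\Theta\eta(\eta^T\vartheta-\pi)$ and the coordinates $\bar z=z-\mathbf z$, $\bar\eta=\eta-\theta$, $\bar\pi=\pi-\varpi-b^{-1}e$, $\bar\vartheta=\vartheta-\varrho$, $\bar u=u-\chi_s(\eta,\vartheta)$, the augmented error system is $$\dot{\bar z}=F(w)\bar z+\bar G,\quad \dot{\bar\eta}=M\bar\eta+N(\bar\pi+b^{-1}e),\quad \dot{\bar\pi}=-\bar\pi-\bar\delta,\quad \dot{\bar\vartheta}=-\Theta\theta\theta^T\bar\vartheta+\bar\gamma,\quad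 \dot e=\bar g+b\bar u,$$ where $\bar G=G(q+e,v,w)(q+e)-G(q,v,w)q$, $\bar K=K(q+e,v,w)(q+e)-K(q,v,w)q$, $\bar\delta=b^{-1}[e+H\bar z+\bar K]+\frac{\partial b^{-1}}{\partial v}S(\sigma)v\,e$, $$\bar\gamma=\Theta\bar\eta[\bar\pi+\varpi+b^{-1}e]+\Theta\theta[\bar\pi+b^{-1}e]-\Theta\theta\bar\eta^T\bar\vartheta-\Theta\bar\eta(\bar\eta+\theta)^T\bar\vartheta-\Theta\bar\eta(\bar\eta+\theta)^T\varrho-\Theta\theta\bar\eta^T\varrho,$$ and $\bar g=H\bar z+\bar K+b[\chi_s(\bar\eta+\theta,\bar\vartheta+\varrho)-\chi_s(\theta,\varrho)]$. A function on $[0,\infty)$ is of class $\mathcal K$ if it is continuous, strictly increasing and zero at $0$; $\mathcal K_o$ and $\mathcal K_\infty$ are the bounded and the unbounded class $\mathcal K$ functions. A dot on $V_i$ denotes the derivative along the indicated subsystem, evaluated at arbitrary values of the remaining variables. **Lemma.** There are positive constants $\underline\alpha_0,\bar\alpha_0,\underline\alpha_1,\bar\alpha_1,\alpha_0,\alpha_1,\beta_1,\phi_0,\phi_1,\phi_2,c_1,\dots,c_4$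 and functions $\underline\alpha_2,\bar\alpha_2,\delta_2,\delta_3\in\mathcal K_\infty$, $\alpha_2\in\mathcal K_o$, $\delta_0,\delta_1\in\mathcal K$ and a smooth $\delta_5\in\mathcal K$, none of them depending on $(v,\sigma,w)\in\mathbb V\times\mathbb S\times\mathbb W$, together with quadratic forms $V_0(\bar z)$ (which may depend on $w$) and $V_1(\bar\xi)$, $\bar\xi=\mathrm{col}(\bar\eta,\bar\pi)$, and, for each exosystem solution $v(t)$ with $v(0)\in\mathbb V$, $\sigma\in\mathbb S$, and each $w\in\mathbb W$, a smooth function $W(t,\bar\vartheta)$, such that the following holds with $V_2(t,\bar\vartheta)=\ln(W(t,\bar\vartheta)+1)$, for all $t\ge0$ and all values of $\bar z,\bar\eta,\bar\pi,\bar\vartheta,e$: * $\underline\alpha_0\|\bar z\|^2\le V_0\le\bar\alpha_0\|\bar z\|^2$ and, along the $\bar z$-subsystem, $\dot V_0\le-\alpha_0V_0+\delta_0(e^2)$; * $\underline\alpha_1\|\bar\xi\|^2\le V_1\le\bar\alpha_1\|\bar\xi\|^2$ and, along the $(\bar\eta,\bar\pi)$-subsystem, $\dot V_1\le-\alpha_1V_1+\beta_1V_0+\delta_1(e^2)$;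 * $c_1\|\bar\vartheta\|^2\le W\le c_2\|\bar\vartheta\|^2$, $\|\partial W/\partial\bar\vartheta\|\le c_3\|\bar\vartheta\|$, $\frac{\partial W}{\partial t}-\frac{\partial W}{\partial\bar\vartheta}\Theta\theta\theta^T\bar\vartheta\le-c_4\|\bar\vartheta\|^2$; * $V_2$ is smooth, $\underline\alpha_2(\|\bar\vartheta\|^2)\le V_2\le\bar\alpha_2(\|\bar\vartheta\|^2)$ and, along the $\bar\vartheta$-subsystem, $\dot V_2\le-\alpha_2(V_2)+\delta_3(V_1)+\delta_2(e^2)$; * $\|\bar g\|^2\le\phi_0V_0+\phi_1V_1+\phi_2\alpha_2(V_2)+\delta_5(e^2)$. Moreover, for each such $v(t),\sigma,w$ the $\bar\vartheta$-subsystem, as a time-varying system on $t\ge0$ with state $\bar\vartheta$ and input $(\bar\eta,\bar\pi,e)$, is integral input-to-state stable but not input-to-state stable. -/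

import Mathlib

open Set Filter Topology MeasureTheory
open scoped ContDiff Matrix

/-- `ℝⁿ` with the Euclidean norm. -/
abbrev Vec (n : ℕ) : Type := EuclideanSpace ℝ (Fin n)

/-- The product of a square matrix and a column vector. -/
def mulE {n : ℕ} (A : Matrix (Fin n) (Fin n) ℝ) (x : Vec n) : Vec n :=
  WithLp.toLp 2 (A *ᵥ x.ofLp)

/-- All complex eigenvalues have negative real part. -/
def IsHurwitz {n : ℕ} (A : Matrix (Fin n) (Fin n) ℝ) : Prop :=
  ∀ z ∈ (A.map (algebraMap ℝ ℂ)).charpoly.roots, z.re < 0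

/-- The complex eigenvalues are pairwise distinct and have zero real part. -/
def HasDistinctImaginaryEigenvalues {n : ℕ} (A : Matrix (Fin n) (Fin n) ℝ) : Prop :=
  (A.map (algebraMap ℝ ℂ)).charpoly.roots.Nodup ∧
    ∀ z ∈ (A.map (algebraMap ℝ ℂ)).charpoly.roots, z.re = 0

/-! ### Comparison functions (functions on `[0, ∞)`; values at negative arguments play no role) -/

def IsClassK (f : ℝ → ℝ) : Prop :=
  ContinuousOn f (Ici 0) ∧ StrictMonoOn f (Ici 0) ∧ f 0 = 0

/-- Unbounded class `K` functions. -/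
def IsClassKInf (f : ℝ → ℝ) : Prop :=
  IsClassK f ∧ Tendsto f atTop atTop

/-- Bounded class `K` functions. -/
def IsClassKBdd (f : ℝ → ℝ) : Prop :=
  IsClassK f ∧ ∃ B : ℝ, ∀ s, 0 ≤ s → f s ≤ B

def IsClassKL (β : ℝ → ℝ → ℝ) : Prop :=
  ContinuousOn (fun p : ℝ × ℝ => β p.1 p.2) (Ici 0 ×ˢ Ici 0) ∧
    (∀ t, 0 ≤ t → IsClassK (fun s => β s t)) ∧
    (∀ s, 0 ≤ s → AntitoneOn (β s) (Ici 0) ∧ Tendsto (β s) atTop (𝓝 0))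

/-! ### (Integral) input-to-state stability of time-varying systems `x' = f(t, x, u)`, `t ≥ 0` -/

section ISS

variable {X U : Type*} [NormedAddCommGroup X] [NormedSpace ℝ X]
  [NormedAddCommGroup U] [MeasurableSpace U]

/-- Measurable inputs that are bounded on bounded time intervals. -/
def IsInput (u : ℝ → U) : Prop :=
  Measurable u ∧ ∀ t₀ T : ℝ, ∃ B : ℝ, ∀ s ∈ Icc t₀ T, ‖u s‖ ≤ B

/-- `x` is a (Carathéodory) solution of `x' = f(t, x, u)` on `[t₀, T]`. -/
def IsSolutionOn (f : ℝ → X → U → X) (u : ℝ → U) (x : ℝ → X) (t₀ T : ℝ) : Prop :=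
  ContinuousOn x (Icc t₀ T) ∧
    IntervalIntegrable (fun s => f s (x s) (u s)) volume t₀ T ∧
    ∀ t ∈ Icc t₀ T, x t = x t₀ + ∫ s in t₀..t, f s (x s) (u s)

/-- Input-to-state stability:
`‖x(t)‖ ≤ β(‖x(t₀)‖, t - t₀) + γ(sup_{[t₀,t]} ‖u‖)` along all solutions. -/
def IsISS (f : ℝ → X → U → X) : Prop :=
  ∃ (β : ℝ → ℝ → ℝ) (γ : ℝ → ℝ), IsClassKL β ∧ IsClassK γ ∧
    ∀ (u : ℝ → U) (x : ℝ → X) (t₀ T : ℝ), 0 ≤ t₀ → IsInput u → IsSolutionOn f u x t₀ T →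
      ∀ t ∈ Icc t₀ T, ∀ r : ℝ, (∀ s ∈ Icc t₀ t, ‖u s‖ ≤ r) →
        ‖x t‖ ≤ β ‖x t₀‖ (t - t₀) + γ r

/-- Integral input-to-state stability:
`α(‖x(t)‖) ≤ β(‖x(t₀)‖, t - t₀) + ∫_{t₀}^t γ(‖u‖)` along all solutions. -/
def IsIntegralISS (f : ℝ → X → U → X) : Prop :=
  ∃ (α : ℝ → ℝ) (β : ℝ → ℝ → ℝ) (γ : ℝ → ℝ), IsClassKInf α ∧ IsClassKL β ∧ IsClassK γ ∧
    ∀ (u : ℝ → U) (x : ℝ → X) (t₀ T : ℝ), 0 ≤ t₀ → IsInput u → IsSolutionOn f u x t₀ T →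
      ∀ t ∈ Icc t₀ T,
        α ‖x t‖ ≤ β ‖x t₀‖ (t - t₀) + ∫ s in t₀..t, γ ‖u s‖

end ISS

/-- `∂V/∂t (t, x) + ∂V/∂x (t, x) ξ`: the derivative of `V` at `(t, x)` along a system whose
velocity there is `ξ`. -/
noncomputable def dotAlong {X : Type*} [NormedAddCommGroup X] [NormedSpace ℝ X]
    (V : ℝ → X → ℝ) (t : ℝ) (x ξ : X) : ℝ :=
  deriv (fun s => V s x) t + fderiv ℝ (V t) x ξ

/-! ### The plant and the exosystem -/

/-- The plant
`z' = F(w) z + G(y,v,w) y + D₁(v,w)`, `y' = H(w) z + K(y,v,w) y + b(w,v) u + D₂(v,w)`,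
with error `e = y - q(v,w)`, and the exosystem `v' = S(σ) v`. The row vector `H(w)` is stored as a
vector, `H(w) z` being the inner product. -/
structure Plant (nz nv nw nσ : ℕ) where
  F : Vec nw → Matrix (Fin nz) (Fin nz) ℝ
  G : ℝ → Vec nv → Vec nw → Vec nz
  D₁ : Vec nv → Vec nw → Vec nz
  H : Vec nw → Vec nz
  K : ℝ → Vec nv → Vec nw → ℝ
  b : Vec nw → Vec nv → ℝ
  D₂ : Vec nv → Vec nw → ℝ
  q : Vec nv → Vec nw → ℝ
  S : Vec nσ → Matrix (Fin nv) (Fin nv) ℝ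
  smooth_F : ∀ i j, ContDiff ℝ ∞ (fun w => F w i j)
  smooth_G : ContDiff ℝ ∞ (fun p : ℝ × Vec nv × Vec nw => G p.1 p.2.1 p.2.2)
  smooth_D₁ : ContDiff ℝ ∞ (fun p : Vec nv × Vec nw => D₁ p.1 p.2)
  smooth_H : ContDiff ℝ ∞ H
  smooth_K : ContDiff ℝ ∞ (fun p : ℝ × Vec nv × Vec nw => K p.1 p.2.1 p.2.2)
  smooth_b : ContDiff ℝ ∞ (fun p : Vec nw × Vec nv => b p.1 p.2)
  smooth_D₂ : ContDiff ℝ ∞ (fun p : Vec nv × Vec nw => D₂ p.1 p.2)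
  smooth_q : ContDiff ℝ ∞ (fun p : Vec nv × Vec nw => q p.1 p.2)
  smooth_S : ∀ i j, ContDiff ℝ ∞ (fun σ => S σ i j)
  b_sq_pos : ∀ w v, 0 < b w v ^ 2
  D₁_zero : ∀ w, D₁ 0 w = 0
  D₂_zero : ∀ w, D₂ 0 w = 0
  q_zero : ∀ w, q 0 w = 0

namespace Plant

variable {nz nv nw nσ n : ℕ} (P : Plant nz nv nw nσ)

/-- `v` solves the exosystem with parameter `σ`. -/
def IsExoTrajectory (σ : Vec nσ) (v : ℝ → Vec nv) : Prop :=
  ∀ t, HasDerivAt v (mulE (P.S σ) (v t)) t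

/-- `(∂f/∂v) S(σ) v`: the time derivative of `f(v)` along the exosystem. -/
noncomputable def exoDeriv (σ : Vec nσ) (f : Vec nv → ℝ) (v : Vec nv) : ℝ :=
  fderiv ℝ f v (mulE (P.S σ) v)

/-- Minimum phase on `Ws`, and `zs(v,σ,w)` is a smooth solution of the regulator equation of the
`z`-dynamics. -/
def MinimumPhaseWith (Ws : Set (Vec nw)) (Ss : Set (Vec nσ))
    (zs : Vec nv → Vec nσ → Vec nw → Vec nz) : Prop :=
  (∀ w ∈ Ws, IsHurwitz (P.F w)) ∧
  ContDiff ℝ ∞ (fun p : Vec nv × Vec nσ × Vec nw => zs p.1 p.2.1 p.2.2) ∧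
  zs 0 0 0 = 0 ∧
  ∀ v, ∀ σ ∈ Ss, ∀ w ∈ Ws,
    fderiv ℝ (fun v' => zs v' σ w) v (mulE (P.S σ) v) =
      mulE (P.F w) (zs v σ w) + P.q v w • P.G (P.q v w) v w + P.D₁ v w

/-- The steady-state input `u(v,σ,w)`. -/
noncomputable def uss (zs : Vec nv → Vec nσ → Vec nw → Vec nz)
    (v : Vec nv) (σ : Vec nσ) (w : Vec nw) : ℝ :=
  (P.b w v)⁻¹ * (P.exoDeriv σ (fun v' => P.q v' w) v - inner ℝ (P.H w) (zs v σ w)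
    - P.K (P.q v w) v w * P.q v w - P.D₂ v w)

/-- `u(v,σ,w)` is a polynomial in `v`. -/
def SteadyInputPolynomial (Ws : Set (Vec nw)) (Ss : Set (Vec nσ))
    (zs : Vec nv → Vec nσ → Vec nw → Vec nz) : Prop :=
  ∀ w ∈ Ws, ∀ σ ∈ Ss, ∃ p : MvPolynomial (Fin nv) ℝ,
    ∀ v : Vec nv, P.uss zs v σ w = MvPolynomial.eval v.ofLp p

/-- Along every exosystem trajectory issued from `Vs`, the steady-state input is a sum of `n`
exponentials `Cᵢ e^{i ωᵢ t}`, with distinct real frequencies `ωᵢ = ωᵢ(σ)` and nonzero coefficients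
`Cᵢ = Cᵢ(v(0),w,σ)`. -/
def AllModesExcited (Vs : Set (Vec nv)) (Ws : Set (Vec nw)) (Ss : Set (Vec nσ))
    (zs : Vec nv → Vec nσ → Vec nw → Vec nz) (freq : Vec nσ → Fin n → ℝ) : Prop :=
  ∀ σ ∈ Ss, Function.Injective (freq σ) ∧
    ∀ w ∈ Ws, ∀ v : ℝ → Vec nv, P.IsExoTrajectory σ v → v 0 ∈ Vs →
      ∃ C : Fin n → ℂ, (∀ i, C i ≠ 0) ∧
        ∀ t : ℝ, (P.uss zs (v t) σ w : ℂ) =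
          ∑ i, C i * Complex.exp (Complex.I * (freq σ i : ℂ) * (t : ℂ))

end Plant

/-! ### The internal model -/

/-- The companion matrix with last row `-(a₁, …, aₙ)`. -/
def companionOf {n : ℕ} (a : Vec n) : Matrix (Fin n) (Fin n) ℝ :=
  Matrix.of fun i j =>
    if (i : ℕ) + 1 = n then - a j else if (j : ℕ) = (i : ℕ) + 1 then 1 else 0

/-- `N = col(0, …, 0, 1)`. -/
def lastVec (n : ℕ) : Vec n :=
  WithLp.toLp 2 fun i => if (i : ℕ) + 1 = n then 1 else 0

/-- The coefficients `a₁, …, aₙ` of the monic polynomial `sⁿ + a₁ + a₂ s + ⋯ + aₙ sⁿ⁻¹` with roots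
`i ω₁, …, i ωₙ`. For the frequencies of a real signal these coefficients are real, and they are the
only ones for which every sum of `n` exponentials with these frequencies and nonzero coefficients
solves `u⁽ⁿ⁾ + a₁ u + a₂ u' + ⋯ + aₙ u⁽ⁿ⁻¹⁾ = 0`. -/
noncomputable def genCoeff {n : ℕ} (f : Fin n → ℝ) : Vec n :=
  WithLp.toLp 2 fun j =>
    ((∏ i, (Polynomial.X - Polynomial.C (Complex.I * (f i : ℂ)))).coeff (j : ℕ)).re

/-- `χ(η, ϑ) = ϑᵀ [Φ(m - ϑ) + I] η`. -/
noncomputable def chiFun {n : ℕ} (m η ϑ : Vec n) : ℝ :=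
  inner ℝ ϑ (mulE (companionOf (m - ϑ) + 1) η)

/-- A plant together with the data of the internal model design: the steady state `zs(v,σ,w)`, the
frequencies `freq σ` of the steady-state input, the vector `m`, the gain `Θ` and the saturated
function `chiS`. -/
structure RegSetup (nz nv nw nσ n : ℕ) extends Plant nz nv nw nσ where
  zs : Vec nv → Vec nσ → Vec nw → Vec nz
  freq : Vec nσ → Fin n → ℝ
  m : Vec n
  Θ : ℝ
  chiS : Vec n → Vec n → ℝ

namespace RegSetup

variable {nz nv nw nσ n : ℕ} (R : RegSetup nz nv nw nσ n)

noncomputable def a (σ : Vec nσ) : Vec n := genCoeff (R.freq σ)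

noncomputable def Φ (σ : Vec nσ) : Matrix (Fin n) (Fin n) ℝ := companionOf (R.a σ)

def M : Matrix (Fin n) (Fin n) ℝ := companionOf R.m

/-- `ϱ = m - a(σ)`. -/
noncomputable def rho (σ : Vec nσ) : Vec n := R.m - R.a σ

/-- The matrix with rows `ϱᵀ (Φ + I) Φᵏ`, `k = 0, …, n-1`. -/
noncomputable def Tinv (σ : Vec nσ) : Matrix (Fin n) (Fin n) ℝ :=
  Matrix.of fun k j => ((R.rho σ).ofLp ᵥ* ((R.Φ σ + 1) * R.Φ σ ^ (k : ℕ))) j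

noncomputable def T (σ : Vec nσ) : Matrix (Fin n) (Fin n) ℝ := (R.Tinv σ)⁻¹

/-- `ξ(μ) = col(u, du/dt, …, dⁿ⁻¹u/dtⁿ⁻¹)`, time derivatives taken along the exosystem. -/
noncomputable def xi (v : Vec nv) (σ : Vec nσ) (w : Vec nw) : Vec n :=
  WithLp.toLp 2 fun k =>
    ((R.exoDeriv σ)^[(k : ℕ)] (fun v' => R.uss R.zs v' σ w)) v

/-- `θ(μ) = T ξ(μ)`. -/
noncomputable def theta (v : Vec nv) (σ : Vec nσ) (w : Vec nw) : Vec n :=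
  mulE (R.T σ) (R.xi v σ w)

/-- `ϖ(μ) = ϱᵀ θ(μ)`. -/
noncomputable def varpi (v : Vec nv) (σ : Vec nσ) (w : Vec nw) : ℝ :=
  inner ℝ (R.rho σ) (R.theta v σ w)

/-- `chiS` is a smooth function which agrees with `χ` on a compact set `D` that contains every
`(θ(μ), ϱ)`, and which vanishes where `‖col(η,ϑ)‖² ≥ δ + 1`, with `δ = max_D ‖col(η,ϑ)‖²`. -/
def IsSaturation (Vs : Set (Vec nv)) (Ws : Set (Vec nw)) (Ss : Set (Vec nσ)) : Prop :=
  ContDiff ℝ ∞ (fun p : Vec n × Vec n => R.chiS p.1 p.2) ∧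
  ∃ (D : Set (Vec n × Vec n)) (δ : ℝ), IsCompact D ∧
    (∀ v ∈ Vs, ∀ σ ∈ Ss, ∀ w ∈ Ws, (R.theta v σ w, R.rho σ) ∈ D) ∧
    IsGreatest ((fun p : Vec n × Vec n => ‖p.1‖ ^ 2 + ‖p.2‖ ^ 2) '' D) δ ∧
    (∀ p ∈ D, R.chiS p.1 p.2 = chiFun R.m p.1 p.2) ∧
    (∀ η ϑ : Vec n, δ + 1 ≤ ‖η‖ ^ 2 + ‖ϑ‖ ^ 2 → R.chiS η ϑ = 0)

/-! ### The augmented error system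

In the coordinates `z̄ = z - z(μ)`, `η̄ = η - θ(μ)`, `π̄ = π - ϖ(μ) - b⁻¹ e`, `ϑ̄ = ϑ - ϱ`,
`e = y - q`, with `μ = (v,σ,w)`. -/

/-- `G(q+e,v,w)(q+e) - G(q,v,w) q`: the contribution of `e` to the `z̄`-dynamics. -/
noncomputable def Gbar (e : ℝ) (v : Vec nv) (w : Vec nw) : Vec nz :=
  (R.q v w + e) • R.G (R.q v w + e) v w - R.q v w • R.G (R.q v w) v w

/-- `K(q+e,v,w)(q+e) - K(q,v,w) q`. -/
noncomputable def Kbar (e : ℝ) (v : Vec nv) (w : Vec nw) : ℝ :=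
  R.K (R.q v w + e) v w * (R.q v w + e) - R.K (R.q v w) v w * R.q v w

noncomputable def epsBar (π e : ℝ) (v : Vec nv) (w : Vec nw) : Vec n :=
  (π + (R.b w v)⁻¹ * e) • lastVec n

noncomputable def deltaBar (z : Vec nz) (e : ℝ) (v : Vec nv) (σ : Vec nσ) (w : Vec nw) : ℝ :=
  (R.b w v)⁻¹ * (e + inner ℝ (R.H w) z + R.Kbar e v w)
    + R.exoDeriv σ (fun v' => (R.b w v')⁻¹) v * e

noncomputable def gammaBar (η : Vec n) (π e : ℝ) (ϑ : Vec n)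
    (v : Vec nv) (σ : Vec nσ) (w : Vec nw) : Vec n :=
  (R.Θ * (π + R.varpi v σ w + (R.b w v)⁻¹ * e)) • η
    + (R.Θ * (π + (R.b w v)⁻¹ * e)) • R.theta v σ w
    - (R.Θ * inner ℝ η ϑ) • R.theta v σ w
    - (R.Θ * inner ℝ (η + R.theta v σ w) ϑ) • η
    - (R.Θ * inner ℝ (η + R.theta v σ w) (R.rho σ)) • η
    - (R.Θ * inner ℝ η (R.rho σ)) • R.theta v σ w

noncomputable def chiBar (η ϑ : Vec n) (v : Vec nv) (σ : Vec nσ) (w : Vec nw) : ℝ :=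
  R.chiS (η + R.theta v σ w) (ϑ + R.rho σ) - R.chiS (R.theta v σ w) (R.rho σ)

/-- `ḡ`, the drift of `e' = ḡ + b(μ) ū`. -/
noncomputable def gBar (z : Vec nz) (e : ℝ) (η ϑ : Vec n)
    (v : Vec nv) (σ : Vec nσ) (w : Vec nw) : ℝ :=
  inner ℝ (R.H w) z + R.Kbar e v w + R.b w v * R.chiBar η ϑ v σ w

/-- Right-hand side of the `z̄`-equation. -/
noncomputable def zRhs (z : Vec nz) (e : ℝ) (v : Vec nv) (w : Vec nw) : Vec nz :=
  mulE (R.F w) z + R.Gbar e v w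

/-- Right-hand side of the `η̄`-equation. -/
noncomputable def etaRhs (η : Vec n) (π e : ℝ) (v : Vec nv) (w : Vec nw) : Vec n :=
  mulE R.M η + R.epsBar π e v w

/-- Right-hand side of the `π̄`-equation. -/
noncomputable def piRhs (z : Vec nz) (π e : ℝ) (v : Vec nv) (σ : Vec nσ) (w : Vec nw) : ℝ :=
  -π - R.deltaBar z e v σ w

/-- Right-hand side of the `ϑ̄`-equation. -/
noncomputable def thetaRhs (η : Vec n) (π e : ℝ) (ϑ : Vec n)
    (v : Vec nv) (σ : Vec nσ) (w : Vec nw) : Vec n :=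
  -((R.Θ * inner ℝ (R.theta v σ w) ϑ) • R.theta v σ w) + R.gammaBar η π e ϑ v σ w

/-- The `ϑ̄`-subsystem along the exosystem signal `v(t)`: state `ϑ̄`, input `(η̄, π̄, e)`. -/
noncomputable def thetaSystem (v : ℝ → Vec nv) (σ : Vec nσ) (w : Vec nw) :
    ℝ → Vec n → Vec n × ℝ × ℝ → Vec n :=
  fun t ϑ u => R.thetaRhs u.1 u.2.1 u.2.2 ϑ (v t) σ w

end RegSetup

/-- `V(t, x) = ln(W(t, x) + 1)`. -/
noncomputable def logLyap {X : Type*} (W : ℝ → X → ℝ) : ℝ → X → ℝ :=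
  fun t x => Real.log (W t x + 1)

/-! The `z̄` and `(η̄, π̄)` equations are Hurwitz linear systems driven by terms that vanish with
`e` (and, for `π̄`, also with `z̄`). Quadratic Lyapunov functions and completed squares settle them.
Uniformity in the parameters comes from compactness, and increments in `e` are bounded by `e² g(e²)`
with one smooth monotone `g` (`exists_increment_bound`).

The difficulty is the `ϑ̄` equation. Its unforced part `ϑ' = -Θ θ θᵀ ϑ` is a gradient system,
uniformly exponentially stable because `θ` is persistently exciting. Indeed `θ = T ξ`, where `ξ` is
the jet of the steady-state input. If `xᵀ ξ` vanishes on an interval, independence of exponentials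
and `Cᵢ ≠ 0` make the polynomial of degree `< n` with coefficients `x` vanish at `n` distinct
points, so `x = 0`. The matrix `T` is invertible by the same polynomial argument
(`isUnit_det_Tinv`). A compactness argument turns this into a uniform level `ε`
(`exists_uniform_excitation`). It needs `θ` to be continuous in `σ`, although nothing is assumed on
how the frequencies vary: `continuous_a` recovers `a(σ)` from an invertible Gram system.

Excitation yields the strict Lyapunov function `W = κ‖ϑ‖² - ∫ₜᵗ⁺¹ (t+1-s)(θ(s)ᵀϑ)² ds`:
differentiating the window produces `-∫ (θᵀϑ)² ≤ -ε‖ϑ‖²`, and a large `κ` absorbs the terms in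
`(θ(t)ᵀϑ)²`. The perturbation `γ̄` is affine in `ϑ̄`, so with `s` the size of the input `W' ≤ -kW +
Q(s + s²)(W + 1)`. Division by `W + 1` gives the estimate for `V₂ = ln(W + 1)` with the bounded rate
`k W/(W+1) = k(1 - e^{-V₂})`. The same inequality gives integral input-to-state stability
(`isIntegralISS_of_dissipation`). Input-to-state stability fails because the bounded input `(-θ, 0,
0)`, that is `η = 0`, stops the adaptation at every `ϑ̄`.

Finally `χ_s` has compact support, hence is both bounded and Lipschitz, so its increment can be
estimated by the bounded function `W/(W+1)`. -/

/-! ### Quadratic Lyapunov functions of Hurwitz matrices -/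

/-- The continuous linear map of a real square matrix on Euclidean space. -/
noncomputable def mulCLM {n : ℕ} (A : Matrix (Fin n) (Fin n) ℝ) : Vec n →L[ℝ] Vec n :=
  Matrix.toEuclideanCLM (𝕜 := ℝ) A

theorem mulCLM_apply {n : ℕ} (A : Matrix (Fin n) (Fin n) ℝ) (x : Vec n) :
    mulCLM A x = mulE A x := rfl

theorem continuous_mulCLM {n : ℕ} :
    Continuous (mulCLM : Matrix (Fin n) (Fin n) ℝ → Vec n →L[ℝ] Vec n) := by
  let L : Matrix (Fin n) (Fin n) ℝ →ₗ[ℝ] (Vec n →L[ℝ] Vec n) :=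
    (Matrix.toEuclideanCLM (𝕜 := ℝ) (n := Fin n)).toAlgEquiv.toLinearMap
  exact L.continuous_of_finiteDimensional

attribute [local instance] Matrix.linftyOpNormedRing Matrix.linftyOpNormedAlgebra in
/-- The powers of a complex matrix with spectrum in the open unit disc converge to zero. -/
theorem tendsto_pow_of_spectrum_lt_one {n : ℕ} (B : Matrix (Fin n) (Fin n) ℂ)
    (hB : ∀ z ∈ spectrum ℂ B, ‖z‖ < 1) : Tendsto (fun k : ℕ => B ^ k) atTop (𝓝 0) := by
  rcases Nat.eq_zero_or_pos n with rfl | hn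
  · have : (fun k : ℕ => B ^ k) = fun _ => 0 := funext fun k => Subsingleton.elim _ _
    rw [this]; exact tendsto_const_nhds
  have : Nonempty (Fin n) := ⟨⟨0, hn⟩⟩
  have hr : spectralRadius ℂ B < (1 : NNReal) :=
    spectrum.spectralRadius_lt_of_forall_lt B (fun z hz => by
      rw [← NNReal.coe_lt_coe]; simpa using hB z hz)
  obtain ⟨r, hr1, hr2⟩ := ENNReal.lt_iff_exists_nnreal_btwn.1 hr
  have hr2' : r < 1 := by exact_mod_cast hr2
  -- Gelfand's formula: eventually `‖B ^ k‖ ^ (1/k) < r`, that is `‖B ^ k‖ ≤ r ^ k` with `r < 1`.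
  have h := (spectrum.pow_nnnorm_pow_one_div_tendsto_nhds_spectralRadius B).eventually_lt_const hr1
  refine tendsto_zero_iff_norm_tendsto_zero.2 ?_
  refine squeeze_zero' (Eventually.of_forall fun _ => norm_nonneg _) (g := fun k => (r : ℝ) ^ k) ?_
    (tendsto_pow_atTop_nhds_zero_of_lt_one r.2 hr2')
  filter_upwards [h, eventually_gt_atTop 0] with k hk hk0
  have hk0' : (0 : ℝ) < k := by exact_mod_cast hk0
  have h2 : ((‖B ^ k‖₊ : ENNReal) ^ (1 / k : ℝ)) ^ (k : ℝ) ≤ (r : ENNReal) ^ (k : ℝ) :=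
    ENNReal.rpow_le_rpow hk.le hk0'.le
  rw [← ENNReal.rpow_mul, one_div_mul_cancel hk0'.ne', ENNReal.rpow_one, ENNReal.rpow_natCast] at h2
  have : ‖B ^ k‖₊ ≤ r ^ k := by exact_mod_cast h2
  exact_mod_cast this

/-- A small Euler step of a Hurwitz matrix has its spectrum in the open unit disc. -/
theorem IsHurwitz.exists_euler_step {n : ℕ} {A : Matrix (Fin n) (Fin n) ℝ} (hA : IsHurwitz A) :
    ∃ h : ℝ, 0 < h ∧ Tendsto (fun k : ℕ => (1 + h • A) ^ k) atTop (𝓝 0) := by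
  set Ac := A.map (algebraMap ℝ ℂ) with hAc
  have hh : ∀ᶠ h : ℝ in 𝓝[>] 0, ∀ z ∈ Ac.charpoly.roots.toFinset, ‖1 + (h : ℂ) * z‖ < 1 := by
    rw [Filter.eventually_all_finset]
    intro z hz
    have hz' : z.re < 0 := hA z (Multiset.mem_toFinset.1 hz)
    -- Since `‖1 + h z‖² = 1 + h (2 Re z + h |z|²)`, it suffices that the bracket is negative, which
    -- holds for small `h > 0`.
    have hc : Tendsto (fun h : ℝ => 2 * z.re + h * Complex.normSq z) (𝓝[>] 0) (𝓝 (2 * z.re)) := by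
      have : Continuous (fun h : ℝ => 2 * z.re + h * Complex.normSq z) := by fun_prop
      simpa using (this.tendsto 0).mono_left nhdsWithin_le_nhds
    filter_upwards [hc.eventually_lt_const (show 2 * z.re < 0 by linarith), self_mem_nhdsWithin]
      with h h1 h2
    have h2 : 0 < h := h2
    have : ‖1 + (h : ℂ) * z‖ ^ 2 < 1 := by
      rw [← Complex.normSq_eq_norm_sq, Complex.normSq_apply]
      rw [Complex.normSq_apply] at h1
      simp only [Complex.add_re, Complex.one_re, Complex.mul_re, Complex.ofReal_re,
        Complex.ofReal_im, Complex.add_im, Complex.one_im, Complex.mul_im]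
      nlinarith
    nlinarith [norm_nonneg (1 + (h : ℂ) * z)]
  obtain ⟨h, hh, hpos⟩ := (hh.and self_mem_nhdsWithin).exists
  refine ⟨h, hpos, ?_⟩
  have hB : Tendsto (fun k : ℕ => (1 + (h : ℂ) • Ac) ^ k) atTop (𝓝 0) := by
    apply tendsto_pow_of_spectrum_lt_one
    intro z hz
    rw [show (1 + (h : ℂ) • Ac) = algebraMap ℂ _ 1 + (h : ℂ) • Ac by simp,
      ← spectrum.singleton_add_eq] at hz
    have hne : (h : ℂ) ≠ 0 := by exact_mod_cast (ne_of_gt hpos)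
    obtain ⟨a, ha, y, hy, rfl⟩ := hz
    rw [Set.mem_singleton_iff] at ha
    subst ha
    have : (h : ℂ) • Ac = (Units.mk0 (h : ℂ) hne) • Ac := rfl
    rw [this, spectrum.unit_smul_eq_smul] at hy
    obtain ⟨l, hl, rfl⟩ := hy
    rw [Matrix.mem_spectrum_iff_isRoot_charpoly] at hl
    exact hh l (by
      rw [Multiset.mem_toFinset, Polynomial.mem_roots (Matrix.charpoly_monic _).ne_zero]
      exact hl)
  have hmap : ∀ k : ℕ, (1 + (h : ℂ) • Ac) ^ k = ((1 + h • A) ^ k).map (algebraMap ℝ ℂ) := by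
    intro k
    have : (1 + (h : ℂ) • Ac) = (algebraMap ℝ ℂ).mapMatrix (1 + h • A) := by
      ext i j
      simp [hAc, Matrix.one_apply, apply_ite (fun x : ℝ => (x : ℂ))]
    rw [this, ← map_pow]; rfl
  have := (Continuous.matrix_map (continuous_id (X := Matrix (Fin n) (Fin n) ℂ))
    Complex.continuous_re).continuousAt.tendsto.comp hB
  refine (this.congr fun k => ?_).trans (by simp)
  ext i j
  rw [Function.comp_apply, hmap]
  simp

/-- Lyapunov's theorem: a Hurwitz matrix admits a quadratic Lyapunov function. -/
theorem IsHurwitz.exists_lyapunov {n : ℕ} {A : Matrix (Fin n) (Fin n) ℝ} (hA : IsHurwitz A) :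
    ∃ (b : Vec n →L[ℝ] Vec n →L[ℝ] ℝ) (c : ℝ), 0 < c ∧ (∀ x y, b x y = b y x) ∧
      (∀ x, ‖x‖ ^ 2 ≤ b x x) ∧ ∀ x, 2 * b x (mulE A x) ≤ -c * ‖x‖ ^ 2 := by
  obtain ⟨h, hpos, hlim⟩ := hA.exists_euler_step
  set B : Vec n →L[ℝ] Vec n := mulCLM (1 + h • A) with hB
  have hBk : ∀ k : ℕ, B ^ k = mulCLM ((1 + h • A) ^ k) := fun k => by
    rw [hB]; exact (map_pow (Matrix.toEuclideanCLM (𝕜 := ℝ) (n := Fin n)) _ k).symm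
  have hlimB : Tendsto (fun k : ℕ => ‖B ^ k‖) atTop (𝓝 0) := by
    have := (continuous_mulCLM (n := n)).norm.continuousAt.tendsto.comp hlim
    simp only [hBk]
    refine this.trans ?_
    have h0 : mulCLM (0 : Matrix (Fin n) (Fin n) ℝ) = 0 :=
      map_zero (Matrix.toEuclideanCLM (𝕜 := ℝ) (n := Fin n))
    simp [h0]
  obtain ⟨N, hN, hN1⟩ := ((hlimB.eventually_lt_const (show (0 : ℝ) < 1 / 2 by norm_num)).and
    (eventually_ge_atTop 1)).exists
  let ip : Vec n →L[ℝ] Vec n →L[ℝ] ℝ := innerSL ℝ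
  -- A finite sum over Euler steps replaces the usual integral over `e^{tA}`. It telescopes:
  -- `b(Bx,Bx) - b(x,x) = ‖B^N x‖² - ‖x‖² ≤ -(3/4)‖x‖²`. With `B = 1 + hA` the left side is `2h
  -- b(x,Ax) + h² b(Ax,Ax)`, whose last term is nonnegative; hence the rate `3/(4h)`. The term `k =
  -- 0`, present as `N ≥ 1`, gives `‖x‖² ≤ b(x,x)`.
  let b : Vec n →L[ℝ] Vec n →L[ℝ] ℝ := ∑ k ∈ Finset.range N, ip.bilinearComp (B ^ k) (B ^ k)
  have hb : ∀ x y, b x y = ∑ k ∈ Finset.range N, inner ℝ ((B ^ k) x) ((B ^ k) y) := by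
    intro x y
    simp only [b, ip, _root_.sum_apply, ContinuousLinearMap.bilinearComp_apply]
    rfl
  have hBx : ∀ x, B x = x + h • mulE A x := by
    intro x
    have : B = 1 + h • mulCLM A := by
      rw [hB]
      simp [mulCLM]
    rw [this]; simp [mulCLM_apply]
  have hsymm : ∀ x y, b x y = b y x := fun x y => by
    simp only [hb]; exact Finset.sum_congr rfl fun k _ => real_inner_comm _ _
  have hnn : ∀ x, 0 ≤ b x x := fun x => by
    rw [hb]; exact Finset.sum_nonneg fun k _ => real_inner_self_nonneg
  refine ⟨b, 3 / (4 * h), by positivity, hsymm, ?_, ?_⟩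
  · intro x
    rw [hb]
    have := Finset.single_le_sum (f := fun k => inner ℝ ((B ^ k) x) ((B ^ k) x))
      (fun k _ => real_inner_self_nonneg) (Finset.mem_range.2 (show 0 < N by omega))
    simpa [real_inner_self_eq_norm_sq] using this
  · intro x
    have h1 : b (B x) (B x) = b x x - ‖x‖ ^ 2 + ‖(B ^ N) x‖ ^ 2 := by
      simp only [hb, real_inner_self_eq_norm_sq]
      have h2 : ∀ k, ‖(B ^ k) (B x)‖ ^ 2 = ‖(B ^ (k + 1)) x‖ ^ 2 := fun k => by
        rw [pow_succ]; rfl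
      simp only [h2]
      have h3 := Finset.sum_range_succ (fun k => ‖(B ^ k) x‖ ^ 2) N
      have h4 := Finset.sum_range_succ' (fun k => ‖(B ^ k) x‖ ^ 2) N
      simp only [pow_zero, one_apply_eq_self] at h4
      linarith
    have h2 : ‖(B ^ N) x‖ ^ 2 ≤ 1 / 4 * ‖x‖ ^ 2 := by
      have h3 : ‖(B ^ N) x‖ ≤ 1 / 2 * ‖x‖ :=
        ((B ^ N).le_opNorm x).trans (by gcongr)
      calc _ ≤ (1 / 2 * ‖x‖) ^ 2 := by gcongr
        _ = _ := by ring
    have h3 : b (B x) (B x) = b x x + 2 * h * b x (mulE A x)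
        + h ^ 2 * b (mulE A x) (mulE A x) := by
      rw [hBx]
      simp only [map_add, add_apply, map_smul, smul_apply,
        smul_eq_mul, hsymm (mulE A x) x]
      ring
    have h4 : 2 * h * b x (mulE A x) ≤ -(3 / 4) * ‖x‖ ^ 2 := by
      have := mul_nonneg (sq_nonneg h) (hnn (mulE A x))
      nlinarith
    have : 2 * b x (mulE A x) = (2 * h * b x (mulE A x)) / h := by field_simp
    rw [this, div_le_iff₀ hpos]
    calc _ ≤ _ := h4
      _ = _ := by field_simp

/-- A continuous family of Hurwitz matrices over a compact set admits quadratic Lyapunov functions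
with uniform constants. -/
theorem exists_uniform_lyapunov {Y : Type*} [TopologicalSpace Y] {n : ℕ}
    {A : Y → Matrix (Fin n) (Fin n) ℝ} (hAc : Continuous A) {K : Set Y} (hK : IsCompact K)
    (hA : ∀ w ∈ K, IsHurwitz (A w)) :
    ∃ (b : Y → Vec n →L[ℝ] Vec n →L[ℝ] ℝ) (c C : ℝ), 0 < c ∧ 0 < C ∧ (∀ w x y, b w x y = b w y x) ∧
      ∀ w ∈ K, ‖b w‖ ≤ C ∧ (∀ x, ‖x‖ ^ 2 ≤ b w x x) ∧
        ∀ x, 2 * b w x (mulE (A w) x) ≤ -c * ‖x‖ ^ 2 := by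
  classical
  refine hK.induction_on (p := fun s => ∃ (b : Y → Vec n →L[ℝ] Vec n →L[ℝ] ℝ) (c C : ℝ), 0 < c ∧
    0 < C ∧ (∀ w x y, b w x y = b w y x) ∧ ∀ w ∈ s, ‖b w‖ ≤ C ∧ (∀ x, ‖x‖ ^ 2 ≤ b w x x) ∧
        ∀ x, 2 * b w x (mulE (A w) x) ≤ -c * ‖x‖ ^ 2) ?_ ?_ ?_ ?_
  · exact ⟨0, 1, 1, one_pos, one_pos, by simp, by simp⟩
  · rintro s t hst ⟨b, c, C, hc, hC, hs, h⟩
    exact ⟨b, c, C, hc, hC, hs, fun w hw => h w (hst hw)⟩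
  · rintro s t ⟨b, c, C, hc, hC, hs, h⟩ ⟨b', c', C', hc', hC', hs', h'⟩
    -- The form is glued by cases: no continuity in the parameter is needed, only common constants.
    refine ⟨fun w => if w ∈ s then b w else b' w, min c c', max C C', lt_min hc hc',
      lt_max_of_lt_left hC, ?_, ?_⟩
    · intro w x y
      dsimp only
      split_ifs
      exacts [hs w x y, hs' w x y]
    · intro w hw
      dsimp only
      split_ifs with hws
      · obtain ⟨h1, h2, h3⟩ := h w hws
        refine ⟨h1.trans (le_max_left _ _), h2, fun x => (h3 x).trans ?_⟩
        nlinarith [min_le_left c c', sq_nonneg ‖x‖]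
      · obtain ⟨h1, h2, h3⟩ := h' w (hw.resolve_left hws)
        refine ⟨h1.trans (le_max_right _ _), h2, fun x => (h3 x).trans ?_⟩
        nlinarith [min_le_right c c', sq_nonneg ‖x‖]
  · intro w hw
    obtain ⟨b, c, hc, hs, hpos, hle⟩ := (hA w hw).exists_lyapunov
    -- A form that works at `w` still works nearby, with half the decay rate.
    have hlim : Tendsto (fun w' => 2 * ‖b‖ * ‖mulCLM (A w') - mulCLM (A w)‖) (𝓝 w) (𝓝 0) := by
      have : Continuous fun w' => 2 * ‖b‖ * ‖mulCLM (A w') - mulCLM (A w)‖ :=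
        continuous_const.mul ((continuous_mulCLM.comp hAc).sub continuous_const).norm
      simpa using this.tendsto w
    refine ⟨_, mem_nhdsWithin_of_mem_nhds (hlim.eventually_lt_const (half_pos hc)),
      fun _ => b, c / 2, ‖b‖ + 1, half_pos hc, by positivity, fun _ => hs, fun w' hw' =>
      ⟨by linarith, hpos, fun x => ?_⟩⟩
    have hw' : 2 * ‖b‖ * ‖mulCLM (A w') - mulCLM (A w)‖ < c / 2 := hw'
    have h1 : b x (mulE (A w') x) = b x (mulE (A w) x) + b x ((mulCLM (A w') - mulCLM (A w)) x) := by
      rw [← map_add]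
      simp [← mulCLM_apply]
    have h2 : b x ((mulCLM (A w') - mulCLM (A w)) x) ≤
        ‖b‖ * ‖x‖ * (‖mulCLM (A w') - mulCLM (A w)‖ * ‖x‖) :=
      (le_abs_self _).trans ((b.le_opNorm₂ _ _).trans (by
        gcongr
        exact ContinuousLinearMap.le_opNorm _ _))
    have h3 := hle x
    have h4 := mul_le_mul_of_nonneg_right hw'.le (sq_nonneg ‖x‖)
    rw [h1]
    nlinarith

/-! ### Majorants and comparison functions -/

/-- Every sequence is dominated by a smooth monotone positive function. -/
theorem exists_contDiff_monotone_majorant (L : ℕ → ℝ) :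
    ∃ g : ℝ → ℝ, ContDiff ℝ ∞ g ∧ Monotone g ∧ (∀ s, 0 < g s) ∧
      ∀ (N : ℕ) (s : ℝ), (N : ℝ) ≤ s → L N ≤ g s := by
  -- The `k`-th bump is zero up to `k - 1` and equals `|L k|` from `k` on, so the sum over `k` is
  -- locally finite.
  let f : ℕ → ℝ → ℝ := fun k s => |L k| * Real.smoothTransition (s - k + 1)
  have hf0 : ∀ k s, 0 ≤ f k s := fun k s =>
    mul_nonneg (abs_nonneg _) (Real.smoothTransition.nonneg _)
  have hfz : ∀ (k : ℕ) (s : ℝ), s ≤ (k : ℝ) - 1 → f k s = 0 := fun k s h => by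
    simp only [f]; rw [Real.smoothTransition.zero_of_nonpos (by linarith), mul_zero]
  have hsum : ∀ (N : ℕ) (s : ℝ), s ≤ N → ∑' k, f k s = ∑ k ∈ Finset.range (N + 1), f k s := by
    intro N s hs
    refine tsum_eq_sum fun k hk => hfz k s ?_
    have : N + 1 ≤ k := by simpa using hk
    have : (N : ℝ) + 1 ≤ k := by exact_mod_cast this
    linarith
  refine ⟨fun s => 1 + ∑' k, f k s, ?_, ?_, ?_, ?_⟩
  · rw [contDiff_iff_contDiffAt]
    intro s
    obtain ⟨N, hN⟩ := exists_nat_gt s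
    have : ContDiffAt ℝ ∞ (fun s => 1 + ∑ k ∈ Finset.range (N + 1), f k s) s := by
      refine ContDiff.contDiffAt ?_
      refine contDiff_const.add (ContDiff.sum fun k _ => contDiff_const.mul ?_)
      exact Real.smoothTransition.contDiff.comp (by fun_prop)
    refine this.congr_of_eventuallyEq ?_
    filter_upwards [Iio_mem_nhds hN] with y hy
    rw [hsum N y (le_of_lt hy)]
  · intro s t hst
    obtain ⟨N, hN⟩ := exists_nat_ge t
    dsimp only
    rw [hsum N t hN, hsum N s (hst.trans hN)]
    gcongr with k hk
    simp only [f]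
    gcongr
    exact Real.smoothTransition.monotone (by linarith)
  · intro s
    have : 0 ≤ ∑' k, f k s := tsum_nonneg (fun k => hf0 k s)
    linarith
  · intro N s hs
    obtain ⟨M, hM⟩ := exists_nat_ge s
    dsimp only
    rw [hsum M s hM]
    have hNM : N ∈ Finset.range (M + 1) := by
      have : (N : ℝ) ≤ M := hs.trans hM
      have : N ≤ M := by exact_mod_cast this
      simp; omega
    have := Finset.single_le_sum (f := fun k => f k s) (fun k _ => hf0 k s) hNM
    have h2 : f N s = |L N| := by
      simp only [f]; rw [Real.smoothTransition.one_of_one_le (by linarith), mul_one]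
    linarith [le_abs_self (L N)]

/-- The increment of a smooth function in a scalar variable, uniformly over a compact set of
parameters. -/
theorem exists_increment_bound {X E : Type*} [NormedAddCommGroup X] [NormedSpace ℝ X]
    [NormedAddCommGroup E] [NormedSpace ℝ E] {k : ℝ → X → E} {q : X → ℝ}
    (hk : ContDiff ℝ ∞ (fun p : ℝ × X => k p.1 p.2)) (hq : Continuous q)
    {K : Set X} (hK : IsCompact K) :
    ∃ g : ℝ → ℝ, ContDiff ℝ ∞ g ∧ Monotone g ∧ (∀ s, 0 < g s) ∧
      ∀ x ∈ K, ∀ e : ℝ, ‖k (q x + e) x - k (q x) x‖ ^ 2 ≤ e ^ 2 * g (e ^ 2) := by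
  let d : ℝ × X → E := fun p => fderiv ℝ (fun p : ℝ × X => k p.1 p.2) (q p.2 + p.1, p.2) (1, 0)
  have hd : Continuous d := by
    have h1 : Continuous (fderiv ℝ (fun p : ℝ × X => k p.1 p.2)) := hk.continuous_fderiv (by simp)
    exact (h1.comp (by fun_prop)).clm_apply continuous_const
  have hbd : ∀ N : ℕ, ∃ B : ℝ, ∀ x ∈ K, ∀ e ∈ Icc (-((N : ℝ) + 1)) (N + 1), ‖d (e, x)‖ ≤ B := by
    intro N
    obtain ⟨B, hB⟩ := (isCompact_Icc.prod hK).exists_bound_of_continuousOn hd.continuousOn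
    exact ⟨B, fun x hx e he => hB (e, x) ⟨he, hx⟩⟩
  choose B hB using hbd
  obtain ⟨g, hg, hmono, hpos, hmaj⟩ := exists_contDiff_monotone_majorant (fun N => B N ^ 2)
  refine ⟨g, hg, hmono, hpos, fun x hx e => ?_⟩
  set N := ⌊e ^ 2⌋₊ with hN
  have h1 : (N : ℝ) ≤ e ^ 2 := Nat.floor_le (sq_nonneg e)
  have h2 : e ^ 2 < N + 1 := Nat.lt_floor_add_one _
  -- From `e² < N + 1 ≤ (N + 1)²`; the derivative bound on `[-(N+1), N+1]` therefore applies between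
  -- `0` and `e`.
  have he : |e| ≤ N + 1 := by
    have hN0 : (0 : ℝ) ≤ N := Nat.cast_nonneg _
    exact abs_le_of_sq_le_sq (by nlinarith) (by positivity)
  have hder : ∀ s : ℝ, HasDerivAt (fun s => k (q x + s) x) (d (s, x)) s := by
    intro s
    have h3 : HasFDerivAt (fun p : ℝ × X => k p.1 p.2)
        (fderiv ℝ (fun p : ℝ × X => k p.1 p.2) (q x + s, x)) (q x + s, x) :=
      (hk.differentiable (by simp) _).hasFDerivAt
    have h4 : HasDerivAt (fun s : ℝ => (q x + s, x)) ((1 : ℝ), (0 : X)) s :=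
      ((hasDerivAt_id s).const_add (q x)).prodMk (hasDerivAt_const s x)
    exact h3.comp_hasDerivAt s h4
  have h0 : (0 : ℝ) ∈ Icc (-((N : ℝ) + 1)) (N + 1) := by
    constructor <;> linarith [Nat.cast_nonneg (α := ℝ) N]
  have hmv := (convex_Icc (-((N : ℝ) + 1)) (N + 1)).norm_image_sub_le_of_norm_hasDerivWithin_le
    (f := fun s => k (q x + s) x) (f' := fun s => d (s, x)) (C := B N)
    (fun s _ => (hder s).hasDerivWithinAt) (fun s hs => hB N x hx s hs) h0 (abs_le.1 he)
  simp only [add_zero, sub_zero, Real.norm_eq_abs] at hmv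
  calc _ ≤ (B N * |e|) ^ 2 := by gcongr
    _ = e ^ 2 * B N ^ 2 := by rw [mul_pow, sq_abs]; ring
    _ ≤ _ := by gcongr; exact hmaj N _ h1

/-- Multiplying the identity by a positive, continuous, monotone function gives an unbounded class
`K` function. -/
theorem isClassKInf_mul {g : ℝ → ℝ} (hg : Continuous g) (hm : Monotone g) (hpos : ∀ s, 0 < g s) :
    IsClassKInf (fun s => s * g s) := by
  refine ⟨⟨by fun_prop, ?_, by simp⟩, ?_⟩
  · intro a ha b hb hab
    have h1 := hm hab.le
    have := hpos a
    have ha : 0 ≤ a := ha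
    dsimp only
    nlinarith
  · refine tendsto_atTop_mono' atTop ?_ (tendsto_id.atTop_mul_const (hpos 0))
    filter_upwards [eventually_ge_atTop 0] with s hs
    exact mul_le_mul_of_nonneg_left (hm hs) hs

/-- `c (√s + s)` is of class `K∞`. -/
theorem isClassKInf_sqrt_add {c : ℝ} (hc : 0 < c) :
    IsClassKInf (fun s => c * (√s + s)) := by
  refine ⟨⟨by fun_prop, ?_, by simp⟩, ?_⟩
  · intro a ha b hb hab
    have := Real.sqrt_le_sqrt hab.le
    dsimp only
    gcongr
  · refine Tendsto.const_mul_atTop hc (tendsto_atTop_mono (fun s => ?_) tendsto_id)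
    simp

/-- `ln (1 + c s)` is of class `K∞`. -/
theorem isClassKInf_log {c : ℝ} (hc : 0 < c) : IsClassKInf (fun s => Real.log (c * s + 1)) := by
  refine ⟨⟨?_, ?_, by simp⟩, ?_⟩
  · refine ContinuousOn.log (by fun_prop) fun s hs => ?_
    have : 0 ≤ c * s := mul_nonneg hc.le hs
    positivity
  · intro a ha b hb hab
    have : 0 ≤ c * a := mul_nonneg hc.le ha
    exact Real.log_lt_log (by positivity) (by gcongr)
  · exact Real.tendsto_log_atTop.comp
      (tendsto_atTop_add_const_right _ _ (tendsto_id.const_mul_atTop hc))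

/-- `c (1 - e⁻ˢ)` is a bounded class `K` function. -/
theorem isClassKBdd_one_sub_exp {c : ℝ} (hc : 0 < c) :
    IsClassKBdd (fun s => c * (1 - Real.exp (-s))) := by
  refine ⟨⟨by fun_prop, ?_, by simp⟩, c, fun s _ => ?_⟩
  · intro a ha b hb hab
    dsimp only
    gcongr
  · nlinarith [Real.exp_pos (-s)]

theorem IsClassKInf.comp_sq {f : ℝ → ℝ} (hf : IsClassKInf f) : IsClassKInf (fun s => f (s ^ 2)) := by
  refine ⟨⟨hf.1.1.comp (by fun_prop) fun s _ => mem_Ici.2 (sq_nonneg s), ?_, by simpa using hf.1.2.2⟩,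
    hf.2.comp (tendsto_pow_atTop two_ne_zero)⟩
  intro a ha b hb hab
  exact hf.1.2.1 (mem_Ici.2 (sq_nonneg a)) (mem_Ici.2 (sq_nonneg b)) (pow_lt_pow_left₀ hab ha two_ne_zero)

/-- `ln (1 + c s² e^{-k t})` is of class `KL`. -/
theorem isClassKL_log {c k : ℝ} (hc : 0 < c) (hk : 0 < k) :
    IsClassKL (fun s t => Real.log (c * s ^ 2 * Real.exp (-k * t) + 1)) := by
  refine ⟨?_, ?_, ?_⟩
  · refine Continuous.continuousOn (Continuous.log (by fun_prop) fun p => ?_)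
    positivity
  · intro t _
    have := (isClassKInf_log (mul_pos hc (Real.exp_pos (-k * t)))).comp_sq.1
    refine (congrArg IsClassK (funext fun s => ?_)).mp this
    ring_nf
  · intro s _
    refine ⟨?_, ?_⟩
    · intro a _ b _ hab
      dsimp only
      have : Real.exp (-k * b) ≤ Real.exp (-k * a) := Real.exp_le_exp.2 (by nlinarith)
      gcongr
    · have h1 : Tendsto (fun t => Real.exp (-k * t)) atTop (𝓝 0) :=
        Real.tendsto_exp_atBot.comp (tendsto_id.const_mul_atTop_of_neg (by linarith))
      have h2 : Tendsto (fun t => c * s ^ 2 * Real.exp (-k * t) + 1) atTop (𝓝 1) := by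
        simpa using (h1.const_mul (c * s ^ 2)).add_const 1
      simpa using h2.log one_ne_zero

/-! ### Sums of exponentials, their recursion and the companion matrix -/

/-- Exponentials with distinct exponents are linearly independent on every interval. -/
theorem eq_zero_of_eventually_sum_exp_eq_zero {n : ℕ} {l D : Fin n → ℂ} (hl : Function.Injective l)
    {t : ℝ} (h : ∀ᶠ s : ℝ in 𝓝 t, ∑ i, D i * Complex.exp (l i * s) = 0) : D = 0 := by
  have hder : ∀ (k : ℕ) (s : ℝ), HasDerivAt (fun s : ℝ => ∑ i, D i * l i ^ k * Complex.exp (l i * s))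
      (∑ i, D i * l i ^ (k + 1) * Complex.exp (l i * s)) s := by
    intro k s
    refine HasDerivAt.fun_sum fun i _ => ?_
    have h1 : HasDerivAt (fun s : ℝ => l i * (s : ℂ)) (l i) s := by
      simpa using (Complex.ofRealCLM.hasDerivAt (x := s)).const_mul (l i)
    convert! (h1.cexp).const_mul (D i * l i ^ k) using 1
    ring
  -- Vanishing near `t` passes to all derivatives, so the values at `t` satisfy every equation of a
  -- Vandermonde system.
  have hk : ∀ k : ℕ, ∀ᶠ s : ℝ in 𝓝 t, ∑ i, D i * l i ^ k * Complex.exp (l i * s) = 0 := by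
    intro k
    induction k with
    | zero => simpa using h
    | succ k ih =>
      filter_upwards [ih.eventually_nhds] with s hs
      exact (hder k s).unique ((hasDerivAt_const s (0 : ℂ)).congr_of_eventuallyEq hs)
  have h0 : (fun i => D i * Complex.exp (l i * t)) = 0 := by
    refine Matrix.eq_zero_of_forall_pow_sum_mul_pow_eq_zero hl fun k => ?_
    rw [← (hk k).self_of_nhds]
    exact Finset.sum_congr rfl fun i _ => by ring
  funext i
  simpa using congrFun h0 i

/-- A real vector orthogonal to all vectors `(1, lᵢ, …, lᵢⁿ⁻¹)` with distinct `lᵢ` vanishes. -/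
theorem eq_zero_of_forall_sum_pow {n : ℕ} {l : Fin n → ℂ} (hl : Function.Injective l)
    {x : Fin n → ℝ} (h : ∀ i, ∑ k : Fin n, (x k : ℂ) * l i ^ (k : ℕ) = 0) : x = 0 := by
  have := Matrix.eq_zero_of_forall_index_sum_mul_pow_eq_zero hl (v := fun k => (x k : ℂ)) h
  funext k
  simpa using congrFun this k

theorem inner_eq_sum {n : ℕ} (x y : Vec n) : inner ℝ x y = ∑ k, x k * y k := by
  simp [PiLp.inner_apply, mul_comm]

/-- A vector which is orthogonal to the jet of a signal with `n` modes near some time is zero. -/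
theorem eq_zero_of_eventually_inner_eq_zero {n : ℕ} {l C : Fin n → ℂ} (hl : Function.Injective l)
    (hC : ∀ i, C i ≠ 0) {ξ : ℝ → Vec n}
    (hξ : ∀ t k, (ξ t k : ℂ) = ∑ i, C i * l i ^ (k : ℕ) * Complex.exp (l i * t))
    {x : Vec n} {t : ℝ} (h : ∀ᶠ s in 𝓝 t, inner ℝ x (ξ s) = 0) : x = 0 := by
  -- In `xᵀ ξ` the `i`-th exponential has as its coefficient `Cᵢ` times the polynomial with
  -- coefficients `x`, evaluated at `lᵢ`.
  have h1 : (fun i => C i * ∑ k : Fin n, (x k : ℂ) * l i ^ (k : ℕ)) = 0 := by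
    refine eq_zero_of_eventually_sum_exp_eq_zero hl (t := t) ?_
    filter_upwards [h] with s hs
    rw [inner_eq_sum] at hs
    have hs' := congrArg (fun r : ℝ => (r : ℂ)) hs
    simp only [Complex.ofReal_sum, Complex.ofReal_mul, hξ, Complex.ofReal_zero,
      Finset.mul_sum] at hs'
    rw [Finset.sum_comm] at hs'
    rw [← hs']
    refine Finset.sum_congr rfl fun i _ => ?_
    rw [Finset.mul_sum, Finset.sum_mul]
    exact Finset.sum_congr rfl fun k _ => by ring
  have h2 := eq_zero_of_forall_sum_pow hl (x := x.ofLp) fun i => by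
    simpa [hC i] using congrFun h1 i
  ext k
  exact congrFun h2 k

theorem prod_X_sub_C_eval {n : ℕ} (l : Fin n → ℂ) (i : Fin n) :
    l i ^ n + ∑ j : Fin n, (∏ i, (Polynomial.X - Polynomial.C (l i))).coeff j * l i ^ (j : ℕ) = 0 := by
  set p : Polynomial ℂ := ∏ i, (Polynomial.X - Polynomial.C (l i)) with hp
  have hmon : p.Monic := Polynomial.monic_prod_of_monic _ _ fun i _ => Polynomial.monic_X_sub_C _
  have hdeg : p.natDegree = n := by
    rw [hp, Polynomial.natDegree_prod_of_monic _ _ fun i _ => Polynomial.monic_X_sub_C _]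
    simp
  have h0 : p.eval (l i) = 0 := by
    rw [hp, Polynomial.eval_prod]
    exact Finset.prod_eq_zero (Finset.mem_univ i) (by simp)
  rw [Polynomial.eval_eq_sum_range, hdeg, Finset.sum_range_succ, Finset.sum_range] at h0
  have hl : p.coeff n = 1 := by
    have := hmon.leadingCoeff
    rwa [Polynomial.leadingCoeff, hdeg] at this
  rw [hl] at h0
  linear_combination h0

/-- A real signal with `n` modes satisfies the recursion with the (real) coefficients `genCoeff`,
and these annihilate all modes. -/
theorem genCoeff_spec {n : ℕ} {f : Fin n → ℝ} (hf : Function.Injective f) {C : Fin n → ℂ}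
    (hC : ∀ i, C i ≠ 0) {y : ℕ → ℝ → ℝ}
    (hy : ∀ k t, (y k t : ℂ) =
      ∑ i, C i * (Complex.I * (f i : ℂ)) ^ k * Complex.exp (Complex.I * (f i : ℂ) * t)) :
    (∀ t, y n t = -∑ j : Fin n, genCoeff f j * y j t) ∧
      ∀ i, (Complex.I * (f i : ℂ)) ^ n +
        ∑ j : Fin n, (genCoeff f j : ℂ) * (Complex.I * (f i : ℂ)) ^ (j : ℕ) = 0 := by
  set l : Fin n → ℂ := fun i => Complex.I * (f i : ℂ) with hl
  have hinj : Function.Injective l := fun i j hij => hf (by simpa [hl] using hij)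
  -- A differential operator with constant coefficients multiplies each mode by its characteristic
  -- polynomial at that mode.
  have key : ∀ (c : Fin n → ℂ) (t : ℝ), (y n t : ℂ) + ∑ j : Fin n, c j * (y j t : ℂ) =
      ∑ i, C i * (l i ^ n + ∑ j : Fin n, c j * l i ^ (j : ℕ)) * Complex.exp (l i * t) := by
    intro c t
    simp only [hy, mul_add, add_mul, Finset.sum_add_distrib, Finset.mul_sum, Finset.sum_mul]
    congr 1
    rw [Finset.sum_comm]
    refine Finset.sum_congr rfl fun i _ => Finset.sum_congr rfl fun j _ => ?_
    simp only [hl]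
    ring
  -- The signal is real, so the recursion survives taking real parts of the coefficients.
  have h1 : ∀ t, y n t + ∑ j : Fin n, genCoeff f j * y j t = 0 := by
    intro t
    have := key (fun j => (∏ i, (Polynomial.X - Polynomial.C (l i))).coeff j) t
    simp only [prod_X_sub_C_eval, mul_zero, zero_mul, Finset.sum_const_zero] at this
    have := congrArg Complex.re this
    simpa [genCoeff, hl] using this
  refine ⟨fun t => by linarith [h1 t], fun i => ?_⟩
  -- Conversely, the recursion with the real coefficients forces them to annihilate each mode,
  -- because all `Cᵢ ≠ 0`. No conjugate symmetry of the frequencies has to be invoked.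
  have h2 : (fun i => C i * (l i ^ n + ∑ j : Fin n, (genCoeff f j : ℂ) * l i ^ (j : ℕ))) = 0 := by
    refine eq_zero_of_eventually_sum_exp_eq_zero hinj (t := 0) (Eventually.of_forall fun t => ?_)
    rw [← key]
    exact_mod_cast h1 t
  simpa [hC i] using congrFun h2 i

/-- The vector of powers of a root of the characteristic polynomial is an eigenvector of the
companion matrix. -/
theorem companionOf_map_mulVec {n : ℕ} (a : Vec n) {l : ℂ}
    (h : l ^ n + ∑ j : Fin n, (a j : ℂ) * l ^ (j : ℕ) = 0) :
    (companionOf a).map (algebraMap ℝ ℂ) *ᵥ (fun j : Fin n => l ^ (j : ℕ)) =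
      l • fun j : Fin n => l ^ (j : ℕ) := by
  funext i
  simp only [Matrix.mulVec, dotProduct, companionOf, Matrix.map_apply, Matrix.of_apply,
    Pi.smul_apply, smul_eq_mul]
  by_cases hi : (i : ℕ) + 1 = n
  · simp only [hi, if_true]
    have : l * l ^ (i : ℕ) = l ^ n := by rw [← pow_succ', hi]
    rw [this]
    simp only [Complex.coe_algebraMap, Complex.ofReal_neg, neg_mul, Finset.sum_neg_distrib]
    linear_combination -h
  · simp only [hi, if_false]
    have hlt : (i : ℕ) + 1 < n := by have := i.2; omega
    rw [Finset.sum_eq_single ⟨i + 1, hlt⟩]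
    · simp [pow_succ, mul_comm]
    · intro j _ hj
      have : (j : ℕ) ≠ i + 1 := fun h => hj (Fin.ext h)
      simp [this]
    · simp

/-- Such a root would be an eigenvalue of the companion matrix with zero real part. The eigenvector
of powers is nonzero because its first entry is `l ^ 0 = 1`, which is where `0 < n` enters. -/
theorem IsHurwitz.companionOf_ne_zero {n : ℕ} (hn : 0 < n) {m : Vec n}
    (hm : IsHurwitz (companionOf m)) {l : ℂ} (hl : l.re = 0) :
    l ^ n + ∑ j : Fin n, (m j : ℂ) * l ^ (j : ℕ) ≠ 0 := by
  intro h
  have h1 := companionOf_map_mulVec m h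
  set Mc := (companionOf m).map (algebraMap ℝ ℂ)
  have h2 : Mc.charpoly.IsRoot l := by
    rw [Polynomial.IsRoot, Matrix.eval_charpoly, ← Matrix.exists_mulVec_eq_zero_iff]
    refine ⟨fun j => l ^ (j : ℕ), fun h0 => ?_, ?_⟩
    · simpa using congrFun h0 ⟨0, hn⟩
    · rw [Matrix.sub_mulVec, h1]
      simp [Matrix.scalar_apply, ← Matrix.smul_one_eq_diagonal, Matrix.smul_mulVec]
  have := hm l ((Polynomial.mem_roots (Matrix.charpoly_monic _).ne_zero).2 h2)
  linarith

/-- The observability matrix of the internal model is invertible. -/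
theorem RegSetup.isUnit_det_Tinv {nz nv nw nσ n : ℕ} (hn : 0 < n) (R : RegSetup nz nv nw nσ n)
    (hM : IsHurwitz R.M) {σ : Vec nσ} (hinj : Function.Injective (R.freq σ))
    (ha : ∀ i, (Complex.I * (R.freq σ i : ℂ)) ^ n +
        ∑ j : Fin n, (R.a σ j : ℂ) * (Complex.I * (R.freq σ i : ℂ)) ^ (j : ℕ) = 0) :
    IsUnit (R.Tinv σ).det := by
  rw [isUnit_iff_ne_zero]
  intro hdet
  obtain ⟨x, hx, hx0⟩ := Matrix.exists_vecMul_eq_zero_iff.2 hdet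
  apply hx
  set l : Fin n → ℂ := fun i => Complex.I * (R.freq σ i : ℂ) with hl
  -- A left null vector `x` is tested on the eigenvectors `e` of `Φ`. Row `k` sends `e` to `(1 + lᵢ)
  -- lᵢᵏ (ϱᵀ e)`, so `(1 + lᵢ)(ϱᵀ e)` times the polynomial with coefficients `x` at `lᵢ` vanishes.
  -- Both prefactors are nonzero, the first because `lᵢ` is imaginary.
  refine eq_zero_of_forall_sum_pow (l := l) (fun i j hij => hinj (by simpa [hl] using hij)) fun i => ?_
  set e : Fin n → ℂ := fun j => l i ^ (j : ℕ) with he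
  set c := algebraMap ℝ ℂ
  have hΦ : (R.Φ σ).map c *ᵥ e = l i • e := companionOf_map_mulVec (R.a σ) (ha i)
  have hpow : ∀ k : ℕ, ((R.Φ σ).map c) ^ k *ᵥ e = l i ^ k • e := by
    intro k
    induction k with
    | zero => simp
    | succ k ih => rw [pow_succ, ← Matrix.mulVec_mulVec, hΦ, Matrix.mulVec_smul, ih, smul_smul,
        pow_succ, mul_comm]
  set r : Fin n → ℂ := fun j => ((R.rho σ) j : ℂ) with hr
  -- As `ϱ = m - a`, the product `ϱᵀ e` is the difference of the characteristic polynomials of `M`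
  -- and `Φ` at `lᵢ`. The second vanishes there and the first does not, `M` being Hurwitz.
  have hre : r ⬝ᵥ e ≠ 0 := by
    have h1 := hM.companionOf_ne_zero hn (m := R.m) (l := l i) (by simp [hl])
    have h2 : r ⬝ᵥ e = (l i ^ n + ∑ j : Fin n, (R.m j : ℂ) * l i ^ (j : ℕ)) -
        (l i ^ n + ∑ j : Fin n, (R.a σ j : ℂ) * l i ^ (j : ℕ)) := by
      rw [add_sub_add_left_eq_sub, ← Finset.sum_sub_distrib]
      refine Finset.sum_congr rfl fun j _ => ?_
      simp only [hr, he, RegSetup.rho, PiLp.sub_apply, Complex.ofReal_sub]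
      ring
    rw [h2, ha i, sub_zero]
    exact h1
  have hrow : ∀ k : Fin n, (fun j => c (R.Tinv σ k j)) ⬝ᵥ e = (1 + l i) * l i ^ (k : ℕ) * (r ⬝ᵥ e) := by
    intro k
    have h1 : (fun j => c (R.Tinv σ k j)) = r ᵥ* (((R.Φ σ).map c + 1) * ((R.Φ σ).map c) ^ (k : ℕ)) := by
      have h2 : ((R.Φ σ).map c + 1) * ((R.Φ σ).map c) ^ (k : ℕ) =
          ((R.Φ σ + 1) * (R.Φ σ) ^ (k : ℕ)).map c := by
        have : ∀ A : Matrix (Fin n) (Fin n) ℝ, A.map c = c.mapMatrix A := fun A => rfl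
        simp only [this, map_add, map_mul, map_pow, map_one]
      rw [h2]
      funext j
      simp only [RegSetup.Tinv, Matrix.of_apply, Matrix.vecMul, dotProduct, map_sum, map_mul,
        Matrix.map_apply]
      rfl
    rw [h1, ← Matrix.dotProduct_mulVec, ← Matrix.mulVec_mulVec, hpow, Matrix.mulVec_smul,
      Matrix.add_mulVec, hΦ, Matrix.one_mulVec]
    simp only [dotProduct_smul, dotProduct_add, smul_eq_mul]
    ring
  have h1l : 1 + l i ≠ 0 := by
    intro h
    have := congrArg Complex.re h
    simp [hl] at this
  have hsum : ((1 + l i) * (r ⬝ᵥ e)) * (∑ k : Fin n, (x k : ℂ) * l i ^ (k : ℕ)) = 0 := by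
    have h3 : ∑ j : Fin n, (∑ k : Fin n, (x k : ℂ) * c (R.Tinv σ k j)) * e j = 0 := by
      refine Finset.sum_eq_zero fun j _ => ?_
      have := congrArg c (congrFun hx0 j)
      simp only [Matrix.vecMul, dotProduct, map_sum, map_mul, Pi.zero_apply, map_zero] at this
      have h5 : ∑ k : Fin n, (x k : ℂ) * c (R.Tinv σ k j) = 0 := this
      rw [h5, zero_mul]
    have h4 : ∑ j : Fin n, (∑ k : Fin n, (x k : ℂ) * c (R.Tinv σ k j)) * e j =
        ∑ k : Fin n, (x k : ℂ) * ((fun j => c (R.Tinv σ k j)) ⬝ᵥ e) := by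
      simp only [Finset.sum_mul, dotProduct, Finset.mul_sum]
      rw [Finset.sum_comm]
      refine Finset.sum_congr rfl fun k _ => Finset.sum_congr rfl fun j _ => ?_
      ring
    rw [h4] at h3
    rw [← h3, Finset.mul_sum (s := Finset.univ)]
    refine Finset.sum_congr rfl fun k _ => ?_
    rw [hrow]
    ring
  exact (mul_eq_zero.1 hsum).resolve_left (mul_ne_zero h1l hre)

/-! ### The exosystem flow and the jet of the steady-state input -/

theorem contDiff_mulE {X : Type*} [NormedAddCommGroup X] [NormedSpace ℝ X] {n : ℕ}
    {A : X → Matrix (Fin n) (Fin n) ℝ} {x : X → Vec n} (hA : ∀ i j, ContDiff ℝ ∞ (fun p => A p i j))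
    (hx : ContDiff ℝ ∞ x) : ContDiff ℝ ∞ (fun p => mulE (A p) (x p)) := by
  rw [contDiff_euclidean]
  intro i
  simp only [mulE, Matrix.mulVec, dotProduct]
  exact ContDiff.sum fun j _ => (hA i j).mul (contDiff_euclidean.1 hx j)

namespace Plant

variable {nz nv nw nσ n : ℕ} (P : Plant nz nv nw nσ)

/-- The flow of the exosystem. -/
noncomputable def flow (σ : Vec nσ) (t : ℝ) (v : Vec nv) : Vec nv :=
  NormedSpace.exp (t • mulCLM (P.S σ)) v

theorem isExoTrajectory_flow (σ : Vec nσ) (v : Vec nv) :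
    P.IsExoTrajectory σ (fun t => P.flow σ t v) := by
  intro t
  have h := hasDerivAt_exp_smul_const' (𝕂 := ℝ) (mulCLM (P.S σ)) t
  exact h.clm_apply (hasDerivAt_const t v) |>.congr_deriv (by simp [flow, mulCLM_apply])

theorem flow_zero (σ : Vec nσ) (v : Vec nv) : P.flow σ 0 v = v := by
  have h : (0 : ℝ) • mulCLM (P.S σ) = 0 :=
    ContinuousLinearMap.ext fun x => zero_smul ℝ (mulCLM (P.S σ) x)
  rw [flow, h, NormedSpace.exp_zero, one_apply_eq_self]

theorem IsExoTrajectory.eq_flow {P : Plant nz nv nw nσ} {σ : Vec nσ} {v : ℝ → Vec nv}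
    (hv : P.IsExoTrajectory σ v) (t : ℝ) : v t = P.flow σ t (v 0) := by
  have := ODE_solution_unique_univ (v := fun _ x => mulCLM (P.S σ) x) (K := ‖mulCLM (P.S σ)‖₊)
    (s := fun _ => univ) (f := v) (g := fun t => P.flow σ t (v 0)) (t₀ := 0)
    (fun _ => ((mulCLM (P.S σ)).lipschitz).lipschitzOnWith)
    (fun t => ⟨hv t, mem_univ _⟩) (fun t => ⟨P.isExoTrajectory_flow σ (v 0) t, mem_univ _⟩)
    (P.flow_zero σ (v 0)).symm
  exact congrFun this t

theorem IsExoTrajectory.shift {P : Plant nz nv nw nσ} {σ : Vec nσ} {v : ℝ → Vec nv}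
    (hv : P.IsExoTrajectory σ v) (t : ℝ) : P.IsExoTrajectory σ (fun s => v (t + s)) :=
  fun s => (hv (t + s)).comp_const_add t s

theorem IsExoTrajectory.contDiff {P : Plant nz nv nw nσ} {σ : Vec nσ} {v : ℝ → Vec nv}
    (hv : P.IsExoTrajectory σ v) : ContDiff ℝ ∞ v := by
  rw [contDiff_infty]
  intro k
  induction k with
  | zero => exact contDiff_zero.2 (continuous_iff_continuousAt.2 fun t => (hv t).continuousAt)
  | succ k ih =>
    refine (contDiff_succ_iff_deriv (n := k)).2 ⟨fun t => (hv t).differentiableAt, by simp, ?_⟩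
    have : deriv v = fun t => mulCLM (P.S σ) (v t) := funext fun t => (hv t).deriv
    rw [this]
    exact (mulCLM (P.S σ)).contDiff.comp ih

theorem continuous_S : Continuous P.S :=
  continuous_matrix fun i j => (P.smooth_S i j).continuous

theorem continuous_F : Continuous P.F :=
  continuous_matrix fun i j => (P.smooth_F i j).continuous

/-- Joint continuity, including in `σ`, is what lets compactness make the excitation level uniform.
-/
theorem continuous_flow :
    Continuous (fun p : Vec nσ × ℝ × Vec nv => P.flow p.1 p.2.1 p.2.2) := by
  have h1 : Continuous (fun p : Vec nσ × ℝ × Vec nv => p.2.1 • mulCLM (P.S p.1)) :=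
    (continuous_fst.comp continuous_snd).smul
      (continuous_mulCLM.comp (P.continuous_S.comp continuous_fst))
  let _ : NormedAlgebra ℚ (Vec nv →L[ℝ] Vec nv) := NormedAlgebra.restrictScalars ℚ ℝ _
  exact (NormedSpace.exp_continuous.comp h1).clm_apply
    (continuous_snd.comp continuous_snd)

theorem contDiff_exoDeriv {f : Vec nv → Vec nσ → Vec nw → ℝ}
    (hf : ContDiff ℝ ∞ (fun p : Vec nv × Vec nσ × Vec nw => f p.1 p.2.1 p.2.2)) :
    ContDiff ℝ ∞ (fun p : Vec nv × Vec nσ × Vec nw =>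
      P.exoDeriv p.2.1 (fun v' => f v' p.2.1 p.2.2) p.1) := by
  have h1 : ContDiff ℝ ∞ (fun p : Vec nv × Vec nσ × Vec nw =>
      fderiv ℝ (fun v' => f v' p.2.1 p.2.2) p.1) := by
    refine ContDiff.fderiv (n := ∞) (m := ∞) (f := fun (p : Vec nv × Vec nσ × Vec nw) v' => f v' p.2.1 p.2.2)
      ?_ contDiff_fst (by simp)
    exact hf.comp (f := fun q : (Vec nv × Vec nσ × Vec nw) × Vec nv => (q.2, q.1.2.1, q.1.2.2))
      (by fun_prop)
  exact h1.clm_apply (contDiff_mulE (fun i j => (P.smooth_S i j).comp (by fun_prop)) contDiff_fst)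

theorem contDiff_b_inv : ContDiff ℝ ∞ (fun p : Vec nv × Vec nσ × Vec nw => (P.b p.2.2 p.1)⁻¹) :=
  (P.smooth_b.comp (f := fun p : Vec nv × Vec nσ × Vec nw => (p.2.2, p.1)) (by fun_prop)).inv
    fun p => by simpa using (P.b_sq_pos p.2.2 p.1).ne'

theorem contDiff_uss {zs : Vec nv → Vec nσ → Vec nw → Vec nz}
    (hz : ContDiff ℝ ∞ (fun p : Vec nv × Vec nσ × Vec nw => zs p.1 p.2.1 p.2.2)) :
    ContDiff ℝ ∞ (fun p : Vec nv × Vec nσ × Vec nw => P.uss zs p.1 p.2.1 p.2.2) := by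
  have hq : ContDiff ℝ ∞ (fun p : Vec nv × Vec nσ × Vec nw => P.q p.1 p.2.2) :=
    P.smooth_q.comp (f := fun p : Vec nv × Vec nσ × Vec nw => (p.1, p.2.2)) (by fun_prop)
  have hD : ContDiff ℝ ∞ (fun p : Vec nv × Vec nσ × Vec nw => P.D₂ p.1 p.2.2) :=
    P.smooth_D₂.comp (f := fun p : Vec nv × Vec nσ × Vec nw => (p.1, p.2.2)) (by fun_prop)
  have hH : ContDiff ℝ ∞ (fun p : Vec nv × Vec nσ × Vec nw => P.H p.2.2) :=
    P.smooth_H.comp (by fun_prop)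
  have hK : ContDiff ℝ ∞ (fun p : Vec nv × Vec nσ × Vec nw => P.K (P.q p.1 p.2.2) p.1 p.2.2) :=
    P.smooth_K.comp (f := fun p : Vec nv × Vec nσ × Vec nw => (P.q p.1 p.2.2, p.1, p.2.2))
      (by fun_prop)
  exact P.contDiff_b_inv.mul ((((P.contDiff_exoDeriv (f := fun v _ w => P.q v w) hq).sub
    (hH.inner ℝ hz)).sub (hK.mul hq)).sub hD)

/-- The `k`-th time derivative of the steady-state input along the exosystem. -/
noncomputable def jet (zs : Vec nv → Vec nσ → Vec nw → Vec nz) (k : ℕ)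
    (v : Vec nv) (σ : Vec nσ) (w : Vec nw) : ℝ :=
  ((P.exoDeriv σ)^[k] (fun v' => P.uss zs v' σ w)) v

variable {zs : Vec nv → Vec nσ → Vec nw → Vec nz}

theorem contDiff_jet
    (hz : ContDiff ℝ ∞ (fun p : Vec nv × Vec nσ × Vec nw => zs p.1 p.2.1 p.2.2)) (k : ℕ) :
    ContDiff ℝ ∞ (fun p : Vec nv × Vec nσ × Vec nw => P.jet zs k p.1 p.2.1 p.2.2) := by
  induction k with
  | zero => exact P.contDiff_uss hz
  | succ k ih =>
    simp only [jet, Function.iterate_succ_apply']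
    exact P.contDiff_exoDeriv ih

theorem IsExoTrajectory.hasDerivAt_jet {P : Plant nz nv nw nσ}
    (hz : ContDiff ℝ ∞ (fun p : Vec nv × Vec nσ × Vec nw => zs p.1 p.2.1 p.2.2))
    {σ : Vec nσ} {v : ℝ → Vec nv} (hv : P.IsExoTrajectory σ v) (w : Vec nw) (k : ℕ) (t : ℝ) :
    HasDerivAt (fun t => P.jet zs k (v t) σ w) (P.jet zs (k + 1) (v t) σ w) t := by
  have h1 : ContDiff ℝ ∞ (fun v' => P.jet zs k v' σ w) :=
    (P.contDiff_jet hz k).comp (f := fun v' : Vec nv => (v', σ, w)) (by fun_prop)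
  have h2 := (h1.differentiable (by simp) (v t)).hasFDerivAt.comp_hasDerivAt t (hv t)
  refine h2.congr_deriv ?_
  simp only [jet, Function.iterate_succ_apply']
  rfl

/-- Induction by uniqueness of derivatives: along a trajectory the iterated Lie derivatives are time
derivatives, and the sum of exponentials is differentiated termwise. -/
theorem IsExoTrajectory.jet_eq_sum {P : Plant nz nv nw nσ}
    (hz : ContDiff ℝ ∞ (fun p : Vec nv × Vec nσ × Vec nw => zs p.1 p.2.1 p.2.2))
    {σ : Vec nσ} {v : ℝ → Vec nv} (hv : P.IsExoTrajectory σ v) (w : Vec nw)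
    {l C : Fin n → ℂ}
    (hC : ∀ t : ℝ, (P.uss zs (v t) σ w : ℂ) = ∑ i, C i * Complex.exp (l i * (t : ℂ))) (k : ℕ) :
    ∀ t : ℝ, (P.jet zs k (v t) σ w : ℂ) = ∑ i, C i * l i ^ k * Complex.exp (l i * (t : ℂ)) := by
  induction k with
  | zero => simpa [jet] using hC
  | succ k ih =>
    intro t
    have h1 : HasDerivAt (fun t => (P.jet zs k (v t) σ w : ℂ)) (P.jet zs (k + 1) (v t) σ w) t :=
      (hv.hasDerivAt_jet hz w k t).ofReal_comp
    have h2 : HasDerivAt (fun s : ℝ => ∑ i, C i * l i ^ k * Complex.exp (l i * s))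
        (∑ i, C i * l i ^ (k + 1) * Complex.exp (l i * t)) t := by
      refine HasDerivAt.fun_sum fun i _ => ?_
      have h1 : HasDerivAt (fun s : ℝ => l i * (s : ℂ)) (l i) t := by
        simpa using (Complex.ofRealCLM.hasDerivAt (x := t)).const_mul (l i)
      convert! (h1.cexp).const_mul (C i * l i ^ k) using 1
      ring
    exact h1.unique (h2.congr_of_eventuallyEq (Eventually.of_forall ih))

end Plant

namespace RegSetup

variable {nz nv nw nσ n : ℕ} {R : RegSetup nz nv nw nσ n}

theorem xi_apply (v : Vec nv) (σ : Vec nσ) (w : Vec nw) (k : Fin n) :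
    R.xi v σ w k = R.jet R.zs k v σ w := rfl

theorem contDiff_xi
    (hz : ContDiff ℝ ∞ (fun p : Vec nv × Vec nσ × Vec nw => R.zs p.1 p.2.1 p.2.2)) :
    ContDiff ℝ ∞ (fun p : Vec nv × Vec nσ × Vec nw => R.xi p.1 p.2.1 p.2.2) :=
  contDiff_euclidean.2 fun k => R.contDiff_jet hz k

end RegSetup

/-! ### Uniform persistency of excitation -/

/-- Inversion is continuous along a continuous family of invertible matrices. -/
theorem Continuous.matrix_inv_of_isUnit_det {X : Type*} [TopologicalSpace X] {n : ℕ}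
    {A : X → Matrix (Fin n) (Fin n) ℝ} (hA : Continuous A) (hu : ∀ x, IsUnit (A x).det) :
    Continuous fun x => (A x)⁻¹ := by
  simp only [Matrix.inv_def, Ring.inverse_eq_inv]
  exact (hA.matrix_det.inv₀ fun x => (hu x).ne_zero).smul hA.matrix_adjugate

theorem integral_sum_const_mul {ι : Type*} [Fintype ι] {a b : ℝ} (c : ι → ℝ) {f : ι → ℝ → ℝ}
    (hf : ∀ i, IntervalIntegrable (f i) volume a b) :
    ∫ s in a..b, ∑ i, c i * f i s = ∑ i, c i * ∫ s in a..b, f i s := by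
  rw [intervalIntegral.integral_finsetSum (f := fun i s => c i * f i s)
    fun i _ => (hf i).const_mul (c i)]
  simp only [intervalIntegral.integral_const_mul]

/-- A nonpositive integrand would make `xᵀ ξ` vanish on `(0, 1)`, a neighbourhood of `1/2`, which
forces `x = 0`. -/
theorem integral_sq_inner_pos {n : ℕ} {l C : Fin n → ℂ} (hl : Function.Injective l)
    (hC : ∀ i, C i ≠ 0) {ξ : ℝ → Vec n} (hc : Continuous ξ)
    (hξ : ∀ t k, (ξ t k : ℂ) = ∑ i, C i * l i ^ (k : ℕ) * Complex.exp (l i * t))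
    {x : Vec n} (hx : x ≠ 0) : 0 < ∫ s in (0 : ℝ)..1, inner ℝ x (ξ s) ^ 2 := by
  have hcont : Continuous fun s => inner ℝ x (ξ s) ^ 2 := (continuous_const.inner hc).pow 2
  refine intervalIntegral.integral_pos one_pos hcont.continuousOn
    (fun s _ => sq_nonneg _) ?_
  by_contra! h
  refine hx (eq_zero_of_eventually_inner_eq_zero hl hC hξ (t := 1 / 2) ?_)
  filter_upwards [Ioo_mem_nhds (show (0 : ℝ) < 1 / 2 by norm_num)
    (show (1 : ℝ) / 2 < 1 by norm_num)] with s hs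
  exact pow_eq_zero_iff two_ne_zero |>.1 (le_antisymm (h s (Ioo_subset_Icc_self hs)) (sq_nonneg _))

namespace RegSetup

variable {nz nv nw nσ n : ℕ} {R : RegSetup nz nv nw nσ n}
  {Vs : Set (Vec nv)} {Ws : Set (Vec nw)} {Ss : Set (Vec nσ)}

/-- The modes of a frequency vector. -/
noncomputable def mode (R : RegSetup nz nv nw nσ n) (σ : Vec nσ) (i : Fin n) : ℂ :=
  Complex.I * (R.freq σ i : ℂ)

theorem exists_modes
    (hz : ContDiff ℝ ∞ (fun p : Vec nv × Vec nσ × Vec nw => R.zs p.1 p.2.1 p.2.2))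
    (hExc : R.AllModesExcited Vs Ws Ss R.zs R.freq) {σ : Vec nσ} (hσ : σ ∈ Ss) {w : Vec nw}
    (hw : w ∈ Ws) {v : ℝ → Vec nv} (hv : R.IsExoTrajectory σ v) (hv0 : v 0 ∈ Vs) :
    Function.Injective (R.mode σ) ∧ (∃ C : Fin n → ℂ, (∀ i, C i ≠ 0) ∧ ∀ k t,
      (R.jet R.zs k (v t) σ w : ℂ) = ∑ i, C i * R.mode σ i ^ k * Complex.exp (R.mode σ i * t)) ∧
    (∀ t, R.jet R.zs n (v t) σ w = -∑ j : Fin n, R.a σ j * R.jet R.zs j (v t) σ w) ∧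
    ∀ i, R.mode σ i ^ n + ∑ j : Fin n, (R.a σ j : ℂ) * R.mode σ i ^ (j : ℕ) = 0 := by
  obtain ⟨hinj, h⟩ := hExc σ hσ
  obtain ⟨C, hC, hCt⟩ := h w hw v hv hv0
  have hj := fun k t => hv.jet_eq_sum hz w (l := R.mode σ) (C := C) hCt k t
  obtain ⟨h1, h2⟩ := genCoeff_spec hinj hC (y := fun k t => R.jet R.zs k (v t) σ w) hj
  exact ⟨fun i j hij => hinj (by simpa [mode] using hij), ⟨C, hC, hj⟩, h1, h2⟩

/-- The coefficients of the internal model depend continuously on the exosystem parameter. -/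
theorem continuous_a
    (hz : ContDiff ℝ ∞ (fun p : Vec nv × Vec nσ × Vec nw => R.zs p.1 p.2.1 p.2.2))
    (hExc : R.AllModesExcited Vs Ws Ss R.zs R.freq) {v₀ : Vec nv} (hv₀ : v₀ ∈ Vs) {w : Vec nw}
    (hw : w ∈ Ws) : Continuous fun σ : Ss => R.a σ := by
  let y : ℕ → Ss → ℝ → ℝ := fun k σ s => R.jet R.zs k (R.flow σ s v₀) σ w
  have hy : ∀ k, Continuous (fun p : Ss × ℝ => y k p.1 p.2) := fun k => by
    have h1 : Continuous (fun p : Ss × ℝ => R.flow p.1 p.2 v₀) :=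
      R.continuous_flow.comp (f := fun p : Ss × ℝ => ((p.1 : Vec nσ), p.2, v₀)) (by fun_prop)
    exact (R.contDiff_jet hz k).continuous.comp
      (f := fun p : Ss × ℝ => (R.flow p.1 p.2 v₀, (p.1 : Vec nσ), w)) (by fun_prop)
  have hys : ∀ k σ, Continuous (y k σ) := fun k σ =>
    (hy k).comp (f := fun s : ℝ => (σ, s)) (by fun_prop)
  -- Gram matrix and right-hand side of the normal equations for `a(σ)`: multiplying the recursion
  -- of order `n` by the `j`-th derivative of the input and integrating over `[0, 1]` gives `G a =
  -- -h`. Both `G` and `h` are continuous in `σ`.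
  let G : Ss → Matrix (Fin n) (Fin n) ℝ := fun σ =>
    Matrix.of fun j k => ∫ s in (0 : ℝ)..1, y j σ s * y k σ s
  let h : Ss → Fin n → ℝ := fun σ j => ∫ s in (0 : ℝ)..1, y j σ s * y n σ s
  have hcont : ∀ j k, Continuous fun σ : Ss => ∫ s in (0 : ℝ)..1, y j σ s * y k σ s := fun j k =>
    intervalIntegral.continuous_parametric_intervalIntegral_of_continuous'
      (f := fun σ s => y j σ s * y k σ s) ((hy j).mul (hy k)) 0 1
  have hG : Continuous G := continuous_matrix fun j k => hcont j k
  have hh : Continuous h := continuous_pi fun j => hcont j n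
  have hint : ∀ j k σ, IntervalIntegrable (fun s => y j σ s * y k σ s) volume 0 1 :=
    fun j k σ => ((hys j σ).mul (hys k σ)).intervalIntegrable _ _
  -- The quadratic form of `G` at `x` is `∫ (xᵀ ξ)²`, positive for `x ≠ 0`.
  have hdet : ∀ σ, IsUnit (G σ).det := by
    intro σ
    rw [isUnit_iff_ne_zero]
    intro hdet
    obtain ⟨x, hx, hx0⟩ := Matrix.exists_mulVec_eq_zero_iff.2 hdet
    obtain ⟨hinj, ⟨C, hC, hj⟩, -⟩ := exists_modes hz hExc σ.2 hw
      (R.isExoTrajectory_flow σ v₀) (by simpa [R.flow_zero] using hv₀)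
    have hxi : Continuous fun s => R.xi (R.flow σ s v₀) σ w := by
      refine (PiLp.continuous_toLp 2 _).comp (continuous_pi fun k => hys k σ)
    have hpos := integral_sq_inner_pos hinj hC (ξ := fun s => R.xi (R.flow σ s v₀) σ w) hxi
      (fun t k => hj k t) (x := WithLp.toLp 2 x) (fun h0 => hx (by simpa using h0))
    have hzero : ∫ s in (0 : ℝ)..1, inner ℝ (WithLp.toLp 2 x) (R.xi (R.flow σ s v₀) σ w) ^ 2 =
        x ⬝ᵥ (G σ *ᵥ x) := by
      have h1 : ∀ s, inner ℝ (WithLp.toLp 2 x) (R.xi (R.flow σ s v₀) σ w) ^ 2 =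
          ∑ q : Fin n × Fin n, x q.1 * x q.2 * (y q.1 σ s * y q.2 σ s) := by
        intro s
        rw [inner_eq_sum, sq, Finset.sum_mul_sum, Fintype.sum_prod_type]
        exact Finset.sum_congr rfl fun j _ => Finset.sum_congr rfl fun k _ => by
          simp only [xi_apply, y]; ring
      simp only [h1]
      rw [integral_sum_const_mul _ fun q : Fin n × Fin n => hint q.1 q.2 σ, Fintype.sum_prod_type]
      simp only [dotProduct, Matrix.mulVec, Finset.mul_sum, G, Matrix.of_apply]
      exact Finset.sum_congr rfl fun j _ => Finset.sum_congr rfl fun k _ => by ring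
    rw [hzero, hx0] at hpos
    simp at hpos
  have ha : ∀ σ : Ss, R.a σ = WithLp.toLp 2 (-((G σ)⁻¹ *ᵥ h σ)) := by
    intro σ
    obtain ⟨-, -, hrec, -⟩ := exists_modes hz hExc σ.2 hw
      (R.isExoTrajectory_flow σ v₀) (by simpa [R.flow_zero] using hv₀)
    have h1 : h σ = -(G σ *ᵥ (R.a σ).ofLp) := by
      funext j
      simp only [h, Pi.neg_apply, Matrix.mulVec, dotProduct, G, Matrix.of_apply]
      have h2 : ∀ s, y j σ s * y n σ s = -∑ k : Fin n, R.a σ k * (y j σ s * y k σ s) := by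
        intro s
        have : y n σ s = -∑ k : Fin n, R.a σ k * y k σ s := hrec s
        rw [this, mul_neg, Finset.mul_sum]
        congr 1
        exact Finset.sum_congr rfl fun k _ => by ring
      simp only [h2]
      rw [intervalIntegral.integral_neg,
        integral_sum_const_mul _ fun k : Fin n => hint j k σ]
      congr 1
      exact Finset.sum_congr rfl fun k _ => mul_comm _ _
    rw [h1, Matrix.mulVec_neg, Matrix.mulVec_mulVec, Matrix.nonsing_inv_mul _ (hdet σ)]
    simp
  simp only [ha]
  exact (PiLp.continuous_toLp 2 _).comp
    ((hG.matrix_inv_of_isUnit_det hdet).matrix_mulVec hh).neg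

theorem continuous_rho
    (ha : Continuous fun σ : Ss => R.a σ) : Continuous fun σ : Ss => R.rho σ :=
  continuous_const.sub ha

theorem continuous_T (ha : Continuous fun σ : Ss => R.a σ)
    (hu : ∀ σ ∈ Ss, IsUnit (R.Tinv σ).det) : Continuous fun σ : Ss => R.T σ := by
  have hΦ : Continuous fun σ : Ss => R.Φ σ := by
    refine continuous_matrix fun i j => ?_
    have : Continuous fun σ : Ss => R.a σ j := (PiLp.continuous_apply 2 _ j).comp ha
    simp only [Φ, companionOf, Matrix.of_apply]
    split_ifs <;> fun_prop
  have hT : Continuous fun σ : Ss => R.Tinv σ := by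
    refine continuous_matrix fun k j => ?_
    simp only [Tinv, Matrix.of_apply]
    have h1 : Continuous fun σ : Ss => (R.rho σ).ofLp :=
      (PiLp.continuous_ofLp 2 _).comp (continuous_rho ha)
    exact (continuous_apply j).comp
      (h1.matrix_vecMul ((hΦ.add continuous_const).matrix_mul (hΦ.pow k)))
  exact hT.matrix_inv_of_isUnit_det fun σ => hu σ σ.2

theorem theta_eq (v : Vec nv) (σ : Vec nσ) (w : Vec nw) :
    R.theta v σ w = mulCLM (R.T σ) (R.xi v σ w) := rfl

theorem continuous_theta
    (hz : ContDiff ℝ ∞ (fun p : Vec nv × Vec nσ × Vec nw => R.zs p.1 p.2.1 p.2.2))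
    (hT : Continuous fun σ : Ss => R.T σ) :
    Continuous fun p : Vec nv × Ss × Vec nw => R.theta p.1 p.2.1 p.2.2 := by
  have h1 : Continuous fun p : Vec nv × Ss × Vec nw => R.xi p.1 p.2.1 p.2.2 :=
    (contDiff_xi hz).continuous.comp
      (f := fun p : Vec nv × Ss × Vec nw => (p.1, (p.2.1 : Vec nσ), p.2.2)) (by fun_prop)
  exact (continuous_mulCLM.comp (hT.comp (continuous_fst.comp continuous_snd))).clm_apply h1

theorem contDiff_theta_trajectory
    (hz : ContDiff ℝ ∞ (fun p : Vec nv × Vec nσ × Vec nw => R.zs p.1 p.2.1 p.2.2))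
    {σ : Vec nσ} {v : ℝ → Vec nv} (hv : R.IsExoTrajectory σ v) (w : Vec nw) :
    ContDiff ℝ ∞ fun t => R.theta (v t) σ w := by
  have h := hv.contDiff
  exact (mulCLM (R.T σ)).contDiff.comp ((contDiff_xi hz).comp
    (f := fun t => (v t, σ, w)) (by fun_prop))

/-- The steady state of the internal model is bounded and persistently exciting, uniformly over the
compact parameter sets. -/
theorem exists_uniform_excitation (hn : 0 < n)
    (hV : IsCompact Vs) (hW : IsCompact Ws) (hS : IsCompact Ss)
    (hVinv : ∀ σ ∈ Ss, ∀ v : ℝ → Vec nv, R.IsExoTrajectory σ v → v 0 ∈ Vs →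
      ∀ t, 0 ≤ t → v t ∈ Vs)
    (hz : ContDiff ℝ ∞ (fun p : Vec nv × Vec nσ × Vec nw => R.zs p.1 p.2.1 p.2.2))
    (hExc : R.AllModesExcited Vs Ws Ss R.zs R.freq) (hM : IsHurwitz R.M) :
    ∃ B ε : ℝ, 0 < B ∧ 0 < ε ∧
      (∀ v ∈ Vs, ∀ σ ∈ Ss, ∀ w ∈ Ws, ‖R.theta v σ w‖ ≤ B ∧ ‖R.rho σ‖ ≤ B) ∧
      ∀ σ ∈ Ss, ∀ w ∈ Ws, ∀ v : ℝ → Vec nv, R.IsExoTrajectory σ v → v 0 ∈ Vs → ∀ t, 0 ≤ t →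
        ∀ x : Vec n, ε * ‖x‖ ^ 2 ≤ ∫ s in t..(t + 1), inner ℝ (R.theta (v s) σ w) x ^ 2 := by
  rcases Vs.eq_empty_or_nonempty with rfl | ⟨v₀, hv₀⟩
  · exact ⟨1, 1, one_pos, one_pos, by simp, by simp⟩
  rcases Ws.eq_empty_or_nonempty with rfl | ⟨w₀, hw₀⟩
  · exact ⟨1, 1, one_pos, one_pos, by simp, by simp⟩
  have hu : ∀ σ ∈ Ss, IsUnit (R.Tinv σ).det := fun σ hσ => by
    obtain ⟨-, -, -, h⟩ := exists_modes hz hExc hσ hw₀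
      (R.isExoTrajectory_flow σ v₀) (by simpa [R.flow_zero] using hv₀)
    exact R.isUnit_det_Tinv hn hM (hExc σ hσ).1 h
  have ha := continuous_a hz hExc hv₀ hw₀
  have hθ := continuous_theta hz (continuous_T ha hu)
  have : CompactSpace Ss := isCompact_iff_compactSpace.1 hS
  have hK : IsCompact (Vs ×ˢ (univ : Set Ss) ×ˢ Ws) := hV.prod (isCompact_univ.prod hW)
  obtain ⟨B₁, hB₁⟩ := hK.exists_bound_of_continuousOn hθ.continuousOn
  obtain ⟨B₂, hB₂⟩ := isCompact_univ.exists_bound_of_continuousOn (continuous_rho ha).continuousOn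
  -- The excitation over a unit window as a function of direction, initial state and parameters.
  -- Being continuous and positive on a compact set, it has a positive lower bound `ε` there.
  let g : Vec n × Vec nv × Ss × Vec nw → ℝ := fun p =>
    ∫ s in (0 : ℝ)..1, inner ℝ (R.theta (R.flow p.2.2.1 s p.2.1) p.2.2.1 p.2.2.2) p.1 ^ 2
  have hg : Continuous g := by
    refine intervalIntegral.continuous_parametric_intervalIntegral_of_continuous'
      (f := fun (p : Vec n × Vec nv × Ss × Vec nw) s =>
        inner ℝ (R.theta (R.flow p.2.2.1 s p.2.1) p.2.2.1 p.2.2.2) p.1 ^ 2) ?_ 0 1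
    have h1 : Continuous fun q : (Vec n × Vec nv × Ss × Vec nw) × ℝ =>
        R.flow q.1.2.2.1 q.2 q.1.2.1 :=
      R.continuous_flow.comp (f := fun q : (Vec n × Vec nv × Ss × Vec nw) × ℝ =>
        ((q.1.2.2.1 : Vec nσ), q.2, q.1.2.1)) (by fun_prop)
    have h2 : Continuous fun q : (Vec n × Vec nv × Ss × Vec nw) × ℝ =>
        R.theta (R.flow q.1.2.2.1 q.2 q.1.2.1) q.1.2.2.1 q.1.2.2.2 :=
      hθ.comp (f := fun q : (Vec n × Vec nv × Ss × Vec nw) × ℝ =>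
        (R.flow q.1.2.2.1 q.2 q.1.2.1, q.1.2.2.1, q.1.2.2.2)) (by fun_prop)
    exact (h2.inner (by fun_prop)).pow 2
  have hgpos : ∀ p ∈ Metric.sphere (0 : Vec n) 1 ×ˢ Vs ×ˢ (univ : Set Ss) ×ˢ Ws, 0 < g p := by
    rintro ⟨x, v, σ, w⟩ ⟨hx, hv, -, hw⟩
    obtain ⟨hinj, ⟨C, hC, hj⟩, -⟩ := exists_modes hz hExc σ.2 hw
      (R.isExoTrajectory_flow σ v) (by simpa [R.flow_zero] using hv)
    have hTx : ∀ ξ : Vec n, inner ℝ (mulCLM (R.T σ) ξ) x =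
        inner ℝ ((mulCLM (R.T σ)).adjoint x) ξ := fun ξ => by
      rw [ContinuousLinearMap.adjoint_inner_left, real_inner_comm]
    -- If the transpose of `T` killed `x`, then `x` would be orthogonal to the range of `T`, which
    -- is everything.
    have hne : (mulCLM (R.T σ)).adjoint x ≠ 0 := by
      intro h0
      have h1 : inner ℝ (mulCLM (R.T σ) (mulCLM (R.Tinv σ) x)) x = 0 := by
        rw [hTx, h0, inner_zero_left]
      have h2 : mulCLM (R.T σ) (mulCLM (R.Tinv σ) x) = x := by
        have h3 : mulCLM (R.T σ) * mulCLM (R.Tinv σ) = 1 := by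
          have := map_mul (Matrix.toEuclideanCLM (𝕜 := ℝ) (n := Fin n)) (R.T σ) (R.Tinv σ)
          rw [RegSetup.T, Matrix.nonsing_inv_mul _ (hu σ σ.2), map_one] at this
          exact this.symm
        exact congrArg (fun L => L x) h3
      rw [h2, real_inner_self_eq_norm_sq] at h1
      have hx : ‖x‖ = 1 := by simpa using hx
      rw [hx] at h1
      norm_num at h1
    have hcxi : Continuous fun s => R.xi (R.flow σ s v) σ w :=
      (contDiff_xi hz).continuous.comp (f := fun s => (R.flow σ s v, (σ : Vec nσ), w)) (by
        have := (R.isExoTrajectory_flow (σ : Vec nσ) v).contDiff.continuous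
        fun_prop)
    have := integral_sq_inner_pos hinj hC (ξ := fun s => R.xi (R.flow σ s v) σ w) hcxi
      (fun t k => hj k t) hne
    simpa only [g, theta_eq, hTx] using this
  obtain ⟨ε, hε, hεg⟩ := ((isCompact_sphere (0 : Vec n) 1).prod hK).exists_forall_le'
    hg.continuousOn (a := 0) hgpos
  refine ⟨max (max B₁ B₂) 1, ε, by positivity, hε, ?_, ?_⟩
  · intro v hv σ hσ w hw
    exact ⟨(hB₁ (v, ⟨σ, hσ⟩, w) ⟨hv, mem_univ _, hw⟩).trans
      ((le_max_left _ _).trans (le_max_left _ _)),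
      (hB₂ ⟨σ, hσ⟩ (mem_univ _)).trans ((le_max_right _ _).trans (le_max_left _ _))⟩
  · intro σ hσ w hw v hv hv0 t ht x
    -- The window at time `t` is the window at time `0` of the trajectory issued from `v t`, which
    -- is still in `Vs` by invariance. The passage to general `x` uses homogeneity of degree two.
    have hshift : ∫ s in t..(t + 1), inner ℝ (R.theta (v s) σ w) x ^ 2 =
        g (x, v t, ⟨σ, hσ⟩, w) := by
      have h1 := intervalIntegral.integral_comp_add_left
        (fun s => inner ℝ (R.theta (v s) σ w) x ^ 2) t (a := 0) (b := 1)
      rw [add_zero] at h1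
      rw [← h1]
      have h2 := (hv.shift t).eq_flow
      simp only [add_zero] at h2
      simp only [h2, g]
    rw [hshift]
    rcases eq_or_ne x 0 with rfl | hx
    · simp [g]
    have hx' : 0 < ‖x‖ := norm_pos_iff.2 hx
    have h3 := hεg (‖x‖⁻¹ • x, v t, ⟨σ, hσ⟩, w)
      ⟨by simp [norm_smul, hx'.ne'], hVinv σ hσ v hv hv0 t ht, mem_univ _, hw⟩
    have h4 : g (‖x‖⁻¹ • x, v t, ⟨σ, hσ⟩, w) = (‖x‖ ^ 2)⁻¹ * g (x, v t, ⟨σ, hσ⟩, w) := by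
      simp only [g, inner_smul_right, mul_pow, intervalIntegral.integral_const_mul, inv_pow]
    rw [h4] at h3
    rwa [← div_eq_inv_mul, le_div_iff₀ (by positivity)] at h3

end RegSetup

/-! ### A strict Lyapunov function for the gradient system -/

theorem contDiff_primitive {E : Type*} [NormedAddCommGroup E] [NormedSpace ℝ E] [CompleteSpace E]
    {f : ℝ → E} (hf : ContDiff ℝ ∞ f) : ContDiff ℝ ∞ fun t => ∫ s in (0 : ℝ)..t, f s := by
  have h : ∀ t, HasDerivAt (fun t => ∫ s in (0 : ℝ)..t, f s) (f t) t := fun t =>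
    intervalIntegral.integral_hasDerivAt_right (hf.continuous.intervalIntegrable _ _)
      hf.continuous.aestronglyMeasurable.stronglyMeasurableAtFilter hf.continuous.continuousAt
  refine contDiff_infty_iff_deriv.2 ⟨fun t => (h t).differentiableAt, ?_⟩
  rwa [show deriv (fun t => ∫ s in (0 : ℝ)..t, f s) = f from funext fun t => (h t).deriv]

section Window

variable {E : Type*} [NormedAddCommGroup E] [NormedSpace ℝ E] [CompleteSpace E] {f : ℝ → E}

/-- The weighted integral `∫ₜᵗ⁺¹ (t + 1 - s) f(s) ds` over a moving window. -/
noncomputable def window (f : ℝ → E) (t : ℝ) : E :=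
  (t + 1) • ((∫ s in (0 : ℝ)..(t + 1), f s) - ∫ s in (0 : ℝ)..t, f s) -
    ((∫ s in (0 : ℝ)..(t + 1), s • f s) - ∫ s in (0 : ℝ)..t, s • f s)

/-- The definition uses only primitives with lower limit `0`, so smoothness in `t` reduces to that
of primitives. -/
theorem contDiff_window (hf : ContDiff ℝ ∞ f) : ContDiff ℝ ∞ (window f) := by
  have h1 := contDiff_primitive hf
  have h2 := contDiff_primitive (contDiff_id.smul hf)
  have h3 : ContDiff ℝ ∞ (fun t : ℝ => t + 1) := by fun_prop
  exact (h3.smul ((h1.comp h3).sub h1)).sub ((h2.comp h3).sub h2)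

/-- The weight `t + 1 - s` vanishes at the right end and is `1` at the left end, so only `-f t`
comes from the limits. The weight itself has derivative `1` in `t`, which yields the integral. -/
theorem hasDerivAt_window (hf : ContDiff ℝ ∞ f) (t : ℝ) :
    HasDerivAt (window f) ((∫ s in t..(t + 1), f s) - f t) t := by
  have hA := hf.continuous
  have hsA : Continuous fun s : ℝ => s • f s := continuous_id.smul hA
  have hd : ∀ {f : ℝ → E}, Continuous f → ∀ t,
      HasDerivAt (fun t => ∫ s in (0 : ℝ)..t, f s) (f t) t := fun hf t =>
    intervalIntegral.integral_hasDerivAt_right (hf.intervalIntegrable _ _)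
      hf.aestronglyMeasurable.stronglyMeasurableAtFilter hf.continuousAt
  have h3 : HasDerivAt (fun t : ℝ => t + 1) 1 t := (hasDerivAt_id t).add_const 1
  have h := (h3.smul (((hd hA (t + 1)).comp_add_const t 1).sub (hd hA t))).sub
    (((hd hsA (t + 1)).comp_add_const t 1).sub (hd hsA t))
  refine h.congr_deriv ?_
  rw [← intervalIntegral.integral_interval_sub_left (hA.intervalIntegrable 0 _)
    (hA.intervalIntegrable 0 _)]
  simp only [Pi.sub_apply]
  module

theorem clm_window (hf : ContDiff ℝ ∞ f) (L : E →L[ℝ] ℝ) (t : ℝ) :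
    L (window f t) = ∫ s in t..(t + 1), (t + 1 - s) * L (f s) := by
  have hA := hf.continuous
  have hsA : Continuous fun s : ℝ => s • f s := continuous_id.smul hA
  rw [window, intervalIntegral.integral_interval_sub_left (hA.intervalIntegrable _ _)
    (hA.intervalIntegrable _ _), intervalIntegral.integral_interval_sub_left
    (hsA.intervalIntegrable _ _) (hsA.intervalIntegrable _ _), ← intervalIntegral.integral_smul,
    ← intervalIntegral.integral_sub (Continuous.intervalIntegrable (by fun_prop) _ _)
      (hsA.intervalIntegrable _ _),
    ← ContinuousLinearMap.intervalIntegral_comp_comm _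
      (Continuous.intervalIntegrable (by fun_prop) _ _)]
  refine intervalIntegral.integral_congr fun s _ => ?_
  simp only [map_sub, map_smul, smul_eq_mul]
  ring

theorem clm_intervalIntegral (hf : Continuous f) (L : E →L[ℝ] ℝ) (a b : ℝ) :
    L (∫ s in a..b, f s) = ∫ s in a..b, L (f s) :=
  (L.intervalIntegral_comp_comm (hf.intervalIntegrable a b)).symm

end Window

/-- The bilinear form `(x, y) ↦ (θᵀx)(θᵀy)`. -/
noncomputable def outerForm {n : ℕ} (θ : Vec n) : Vec n →L[ℝ] Vec n →L[ℝ] ℝ :=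
  (innerSL ℝ θ).smulRight (innerSL ℝ θ)

theorem outerForm_apply {n : ℕ} (θ x y : Vec n) :
    outerForm θ x y = inner ℝ θ x * inner ℝ θ y := rfl

/-- The bilinear form `(x, y) ↦ ∫ₜᵗ⁺¹ (t + 1 - s) (θ(s)ᵀx)(θ(s)ᵀy) ds`. -/
noncomputable def windowForm {n : ℕ} (θ : ℝ → Vec n) : ℝ → Vec n →L[ℝ] Vec n →L[ℝ] ℝ :=
  window fun s => outerForm (θ s)

section WindowForm

variable {n : ℕ} {θ : ℝ → Vec n}

theorem contDiff_outerForm (hθ : ContDiff ℝ ∞ θ) : ContDiff ℝ ∞ fun s => outerForm (θ s) := by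
  have h : ContDiff ℝ ∞ fun s => innerSL ℝ (θ s) := (innerSL ℝ).contDiff.comp hθ
  exact h.smulRight h

theorem contDiff_windowForm (hθ : ContDiff ℝ ∞ θ) : ContDiff ℝ ∞ (windowForm θ) :=
  contDiff_window (contDiff_outerForm hθ)

theorem hasDerivAt_windowForm (hθ : ContDiff ℝ ∞ θ) (t : ℝ) :
    HasDerivAt (windowForm θ) ((∫ s in t..(t + 1), outerForm (θ s)) - outerForm (θ t)) t :=
  hasDerivAt_window (contDiff_outerForm hθ) t

/-- Evaluation of a bilinear form at a pair of vectors. -/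
noncomputable def evalPair {n : ℕ} (x y : Vec n) : (Vec n →L[ℝ] Vec n →L[ℝ] ℝ) →L[ℝ] ℝ :=
  (ContinuousLinearMap.apply ℝ ℝ y).comp (ContinuousLinearMap.apply ℝ (Vec n →L[ℝ] ℝ) x)

theorem windowForm_eq (hθ : ContDiff ℝ ∞ θ) (t : ℝ) (x y : Vec n) :
    windowForm θ t x y =
      ∫ s in t..(t + 1), (t + 1 - s) * (inner ℝ (θ s) x * inner ℝ (θ s) y) :=
  clm_window (contDiff_outerForm hθ) (evalPair x y) t

theorem integral_outerForm_apply (hθ : ContDiff ℝ ∞ θ) (t : ℝ) (x : Vec n) :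
    (∫ s in t..(t + 1), outerForm (θ s)) x x = ∫ s in t..(t + 1), inner ℝ (θ s) x ^ 2 := by
  have h := clm_intervalIntegral (contDiff_outerForm hθ).continuous (evalPair x x) t (t + 1)
  refine Eq.trans h (intervalIntegral.integral_congr fun s _ => ?_)
  exact (sq _).symm

theorem windowForm_symm (hθ : ContDiff ℝ ∞ θ) (t : ℝ) (x y : Vec n) :
    windowForm θ t x y = windowForm θ t y x := by
  simp only [windowForm_eq hθ, mul_comm (inner ℝ _ x)]

theorem windowForm_nonneg (hθ : ContDiff ℝ ∞ θ) (t : ℝ) (x : Vec n) : 0 ≤ windowForm θ t x x := by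
  rw [windowForm_eq hθ]
  refine intervalIntegral.integral_nonneg (by linarith) fun s hs => ?_
  exact mul_nonneg (by linarith [hs.2]) (mul_self_nonneg _)

theorem abs_windowForm_le (hθ : ContDiff ℝ ∞ θ) {B : ℝ} (hB : ∀ t, 0 ≤ t → ‖θ t‖ ≤ B)
    {t : ℝ} (ht : 0 ≤ t) (x y : Vec n) : |windowForm θ t x y| ≤ B ^ 2 * (‖x‖ * ‖y‖) := by
  rw [windowForm_eq hθ]
  have := intervalIntegral.norm_integral_le_of_norm_le_const (a := t) (b := t + 1)
    (f := fun s => (t + 1 - s) * (inner ℝ (θ s) x * inner ℝ (θ s) y)) (C := B ^ 2 * (‖x‖ * ‖y‖)) ?_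
  · simpa using this
  intro s hs
  rw [uIoc_of_le (by linarith)] at hs
  have hBs := hB s (by linarith [hs.1])
  have hi : ∀ z : Vec n, |inner ℝ (θ s) z| ≤ B * ‖z‖ := fun z =>
    (abs_real_inner_le_norm _ _).trans (by gcongr)
  rw [Real.norm_eq_abs, abs_mul, abs_mul]
  have h1 : |t + 1 - s| ≤ 1 := abs_le.2 ⟨by linarith [hs.2], by linarith [hs.1]⟩
  have hB0 : 0 ≤ B := (norm_nonneg _).trans hBs
  calc |t + 1 - s| * (|inner ℝ (θ s) x| * |inner ℝ (θ s) y|) ≤ 1 * ((B * ‖x‖) * (B * ‖y‖)) := by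
        gcongr
        exacts [hi x, hi y]
    _ = _ := by ring

end WindowForm

/-- The strict Lyapunov function of the gradient system `ϑ' = -Θ θ θᵀ ϑ`. -/
noncomputable def gradientLyap {n : ℕ} (κ : ℝ) (θ : ℝ → Vec n) (t : ℝ) (x : Vec n) : ℝ :=
  κ * ‖x‖ ^ 2 - windowForm θ t x x

/-- The weight in `gradientLyap`, in terms of the gain, the bound and the level of excitation. -/
noncomputable def gradientWeight (Θ B ε : ℝ) : ℝ :=
  B ^ 2 + 1 + (1 + 2 * Θ ^ 2 * B ^ 6 / ε) / (2 * Θ)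

section GradientLyap

variable {n : ℕ} {θ : ℝ → Vec n} {κ : ℝ}

theorem contDiff_gradientLyap (hθ : ContDiff ℝ ∞ θ) :
    ContDiff ℝ ∞ fun p : ℝ × Vec n => gradientLyap κ θ p.1 p.2 := by
  have h := ((contDiff_windowForm hθ).comp (contDiff_fst (F := Vec n))).clm_apply
    (contDiff_snd (E := ℝ)) |>.clm_apply (contDiff_snd (E := ℝ))
  exact (contDiff_const.mul ((contDiff_snd (E := ℝ)).norm_sq ℝ)).sub h

theorem fderiv_gradientLyap (hθ : ContDiff ℝ ∞ θ) (t : ℝ) (x y : Vec n) :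
    fderiv ℝ (gradientLyap κ θ t) x y = 2 * (κ * inner ℝ x y - windowForm θ t x y) := by
  have h1 : HasFDerivAt (fun x : Vec n => ‖x‖ ^ 2) (2 • innerSL ℝ x) x :=
    (hasStrictFDerivAt_norm_sq x).hasFDerivAt
  have h2 := (windowForm θ t).hasFDerivAt (x := x) |>.clm_apply (hasFDerivAt_id x)
  have h : HasFDerivAt (gradientLyap κ θ t) _ x := (h1.const_mul κ).sub h2
  rw [h.fderiv]
  simp [windowForm_symm hθ t y x]
  ring

theorem deriv_gradientLyap (hθ : ContDiff ℝ ∞ θ) (t : ℝ) (x : Vec n) :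
    deriv (fun s => gradientLyap κ θ s x) t =
      inner ℝ (θ t) x ^ 2 - ∫ s in t..(t + 1), inner ℝ (θ s) x ^ 2 := by
  have h := ((hasDerivAt_windowForm hθ t).clm_apply (hasDerivAt_const t x)).clm_apply
    (hasDerivAt_const t x)
  have h2 := (hasDerivAt_const t (κ * ‖x‖ ^ 2)).sub h
  rw [show (fun s => gradientLyap κ θ s x) =
    ((fun _ => κ * ‖x‖ ^ 2) - fun s => windowForm θ s x x) from rfl, h2.deriv]
  simp only [map_zero, add_zero, sub_apply, integral_outerForm_apply hθ, outerForm_apply]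
  ring

variable {B ε Θ : ℝ}

theorem gradientWeight_ge (hε : 0 < ε) (hΘ : 0 < Θ) : B ^ 2 + 1 ≤ gradientWeight Θ B ε := by
  have : 0 ≤ (1 + 2 * Θ ^ 2 * B ^ 6 / ε) / (2 * Θ) := by
    have : 0 ≤ B ^ 6 := by positivity
    positivity
  simp only [gradientWeight]
  linarith

theorem gradientLyap_bounds (hθ : ContDiff ℝ ∞ θ) (hB : ∀ t, 0 ≤ t → ‖θ t‖ ≤ B)
    (hκ : B ^ 2 + 1 ≤ κ) {t : ℝ} (ht : 0 ≤ t) (x : Vec n) :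
    1 * ‖x‖ ^ 2 ≤ gradientLyap κ θ t x ∧ gradientLyap κ θ t x ≤ κ * ‖x‖ ^ 2 := by
  have h1 := windowForm_nonneg hθ t x
  have h2 := (le_abs_self _).trans (abs_windowForm_le hθ hB ht x x)
  have h3 := mul_le_mul_of_nonneg_right hκ (sq_nonneg ‖x‖)
  constructor <;> simp only [gradientLyap] <;> nlinarith

theorem norm_fderiv_gradientLyap_le (hθ : ContDiff ℝ ∞ θ) (hB : ∀ t, 0 ≤ t → ‖θ t‖ ≤ B)
    (hκ : B ^ 2 + 1 ≤ κ) {t : ℝ} (ht : 0 ≤ t) (x : Vec n) :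
    ‖fderiv ℝ (gradientLyap κ θ t) x‖ ≤ (4 * κ) * ‖x‖ := by
  have hκ0 : 0 ≤ κ := by nlinarith [sq_nonneg B]
  refine ContinuousLinearMap.opNorm_le_bound _ (by positivity) fun y => ?_
  rw [fderiv_gradientLyap hθ, Real.norm_eq_abs, abs_mul, abs_two]
  have h1 := abs_windowForm_le hθ hB ht x y
  have h2 : |κ * inner ℝ x y| ≤ κ * (‖x‖ * ‖y‖) := by
    rw [abs_mul, abs_of_nonneg hκ0]
    gcongr
    exact abs_real_inner_le_norm _ _
  have h3 := abs_sub (κ * inner ℝ x y) (windowForm θ t x y)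
  have h4 : B ^ 2 * (‖x‖ * ‖y‖) ≤ κ * (‖x‖ * ‖y‖) := by gcongr; linarith
  linarith

/-- With `p = θᵀ x` and `q` the window form at `(x, θ)`, the derivative is `p² - ∫ (θᵀ x)² - 2Θκp² +
2Θpq`. Excitation gives `-ε‖x‖²`, half of which pays for the cross term; everything else is a
multiple of `p²`. -/
theorem dotAlong_gradientLyap_le (hθ : ContDiff ℝ ∞ θ) (hB0 : 0 < B) (hε : 0 < ε) (hΘ : 0 < Θ)
    (hB : ∀ t, 0 ≤ t → ‖θ t‖ ≤ B)
    (hPE : ∀ t, 0 ≤ t → ∀ x : Vec n, ε * ‖x‖ ^ 2 ≤ ∫ s in t..(t + 1), inner ℝ (θ s) x ^ 2)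
    {t : ℝ} (ht : 0 ≤ t) (x : Vec n) :
    dotAlong (gradientLyap (gradientWeight Θ B ε) θ) t x (-((Θ * inner ℝ (θ t) x) • θ t)) ≤
      -(ε / 2) * ‖x‖ ^ 2 := by
  rw [dotAlong, deriv_gradientLyap hθ, map_neg, map_smul, fderiv_gradientLyap hθ]
  set κ := gradientWeight Θ B ε with hκ
  have h1 := hPE t ht x
  have h2 : |windowForm θ t x (θ t)| ≤ B ^ 3 * ‖x‖ :=
    (abs_windowForm_le hθ hB ht x (θ t)).trans (by
      calc B ^ 2 * (‖x‖ * ‖θ t‖) ≤ B ^ 2 * (‖x‖ * B) := by gcongr; exact hB t ht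
        _ = _ := by ring)
  set p := inner ℝ (θ t) x with hp
  rw [real_inner_comm, ← hp, smul_eq_mul]
  set q := windowForm θ t x (θ t)
  have h3 : 2 * Θ * (p * q) ≤ ε / 2 * ‖x‖ ^ 2 + 2 * Θ ^ 2 * B ^ 6 / ε * p ^ 2 := by
    have h4 : p * q ≤ |p| * (B ^ 3 * ‖x‖) :=
      (le_abs_self _).trans (by rw [abs_mul]; gcongr)
    have h5 : 2 * Θ * (|p| * (B ^ 3 * ‖x‖)) ≤
        ε / 2 * ‖x‖ ^ 2 + 2 * Θ ^ 2 * B ^ 6 / ε * |p| ^ 2 := by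
      have : ε / 2 * ‖x‖ ^ 2 + 2 * Θ ^ 2 * B ^ 6 / ε * |p| ^ 2 - 2 * Θ * (|p| * (B ^ 3 * ‖x‖)) =
          (ε * ‖x‖ - 2 * Θ * B ^ 3 * |p|) ^ 2 / (2 * ε) := by
        field_simp
        ring
      have h6 : 0 ≤ (ε * ‖x‖ - 2 * Θ * B ^ 3 * |p|) ^ 2 / (2 * ε) := by positivity
      linarith
    rw [sq_abs] at h5
    nlinarith
  -- The last summand of the weight is chosen to cancel exactly `p²` and the `p²` part of Young's
  -- inequality. The summand `B² + 1`, needed for `W ≥ ‖x‖²`, only helps here.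
  have h7 : 2 * Θ * κ * p ^ 2 = 2 * Θ * (B ^ 2 + 1) * p ^ 2 + p ^ 2
      + 2 * Θ ^ 2 * B ^ 6 / ε * p ^ 2 := by
    rw [hκ, gradientWeight]
    field_simp
    ring
  have h8 : 0 ≤ 2 * Θ * (B ^ 2 + 1) * p ^ 2 := by positivity
  nlinarith

end GradientLyap

/-! ### Integral input-to-state stability from a dissipation inequality -/

/-- The chain rule for a function of time and state along a curve. -/
theorem hasDerivAt_along {X : Type*} [NormedAddCommGroup X] [NormedSpace ℝ X] {W : ℝ → X → ℝ}
    {t : ℝ} {x : ℝ → X} {ξ : X}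
    (hW : DifferentiableAt ℝ (fun p : ℝ × X => W p.1 p.2) (t, x t))
    (hx : HasDerivAt x ξ t) : HasDerivAt (fun s => W s (x s)) (dotAlong W t (x t) ξ) t := by
  set L := fderiv ℝ (fun p : ℝ × X => W p.1 p.2) (t, x t)
  have hL : HasFDerivAt (fun p : ℝ × X => W p.1 p.2) L (t, x t) := hW.hasFDerivAt
  have h1 : HasDerivAt (fun s => W s (x t)) (L (1, 0)) t :=
    hL.comp_hasDerivAt (f := fun s => (s, x t)) t ((hasDerivAt_id t).prodMk (hasDerivAt_const t (x t)))
  have h2 : HasFDerivAt (W t) (L.comp (ContinuousLinearMap.inr ℝ ℝ X)) (x t) :=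
    hL.comp (f := fun y => (t, y)) (x t) (hasFDerivAt_prodMk_right t (x t))
  have h3 : HasDerivAt (fun s => W s (x s)) (L (1, ξ)) t :=
    hL.comp_hasDerivAt (f := fun s => (s, x s)) t ((hasDerivAt_id t).prodMk hx)
  refine h3.congr_deriv ?_
  rw [dotAlong, h1.deriv, h2.fderiv, ContinuousLinearMap.comp_apply, ContinuousLinearMap.inr_apply,
    ← map_add]
  simp

/-- A `C¹` function along a Lipschitz curve is absolutely continuous. -/
theorem absolutelyContinuousOnInterval_comp {E : Type*} [NormedAddCommGroup E] [NormedSpace ℝ E]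
    [ProperSpace E] {Ψ : E → ℝ} (hΨ : ContDiff ℝ ∞ Ψ) {c : ℝ → E} {a b : ℝ} {K : NNReal}
    (hc : LipschitzOnWith K c (uIcc a b)) :
    AbsolutelyContinuousOnInterval (fun s => Ψ (c s)) a b := by
  obtain ⟨r, hr⟩ := (isCompact_uIcc.image_of_continuousOn hc.continuousOn).isBounded.subset_closedBall 0
  obtain ⟨B, hB⟩ := (isCompact_closedBall (0 : E) r).exists_bound_of_continuousOn
    (hΨ.continuous_fderiv (by simp)).continuousOn
  have hlip : LipschitzOnWith B.toNNReal Ψ (Metric.closedBall 0 r) :=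
    (convex_closedBall 0 r).lipschitzOnWith_of_nnnorm_fderiv_le
      (fun y _ => hΨ.differentiable (by simp) y) fun y hy => by
        rw [← NNReal.coe_le_coe, coe_nnnorm]
        exact (hB y hy).trans (Real.le_coe_toNNReal B)
  exact (hlip.comp hc fun s hs => hr (mem_image_of_mem c hs)).absolutelyContinuousOnInterval

theorem lipschitzOnWith_primitive {X : Type*} [NormedAddCommGroup X] [NormedSpace ℝ X]
    {f : ℝ → X} {a b : ℝ} (hab : a ≤ b) (hf : IntervalIntegrable f volume a b) {M : ℝ}
    (hM : ∀ s ∈ Icc a b, ‖f s‖ ≤ M) :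
    LipschitzOnWith M.toNNReal (fun t => ∫ s in a..t, f s) (uIcc a b) := by
  rw [uIcc_of_le hab]
  refine LipschitzOnWith.of_dist_le_mul fun s hs t ht => ?_
  have hi : ∀ t ∈ Icc a b, IntervalIntegrable f volume a t := fun t ht =>
    hf.mono_set (by rw [uIcc_of_le hab, uIcc_of_le ht.1]; exact Icc_subset_Icc_right ht.2)
  rw [dist_eq_norm, intervalIntegral.integral_interval_sub_left (hi s hs) (hi t ht), Real.dist_eq]
  refine (intervalIntegral.norm_integral_le_of_norm_le_const (C := M) fun y hy => hM y ?_).trans ?_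
  · have := uIoc_subset_uIcc hy
    exact (uIcc_subset_Icc ht hs) this
  · gcongr
    exact Real.le_coe_toNNReal M

/-- Along Carathéodory solutions the right-hand side is merely integrable in time, so derivatives
exist only almost everywhere. -/
theorem ae_hasDerivAt_primitive {X : Type*} [NormedAddCommGroup X] [NormedSpace ℝ X]
    [CompleteSpace X] {f : ℝ → X} {a b : ℝ} (hf : IntervalIntegrable f volume a b) :
    ∀ᵐ s, s ∈ uIcc a b → HasDerivAt (fun t => ∫ s in a..t, f s) (f s) s := by
  filter_upwards [hf.ae_hasDerivAt_integral] with s hs h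
  exact hs h a (by simp)

/-- A function along a Lipschitz curve with nonpositive derivative almost everywhere decreases. -/
theorem le_of_ae_hasDerivAt_nonpos {Z : ℝ → ℝ} {a b : ℝ} (hab : a ≤ b)
    (hZ : AbsolutelyContinuousOnInterval Z a b)
    (h : ∀ᵐ s, s ∈ Ioo a b → ∃ d ≤ 0, HasDerivAt Z d s) : Z b ≤ Z a := by
  have h1 := hZ.integral_deriv_eq_sub
  have h2 : 0 ≤ ∫ s in a..b, -deriv Z s := by
    refine intervalIntegral.integral_nonneg_of_ae_restrict hab ?_
    rw [EventuallyLE, ae_restrict_iff' measurableSet_Icc]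
    have ha : ∀ᵐ s : ℝ, s ≠ a := by simp [ae_iff, measure_singleton]
    have hb : ∀ᵐ s : ℝ, s ≠ b := by simp [ae_iff, measure_singleton]
    filter_upwards [h, ha, hb] with s hs hsa hsb hmem
    obtain ⟨d, hd, hder⟩ := hs ⟨lt_of_le_of_ne hmem.1 (Ne.symm hsa), lt_of_le_of_ne hmem.2 hsb⟩
    rw [hder.deriv]
    simpa using hd
  rw [intervalIntegral.integral_neg] at h2
  linarith

/-- A dissipation inequality `W' ≤ -k W + γ(‖u‖) (W + 1)` for a function `W` comparable with `‖x‖²`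
implies integral input-to-state stability. -/
theorem isIntegralISS_of_dissipation {X U : Type*} [NormedAddCommGroup X] [NormedSpace ℝ X]
    [FiniteDimensional ℝ X] [NormedAddCommGroup U] [MeasurableSpace U] [OpensMeasurableSpace U]
    {f : ℝ → X → U → X} {W : ℝ → X → ℝ} {c₁ c₂ k : ℝ} {γ : ℝ → ℝ} (hc₁ : 0 < c₁) (hc₂ : 0 < c₂)
    (hk : 0 < k) (hγK : IsClassK γ) (hγ : Continuous γ)
    (hW : ContDiff ℝ ∞ fun p : ℝ × X => W p.1 p.2)
    (hbd : ∀ t, 0 ≤ t → ∀ x, c₁ * ‖x‖ ^ 2 ≤ W t x ∧ W t x ≤ c₂ * ‖x‖ ^ 2)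
    (hdot : ∀ t, 0 ≤ t → ∀ x u, dotAlong W t x (f t x u) ≤ -k * W t x + γ ‖u‖ * (W t x + 1))
    (hf : ∀ r : ℝ, ∃ M : ℝ, ∀ t, 0 ≤ t → ∀ x u, ‖x‖ ≤ r → ‖u‖ ≤ r → ‖f t x u‖ ≤ M) :
    IsIntegralISS f := by
  have : ProperSpace X := FiniteDimensional.proper_real X
  have : CompleteSpace X := FiniteDimensional.complete ℝ X
  refine ⟨_, _, γ, (isClassKInf_log hc₁).comp_sq, isClassKL_log hc₂ hk, hγK, ?_⟩
  intro u x t₀ T ht₀ hu hx t ht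
  obtain ⟨hxc, hxi, hxeq⟩ := hx
  have hsub : Icc t₀ t ⊆ Icc t₀ T := Icc_subset_Icc_right ht.2
  -- bounds on the compact time interval
  obtain ⟨Bu, hBu⟩ := hu.2 t₀ t
  obtain ⟨Bx, hBx⟩ := isCompact_Icc.exists_bound_of_continuousOn (hxc.mono hsub)
  obtain ⟨M, hM⟩ := hf (max Bx Bu)
  have hfM : ∀ s ∈ Icc t₀ t, ‖f s (x s) (u s)‖ ≤ M := fun s hs =>
    hM s (ht₀.trans hs.1) _ _ ((hBx s hs).trans (le_max_left _ _)) ((hBu s hs).trans (le_max_right _ _))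
  have hfi : IntervalIntegrable (fun s => f s (x s) (u s)) volume t₀ t :=
    hxi.mono_set (by rw [uIcc_of_le ht.1, uIcc_of_le (ht.1.trans ht.2)]; exact hsub)
  have hγb : ∀ s ∈ Icc t₀ t, ‖γ ‖u s‖‖ ≤ γ Bu := fun s hs => by
    have h0 : 0 ≤ ‖u s‖ := norm_nonneg _
    have h1 : γ 0 ≤ γ ‖u s‖ := hγK.2.1.monotoneOn (mem_Ici.2 le_rfl) (mem_Ici.2 h0) h0
    rw [hγK.2.2] at h1
    rw [Real.norm_of_nonneg h1]
    exact hγK.2.1.monotoneOn (mem_Ici.2 h0) (mem_Ici.2 (h0.trans (hBu s hs))) (hBu s hs)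
  have hγi : IntervalIntegrable (fun s => γ ‖u s‖) volume t₀ t := by
    rw [intervalIntegrable_iff_integrableOn_Icc_of_le ht.1]
    refine Measure.integrableOn_of_bounded (M := γ Bu) (by simp) ?_ ?_
    · exact (hγ.measurable.comp hu.1.norm).aestronglyMeasurable
    · rw [ae_restrict_iff' measurableSet_Icc]
      exact Eventually.of_forall hγb
  set J : ℝ → ℝ := fun s => ∫ r in t₀..s, γ ‖u r‖ with hJ
  set y : ℝ → X := fun s => x t₀ + ∫ r in t₀..s, f r (x r) (u r) with hy
  have hyx : ∀ s ∈ Icc t₀ t, x s = y s := fun s hs => hxeq s (hsub hs)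
  -- the discounted function
  let Ψ : ℝ × X × ℝ → ℝ := fun p =>
    ((W p.1 p.2.1 + 1) * Real.exp (-p.2.2) - 1) * Real.exp (k * (p.1 - t₀))
  have hΨ : ContDiff ℝ ∞ Ψ := by
    have h1 : ContDiff ℝ ∞ fun p : ℝ × X × ℝ => W p.1 p.2.1 :=
      hW.comp (f := fun p : ℝ × X × ℝ => (p.1, p.2.1)) (by fun_prop)
    fun_prop
  have hclip : ∃ K, LipschitzOnWith K (fun s => (s, y s, J s)) (uIcc t₀ t) := by
    have h1 := (LipschitzWith.const (α := ℝ) (x t₀)).lipschitzOnWith (s := uIcc t₀ t) |>.add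
      (lipschitzOnWith_primitive ht.1 hfi hfM)
    have h2 := lipschitzOnWith_primitive ht.1 hγi hγb
    exact ⟨_, (LipschitzWith.id.lipschitzOnWith).prodMk (h1.prodMk h2)⟩
  obtain ⟨K, hK⟩ := hclip
  have hAC := absolutelyContinuousOnInterval_comp hΨ hK
  -- With `E = e^{k(s-t₀)}`, the derivative of `((W+1)e^{-J} - 1)E` is `(W' - γ(W+1) + kW) e^{-J} E
  -- + k E (e^{-J} - 1)`. The first term is nonpositive by dissipation, the second because `J ≥ 0`.
  have hle : Ψ (t, y t, J t) ≤ Ψ (t₀, y t₀, J t₀) := by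
    refine le_of_ae_hasDerivAt_nonpos ht.1 hAC ?_
    filter_upwards [ae_hasDerivAt_primitive hfi, ae_hasDerivAt_primitive hγi] with s h1 h2 hs
    have hsI : s ∈ Icc t₀ t := Ioo_subset_Icc_self hs
    have hsu : s ∈ uIcc t₀ t := by rwa [uIcc_of_le ht.1]
    have hs0 : 0 ≤ s := ht₀.trans hsI.1
    have hyd : HasDerivAt y (f s (x s) (u s)) s := (h1 hsu).const_add (x t₀)
    have hWd : HasDerivAt (fun r => W r (y r)) (dotAlong W s (y s) (f s (x s) (u s))) s :=
      hasDerivAt_along (hW.differentiable (by simp) _) hyd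
    have hJd : HasDerivAt (fun r => Real.exp (-J r)) (Real.exp (-J s) * -γ ‖u s‖) s :=
      (h2 hsu).neg.exp
    have hEd : HasDerivAt (fun r => Real.exp (k * (r - t₀))) (Real.exp (k * (s - t₀)) * (k * 1)) s :=
      (((hasDerivAt_id s).sub_const t₀).const_mul k).exp
    have hZ := (((hWd.add_const 1).mul hJd).sub_const 1).mul hEd
    refine ⟨_, ?_, hZ⟩
    rw [← hyx s hsI]
    have hd := hdot s hs0 (x s) (u s)
    set w := W s (x s)
    set d := dotAlong W s (x s) (f s (x s) (u s))
    have hE := Real.exp_pos (k * (s - t₀))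
    have hEJ := Real.exp_pos (-J s)
    have h3 : (d - γ ‖u s‖ * (w + 1) + k * w) * (Real.exp (-J s) * Real.exp (k * (s - t₀))) ≤ 0 :=
      mul_nonpos_of_nonpos_of_nonneg (by linarith) (mul_pos hEJ hE).le
    have h4 : Real.exp (-J s) ≤ 1 := by
      have : 0 ≤ J s := intervalIntegral.integral_nonneg hs.1.le fun r hr => by
        have h0 : 0 ≤ ‖u r‖ := norm_nonneg _
        have := hγK.2.1.monotoneOn (mem_Ici.2 le_rfl) (mem_Ici.2 h0) h0
        rwa [hγK.2.2] at this
      exact Real.exp_le_one_iff.2 (by linarith)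
    have h5 : k * Real.exp (k * (s - t₀)) * (Real.exp (-J s) - 1) ≤ 0 :=
      mul_nonpos_of_nonneg_of_nonpos (by positivity) (by linarith)
    simp only [Pi.mul_apply]
    rw [← hyx s hsI]
    linarith
  have hy0 : y t₀ = x t₀ := by simp [hy]
  have hJ0 : J t₀ = 0 := by simp [hJ]
  rw [← hyx t ⟨ht.1, le_rfl⟩, hy0, hJ0] at hle
  simp only [Ψ, sub_self, mul_zero, Real.exp_zero, mul_one, neg_zero, add_sub_cancel_right] at hle
  obtain ⟨hw1, -⟩ := hbd t (ht₀.trans ht.1) (x t)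
  obtain ⟨-, hw2⟩ := hbd t₀ ht₀ (x t₀)
  have hE : Real.exp (k * (t - t₀)) * Real.exp (-k * (t - t₀)) = 1 := by
    rw [← Real.exp_add]; simp
  have h1 : (W t (x t) + 1) * Real.exp (-J t) ≤
      c₂ * ‖x t₀‖ ^ 2 * Real.exp (-k * (t - t₀)) + 1 := by
    have := mul_le_mul_of_nonneg_right (hle.trans hw2) (Real.exp_pos (-k * (t - t₀))).le
    rw [mul_assoc, hE, mul_one] at this
    linarith
  have h2 : c₁ * ‖x t‖ ^ 2 + 1 ≤
      (c₂ * ‖x t₀‖ ^ 2 * Real.exp (-k * (t - t₀)) + 1) * Real.exp (J t) := by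
    have hE2 : Real.exp (-J t) * Real.exp (J t) = 1 := by rw [← Real.exp_add]; simp
    have := mul_le_mul_of_nonneg_right h1 (Real.exp_pos (J t)).le
    rw [mul_assoc, hE2, mul_one] at this
    linarith
  -- The logarithm turns the factor `e^J` into the additive integral of `γ(‖u‖)`.
  calc Real.log (c₁ * ‖x t‖ ^ 2 + 1)
      ≤ Real.log ((c₂ * ‖x t₀‖ ^ 2 * Real.exp (-k * (t - t₀)) + 1) * Real.exp (J t)) :=
        Real.log_le_log (by positivity) h2
    _ = _ := by rw [Real.log_mul (by positivity) (Real.exp_pos _).ne', Real.log_exp]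

/-- A system which a bounded input can freeze at every state is not input-to-state stable. -/
theorem not_isISS_of_freezing_input {X U : Type*} [NormedAddCommGroup X] [NormedSpace ℝ X]
    [Nontrivial X] [NormedAddCommGroup U] [MeasurableSpace U] {f : ℝ → X → U → X} {u : ℝ → U}
    (hu : IsInput u) {r : ℝ} (hr : ∀ s, 0 ≤ s → ‖u s‖ ≤ r) (hf : ∀ s x, f s x (u s) = 0) :
    ¬ IsISS f := by
  rintro ⟨β, γ, hβ, -, h⟩
  -- A constant solution starting beyond the gain `γ r` contradicts the decay of `β` to zero.
  obtain ⟨x₀, hx₀⟩ : ∃ x₀ : X, γ r < ‖x₀‖ := NormedSpace.exists_lt_norm ℝ X (γ r)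
  have h1 : ∀ t, 0 ≤ t → ‖x₀‖ ≤ β ‖x₀‖ t + γ r := fun t ht => by
    have := h u (fun _ => x₀) 0 t le_rfl hu ⟨continuousOn_const, by simp [hf], by simp [hf]⟩ t
      ⟨ht, le_rfl⟩ r fun s hs => hr s hs.1
    simpa using this
  have h2 : Tendsto (fun t => β ‖x₀‖ t + γ r) atTop (𝓝 (0 + γ r)) :=
    (hβ.2.2 ‖x₀‖ (norm_nonneg _)).2.add_const _
  have h3 := ge_of_tendsto h2 (eventually_atTop.2 ⟨0, h1⟩)
  linarith

/-! ### Lyapunov estimates for the `z̄` and `(η̄, π̄)` subsystems -/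

/-- The quadratic form `x ↦ b(x, x)` of a continuous bilinear form. -/
noncomputable def quadOf {E : Type*} [NormedAddCommGroup E] [NormedSpace ℝ E]
    (b : E →L[ℝ] E →L[ℝ] ℝ) : QuadraticForm ℝ E :=
  LinearMap.BilinMap.toQuadraticMap b.toLinearMap₁₂

section QuadOf

variable {E : Type*} [NormedAddCommGroup E] [NormedSpace ℝ E] (b : E →L[ℝ] E →L[ℝ] ℝ)

theorem quadOf_apply (x : E) : quadOf b x = b x x := rfl

theorem contDiff_quadOf : ContDiff ℝ ∞ fun x => quadOf b x := by
  simp only [quadOf_apply]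
  exact b.contDiff.clm_apply contDiff_id

theorem hasFDerivAt_quadOf (hb : ∀ x y, b x y = b y x) (x : E) :
    HasFDerivAt (fun x => quadOf b x) ((2 : ℝ) • b x) x := by
  simp only [quadOf_apply]
  refine (b.hasFDerivAt (x := x) |>.clm_apply (hasFDerivAt_id x)).congr_fderiv ?_
  ext y
  simp [hb y x]
  ring

end QuadOf

/-- A perturbed linear system with quadratic Lyapunov function: completing the square. -/
theorem lyapunov_perturbed {n : ℕ} {b : Vec n →L[ℝ] Vec n →L[ℝ] ℝ} {A : Matrix (Fin n) (Fin n) ℝ}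
    {c C : ℝ} (hc : 0 < c) (hC : ‖b‖ ≤ C) (hb : ∀ x, 2 * b x (mulE A x) ≤ -c * ‖x‖ ^ 2)
    (x d : Vec n) : 2 * b x (mulE A x + d) ≤ -(c / 2) * ‖x‖ ^ 2 + 2 * C ^ 2 / c * ‖d‖ ^ 2 := by
  have h1 : b x d ≤ C * ‖x‖ * ‖d‖ :=
    (le_abs_self _).trans ((b.le_opNorm₂ x d).trans (by gcongr))
  have h2 : c / 2 * ‖x‖ ^ 2 + 2 * C ^ 2 / c * ‖d‖ ^ 2 - 2 * (C * ‖x‖ * ‖d‖) =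
      (c * ‖x‖ - 2 * C * ‖d‖) ^ 2 / (2 * c) := by
    field_simp
    ring
  have h3 : 0 ≤ (c * ‖x‖ - 2 * C * ‖d‖) ^ 2 / (2 * c) := by positivity
  have h4 := hb x
  rw [map_add]
  linarith

theorem apply_self_le {n : ℕ} {b : Vec n →L[ℝ] Vec n →L[ℝ] ℝ} {C : ℝ} (hC : ‖b‖ ≤ C) (x : Vec n) :
    b x x ≤ C * ‖x‖ ^ 2 :=
  (le_abs_self _).trans ((b.le_opNorm₂ x x).trans (by rw [mul_assoc, ← sq]; gcongr))

namespace RegSetup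

variable {nz nv nw nσ n : ℕ} {R : RegSetup nz nv nw nσ n}
  {Vs : Set (Vec nv)} {Ws : Set (Vec nw)} {Ss : Set (Vec nσ)}

theorem exists_Gbar_bound (hV : IsCompact Vs) (hW : IsCompact Ws) :
    ∃ g : ℝ → ℝ, ContDiff ℝ ∞ g ∧ Monotone g ∧ (∀ s, 0 < g s) ∧
      ∀ v ∈ Vs, ∀ w ∈ Ws, ∀ e : ℝ, ‖R.Gbar e v w‖ ^ 2 ≤ e ^ 2 * g (e ^ 2) := by
  obtain ⟨g, h1, h2, h3, h4⟩ := exists_increment_bound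
    (k := fun y (p : Vec nv × Vec nw) => y • R.G y p.1 p.2) (q := fun p => R.q p.1 p.2)
    (contDiff_fst.smul R.smooth_G) R.smooth_q.continuous (hV.prod hW)
  exact ⟨g, h1, h2, h3, fun v hv w hw e => h4 (v, w) ⟨hv, hw⟩ e⟩

theorem exists_Kbar_bound (hV : IsCompact Vs) (hW : IsCompact Ws) :
    ∃ g : ℝ → ℝ, ContDiff ℝ ∞ g ∧ Monotone g ∧ (∀ s, 0 < g s) ∧
      ∀ v ∈ Vs, ∀ w ∈ Ws, ∀ e : ℝ, R.Kbar e v w ^ 2 ≤ e ^ 2 * g (e ^ 2) := by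
  obtain ⟨g, h1, h2, h3, h4⟩ := exists_increment_bound
    (k := fun y (p : Vec nv × Vec nw) => R.K y p.1 p.2 * y) (q := fun p => R.q p.1 p.2)
    (R.smooth_K.mul contDiff_fst) R.smooth_q.continuous (hV.prod hW)
  refine ⟨g, h1, h2, h3, fun v hv w hw e => ?_⟩
  have := h4 (v, w) ⟨hv, hw⟩ e
  rwa [Real.norm_eq_abs, sq_abs] at this

theorem exists_plant_bound (hV : IsCompact Vs) (hW : IsCompact Ws) (hS : IsCompact Ss) :
    ∃ D : ℝ, 1 ≤ D ∧ ∀ v ∈ Vs, ∀ σ ∈ Ss, ∀ w ∈ Ws, |R.b w v| ≤ D ∧ |(R.b w v)⁻¹| ≤ D ∧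
      ‖R.H w‖ ≤ D ∧ |R.exoDeriv σ (fun v' => (R.b w v')⁻¹) v| ≤ D := by
  have hK : IsCompact (Vs ×ˢ Ss ×ˢ Ws) := hV.prod (hS.prod hW)
  have hb : Continuous fun p : Vec nv × Vec nσ × Vec nw => R.b p.2.2 p.1 :=
    R.smooth_b.continuous.comp (f := fun p : Vec nv × Vec nσ × Vec nw => (p.2.2, p.1)) (by fun_prop)
  have hH : Continuous fun p : Vec nv × Vec nσ × Vec nw => R.H p.2.2 :=
    R.smooth_H.continuous.comp (by fun_prop)
  obtain ⟨D₁, h₁⟩ := hK.exists_bound_of_continuousOn hb.continuousOn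
  obtain ⟨D₂, h₂⟩ := hK.exists_bound_of_continuousOn
    (R.contDiff_b_inv (nσ := nσ)).continuous.continuousOn
  obtain ⟨D₃, h₃⟩ := hK.exists_bound_of_continuousOn hH.continuousOn
  obtain ⟨D₄, h₄⟩ := hK.exists_bound_of_continuousOn
    (R.contDiff_exoDeriv (f := fun v _ w => (R.b w v)⁻¹) R.contDiff_b_inv).continuous.continuousOn
  refine ⟨max 1 (max (max D₁ D₂) (max D₃ D₄)), le_max_left _ _, fun v hv σ hσ w hw => ?_⟩
  have hp : (v, σ, w) ∈ Vs ×ˢ Ss ×ˢ Ws := ⟨hv, hσ, hw⟩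
  refine ⟨(h₁ _ hp).trans ?_, (h₂ _ hp).trans ?_, (h₃ _ hp).trans ?_, (h₄ _ hp).trans ?_⟩ <;> simp

/-- The `z̄`-subsystem is input-to-state stable with a quadratic Lyapunov function. -/
theorem exists_z_lyapunov (hV : IsCompact Vs) (hW : IsCompact Ws)
    (hF : ∀ w ∈ Ws, IsHurwitz (R.F w)) :
    ∃ (V₀ : Vec nw → QuadraticForm ℝ (Vec nz)) (A₀ k₀ : ℝ) (δ₀ : ℝ → ℝ),
      0 < A₀ ∧ 0 < k₀ ∧ IsClassK δ₀ ∧ ∀ w ∈ Ws, ContDiff ℝ ∞ (fun z => V₀ w z) ∧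
        (∀ z, 1 * ‖z‖ ^ 2 ≤ V₀ w z ∧ V₀ w z ≤ A₀ * ‖z‖ ^ 2) ∧
        ∀ v ∈ Vs, ∀ (z : Vec nz) (e : ℝ),
          fderiv ℝ (fun z' => V₀ w z') z (R.zRhs z e v w) ≤ -k₀ * V₀ w z + δ₀ (e ^ 2) := by
  obtain ⟨b, c, C, hc, hC, hs, hb⟩ := exists_uniform_lyapunov R.continuous_F hW hF
  obtain ⟨g, hg, hgm, hgp, hG⟩ := exists_Gbar_bound (R := R) hV hW
  refine ⟨fun w => quadOf (b w), C, c / (2 * C), fun s => s * (2 * C ^ 2 / c * g s), hC,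
    by positivity, ?_, fun w hw => ?_⟩
  · refine (isClassKInf_mul (continuous_const.mul hg.continuous) ?_ ?_).1
    · exact hgm.const_mul (by positivity)
    · exact fun s => mul_pos (by positivity) (hgp s)
  · obtain ⟨h1, h2, h3⟩ := hb w hw
    refine ⟨contDiff_quadOf _, fun z => ⟨by simpa [quadOf_apply] using h2 z, apply_self_le h1 z⟩,
      fun v hv z e => ?_⟩
    rw [(hasFDerivAt_quadOf (b w) (hs w) z).fderiv]
    have h4 := lyapunov_perturbed hc h1 h3 z (R.Gbar e v w)
    have h5 := mul_le_mul_of_nonneg_left (hG v hv w hw e) (show 0 ≤ 2 * C ^ 2 / c by positivity)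
    have h6 : c / (2 * C) * quadOf (b w) z ≤ c / 2 * ‖z‖ ^ 2 := by
      have := mul_le_mul_of_nonneg_left (apply_self_le h1 z) (show 0 ≤ c / (2 * C) by positivity)
      refine this.trans (le_of_eq ?_)
      field_simp
    change 2 * b w z (mulE (R.F w) z + R.Gbar e v w) ≤ _
    linarith

theorem sq_add_four_le (x y z w : ℝ) :
    (x + y + z + w) ^ 2 ≤ 4 * (x ^ 2 + y ^ 2 + z ^ 2 + w ^ 2) := by
  nlinarith [sq_nonneg (x - y), sq_nonneg (x - z), sq_nonneg (x - w), sq_nonneg (y - z),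
    sq_nonneg (y - w), sq_nonneg (z - w)]

theorem deltaBar_sq_le {v : Vec nv} {σ : Vec nσ} {w : Vec nw} {e D g : ℝ}
    (hb : |(R.b w v)⁻¹| ≤ D) (hH : ‖R.H w‖ ≤ D)
    (hd : |R.exoDeriv σ (fun v' => (R.b w v')⁻¹) v| ≤ D) (hK : R.Kbar e v w ^ 2 ≤ e ^ 2 * g)
    (z : Vec nz) :
    R.deltaBar z e v σ w ^ 2 ≤ 8 * D ^ 2 * e ^ 2 + 4 * D ^ 4 * ‖z‖ ^ 2 + 4 * D ^ 2 * (e ^ 2 * g) := by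
  set β := (R.b w v)⁻¹
  set d := R.exoDeriv σ (fun v' => (R.b w v')⁻¹) v
  set p := inner ℝ (R.H w) z
  set q := R.Kbar e v w
  have hβ2 : β ^ 2 ≤ D ^ 2 := sq_le_sq' (by linarith [abs_le.1 hb]) (abs_le.1 hb).2
  have hd2 : d ^ 2 ≤ D ^ 2 := sq_le_sq' (by linarith [abs_le.1 hd]) (abs_le.1 hd).2
  have hp2 : p ^ 2 ≤ D ^ 2 * ‖z‖ ^ 2 := by
    rw [← mul_pow, ← sq_abs]
    have := (abs_real_inner_le_norm (R.H w) z).trans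
      (mul_le_mul_of_nonneg_right hH (norm_nonneg z))
    gcongr
  have h8 : R.deltaBar z e v σ w = β * e + β * p + β * q + d * e := by
    simp only [deltaBar]
    ring
  have h9 := sq_add_four_le (β * e) (β * p) (β * q) (d * e)
  simp only [mul_pow] at h9
  have i1 : β ^ 2 * e ^ 2 ≤ D ^ 2 * e ^ 2 := by gcongr
  have i2 : d ^ 2 * e ^ 2 ≤ D ^ 2 * e ^ 2 := by gcongr
  have i3 : β ^ 2 * q ^ 2 ≤ D ^ 2 * (e ^ 2 * g) := by gcongr
  have i4 : β ^ 2 * p ^ 2 ≤ D ^ 2 * (D ^ 2 * ‖z‖ ^ 2) := by gcongr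
  rw [h8]
  linarith

/-- The `(η̄, π̄)`-subsystem is input-to-state stable with a quadratic Lyapunov function. -/
theorem exists_xi_lyapunov (hV : IsCompact Vs) (hW : IsCompact Ws) (hS : IsCompact Ss)
    (hM : IsHurwitz R.M) :
    ∃ (V₁ : QuadraticForm ℝ (Vec n × ℝ)) (A₁ k₁ β₁ : ℝ) (δ₁ : ℝ → ℝ),
      0 < A₁ ∧ 0 < k₁ ∧ 0 < β₁ ∧ IsClassK δ₁ ∧
      ContDiff ℝ ∞ (fun p => V₁ p) ∧
        (∀ (η : Vec n) (π : ℝ), 1 * (‖η‖ ^ 2 + π ^ 2) ≤ V₁ (η, π) ∧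
          V₁ (η, π) ≤ A₁ * (‖η‖ ^ 2 + π ^ 2)) ∧
        ∀ v ∈ Vs, ∀ σ ∈ Ss, ∀ w ∈ Ws, ∀ (z : Vec nz) (η : Vec n) (π e : ℝ),
          fderiv ℝ (fun p => V₁ p) (η, π) (R.etaRhs η π e v w, R.piRhs z π e v σ w) ≤
            -k₁ * V₁ (η, π) + β₁ * ‖z‖ ^ 2 + δ₁ (e ^ 2) := by
  obtain ⟨b, c, hc, hs, hpos, hb⟩ := hM.exists_lyapunov
  obtain ⟨g, hg, hgm, hgp, hK⟩ := exists_Kbar_bound (R := R) hV hW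
  obtain ⟨D, hD1, hD⟩ := exists_plant_bound (R := R) hV hW hS
  -- `m` bounds the effect of `π²` on the `η̄`-part after completing the square. The `π̄`-part of
  -- `V₁` has weight `κ = m + 1` and contributes `-κπ² + κδ̄²`, so `-π²` remains. The bound on `δ̄²`
  -- in terms of `‖z‖²` then produces `β₁ = 4κD⁴`.
  set m := 4 * ‖b‖ ^ 2 / c * ‖lastVec n‖ ^ 2 with hm
  have hm0 : 0 ≤ m := by positivity
  set κ := m + 1 with hκ
  have hκ0 : 0 < κ := by positivity
  set A := max ‖b‖ κ with hA
  have hA0 : 0 < A := lt_max_of_lt_right hκ0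
  set V₁ : QuadraticForm ℝ (Vec n × ℝ) := (quadOf b).prod (κ • QuadraticMap.sq) with hV₁
  have hVa : ∀ p : Vec n × ℝ, V₁ p = quadOf b p.1 + κ * (p.2 * p.2) := fun p => by
    simp [hV₁, QuadraticMap.prod_apply]
  have hder : ∀ (η : Vec n) (π : ℝ) (η' : Vec n) (π' : ℝ),
      fderiv ℝ (fun p => V₁ p) (η, π) (η', π') = 2 * b η η' + 2 * κ * (π * π') := by
    intro η π η' π'
    have h1 : HasFDerivAt (fun p : Vec n × ℝ => quadOf b p.1 + κ * (p.2 * p.2)) _ (η, π) :=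
      ((hasFDerivAt_quadOf b hs η).comp (f := fun p : Vec n × ℝ => p.1) (η, π) hasFDerivAt_fst).add
      (((hasFDerivAt_snd (p := (η, π))).mul (hasFDerivAt_snd (p := (η, π)))).const_mul κ)
    simp only [hVa]
    rw [h1.fderiv]
    simp
    ring
  have hVle : ∀ (η : Vec n) (π : ℝ), V₁ (η, π) ≤ A * (‖η‖ ^ 2 + π ^ 2) := by
    intro η π
    have h2 := apply_self_le le_rfl η (b := b)
    have h3 : ‖b‖ * ‖η‖ ^ 2 ≤ A * ‖η‖ ^ 2 := by gcongr; exact le_max_left _ _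
    have h4 : κ * π ^ 2 ≤ A * π ^ 2 := by gcongr; exact le_max_right _ _
    rw [hVa, quadOf_apply, ← sq]
    linarith
  refine ⟨V₁, A, min (c / 2) 1 / A, 4 * κ * D ^ 4,
    fun s => s * (m * D ^ 2 + 8 * κ * D ^ 2 + 4 * κ * D ^ 2 * g s), hA0,
    by positivity, by positivity, ?_, ?_, ?_, ?_⟩
  · refine (isClassKInf_mul (by have := hg.continuous; fun_prop) ?_ ?_).1
    · exact (hgm.const_mul (by positivity)).const_add _
    · intro s
      have := hgp s
      positivity
  · simp only [hVa]
    exact ((contDiff_quadOf b).comp contDiff_fst).add (by fun_prop)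
  · intro η π
    refine ⟨?_, hVle η π⟩
    have h1 := hpos η
    have h5 : 0 ≤ m * π ^ 2 := by positivity
    rw [hVa, quadOf_apply, ← sq, hκ]
    linarith
  · intro v hv σ hσ w hw z η π e
    obtain ⟨-, hb2, hH, hd⟩ := hD v hv σ hσ w hw
    have hKb := hK v hv w hw e
    rw [hder, etaRhs, piRhs]
    have h1 := lyapunov_perturbed hc le_rfl hb η (R.epsBar π e v w)
    set β := (R.b w v)⁻¹ with hβ
    have hβ2 : β ^ 2 ≤ D ^ 2 := sq_le_sq' (by linarith [abs_le.1 hb2]) (abs_le.1 hb2).2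
    have h2 : 2 * ‖b‖ ^ 2 / c * ‖R.epsBar π e v w‖ ^ 2 ≤ m * π ^ 2 + m * D ^ 2 * e ^ 2 := by
      rw [epsBar, norm_smul, mul_pow, Real.norm_eq_abs, sq_abs]
      have h3 : (π + β * e) ^ 2 ≤ 2 * π ^ 2 + 2 * (D ^ 2 * e ^ 2) := by
        nlinarith [sq_nonneg (π - β * e), mul_le_mul_of_nonneg_right hβ2 (sq_nonneg e)]
      have h4 : 0 ≤ 2 * ‖b‖ ^ 2 / c * ‖lastVec n‖ ^ 2 := by positivity
      have h5 := mul_le_mul_of_nonneg_left h3 h4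
      have h6 : m = 2 * (2 * ‖b‖ ^ 2 / c * ‖lastVec n‖ ^ 2) := by rw [hm]; ring
      rw [h6]
      linarith
    have h7 := deltaBar_sq_le hb2 hH hd hKb z
    set δ := R.deltaBar z e v σ w
    have h10 : 2 * κ * (π * (-π - δ)) ≤ -κ * π ^ 2 + κ * δ ^ 2 := by
      have := mul_nonneg hκ0.le (sq_nonneg (π + δ))
      linarith
    have h11 := mul_le_mul_of_nonneg_left h7 hκ0.le
    have h12 : min (c / 2) 1 / A * V₁ (η, π) ≤ c / 2 * ‖η‖ ^ 2 + π ^ 2 := by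
      have h13 := hVle η π
      calc _ ≤ min (c / 2) 1 / A * (A * (‖η‖ ^ 2 + π ^ 2)) := by gcongr
        _ = min (c / 2) 1 * ‖η‖ ^ 2 + min (c / 2) 1 * π ^ 2 := by field_simp
        _ ≤ c / 2 * ‖η‖ ^ 2 + 1 * π ^ 2 := by
          gcongr
          exacts [min_le_left _ _, min_le_right _ _]
        _ = _ := by ring
    have h14 : κ * π ^ 2 = m * π ^ 2 + π ^ 2 := by rw [hκ]; ring
    change 2 * b η (mulE R.M η + R.epsBar π e v w) + _ ≤ _
    linarith

end RegSetup

/-! ### The `ϑ̄` subsystem and the growth of `ḡ` -/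

theorem dotAlong_logLyap {X : Type*} [NormedAddCommGroup X] [NormedSpace ℝ X] {W : ℝ → X → ℝ}
    (hW : ContDiff ℝ ∞ fun p : ℝ × X => W p.1 p.2) {t : ℝ} {x : X} (h : W t x + 1 ≠ 0) (ξ : X) :
    dotAlong (logLyap W) t x ξ = dotAlong W t x ξ / (W t x + 1) := by
  have h1 : DifferentiableAt ℝ (fun s => W s x) t :=
    (hW.comp (f := fun s : ℝ => (s, x)) (by fun_prop)).differentiable (by simp) t
  have h2 : DifferentiableAt ℝ (W t) x :=
    (hW.comp (f := fun y : X => (t, y)) (by fun_prop)).differentiable (by simp) x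
  have h3 : HasDerivAt (fun s => logLyap W s x) (deriv (fun s => W s x) t / (W t x + 1)) t :=
    (h1.hasDerivAt.add_const 1).log h
  have h4 : HasFDerivAt (logLyap W t) ((W t x + 1)⁻¹ • fderiv ℝ (W t) x) x :=
    (h2.hasFDerivAt.add_const 1).log h
  rw [dotAlong, h3.deriv, h4.fderiv, dotAlong, smul_apply, smul_eq_mul]
  field_simp

theorem contDiffAt_logLyap {X : Type*} [NormedAddCommGroup X] [NormedSpace ℝ X] {W : ℝ → X → ℝ}
    (hW : ContDiff ℝ ∞ fun p : ℝ × X => W p.1 p.2) {t : ℝ} {x : X} (h : W t x + 1 ≠ 0) :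
    ContDiffAt ℝ ∞ (fun p : ℝ × X => logLyap W p.1 p.2) (t, x) :=
  (hW.contDiffAt.add contDiffAt_const).log h

namespace RegSetup

variable {nz nv nw nσ n : ℕ} {R : RegSetup nz nv nw nσ n}
  {Vs : Set (Vec nv)} {Ws : Set (Vec nw)} {Ss : Set (Vec nσ)}

section Parametric

variable {v : Vec nv} {σ : Vec nσ} {w : Vec nw} {D : ℝ}

/-- Every term of `γ̄` contains a factor from the input and is at most linear in `ϑ`. Linear growth
in `ϑ` is what makes division by `W + 1` effective. -/
theorem norm_gammaBar_le (hΘ : 0 < R.Θ) (hD : 1 ≤ D) (hb : |(R.b w v)⁻¹| ≤ D)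
    (hθ : ‖R.theta v σ w‖ ≤ D) (hρ : ‖R.rho σ‖ ≤ D) (η : Vec n) (π e : ℝ) (ϑ : Vec n) :
    ‖R.gammaBar η π e ϑ v σ w‖ ≤ 4 * R.Θ * D ^ 2 *
      ((‖η‖ + |π| + |e|) + (‖η‖ + |π| + |e|) ^ 2) * (1 + ‖ϑ‖) := by
  set s := ‖η‖ + |π| + |e| with hs
  set r := ‖ϑ‖ with hr
  set θ := R.theta v σ w
  set ρ := R.rho σ
  have hD0 : 0 ≤ D := by linarith
  have hs0 : 0 ≤ s := by positivity
  have hr0 : 0 ≤ r := norm_nonneg _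
  have hη : ‖η‖ ≤ s := by have := abs_nonneg π; have := abs_nonneg e; linarith
  have hi : ∀ x y : Vec n, ∀ a b : ℝ, ‖x‖ ≤ a → ‖y‖ ≤ b → 0 ≤ a → |inner ℝ x y| ≤ a * b :=
    fun x y a b hx hy ha => (abs_real_inner_le_norm x y).trans (by gcongr)
  have hϖ : |R.varpi v σ w| ≤ D * D := hi _ _ _ _ hρ hθ hD0
  have hβ : |(R.b w v)⁻¹ * e| ≤ D * |e| := by rw [abs_mul]; gcongr
  have hπe : |π + (R.b w v)⁻¹ * e| ≤ D * s := by
    have := abs_add_le π ((R.b w v)⁻¹ * e)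
    have h1 : |π| ≤ D * |π| := le_mul_of_one_le_left (abs_nonneg _) hD
    have h2 : 0 ≤ D * ‖η‖ := by positivity
    rw [hs]
    linarith
  have hsum : ‖η + θ‖ ≤ s + D := (norm_add_le _ _).trans (by linarith)
  have hsm : ∀ (a A X : ℝ) (x : Vec n), |a| ≤ A → ‖x‖ ≤ X → 0 ≤ A →
      ‖(R.Θ * a) • x‖ ≤ R.Θ * (A * X) := fun a A X x ha hx hA => by
    rw [norm_smul, Real.norm_eq_abs, abs_mul, abs_of_pos hΘ, mul_assoc]
    gcongr
  have t1 : ‖(R.Θ * (π + R.varpi v σ w + (R.b w v)⁻¹ * e)) • η‖ ≤ R.Θ * ((D * s + D * D) * s) := by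
    refine hsm _ _ _ _ ?_ hη (by positivity)
    have := abs_add_le (π + (R.b w v)⁻¹ * e) (R.varpi v σ w)
    rw [show π + R.varpi v σ w + (R.b w v)⁻¹ * e = π + (R.b w v)⁻¹ * e + R.varpi v σ w by ring]
    linarith
  have t2 : ‖(R.Θ * (π + (R.b w v)⁻¹ * e)) • θ‖ ≤ R.Θ * (D * s * D) :=
    hsm _ _ _ _ hπe hθ (by positivity)
  have t3 : ‖(R.Θ * inner ℝ η ϑ) • θ‖ ≤ R.Θ * (s * r * D) :=
    hsm _ _ _ _ (hi _ _ _ _ hη le_rfl hs0) hθ (by positivity)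
  have t4 : ‖(R.Θ * inner ℝ (η + θ) ϑ) • η‖ ≤ R.Θ * ((s + D) * r * s) :=
    hsm _ _ _ _ (hi _ _ _ _ hsum le_rfl (by positivity)) hη (by positivity)
  have t5 : ‖(R.Θ * inner ℝ (η + θ) ρ) • η‖ ≤ R.Θ * ((s + D) * D * s) :=
    hsm _ _ _ _ (hi _ _ _ _ hsum hρ (by positivity)) hη (by positivity)
  have t6 : ‖(R.Θ * inner ℝ η ρ) • θ‖ ≤ R.Θ * (s * D * D) :=
    hsm _ _ _ _ (hi _ _ _ _ hη hρ hs0) hθ (by positivity)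
  have htri : ‖R.gammaBar η π e ϑ v σ w‖ ≤ R.Θ * ((D * s + D * D) * s) + R.Θ * (D * s * D)
      + R.Θ * (s * r * D) + R.Θ * ((s + D) * r * s) + R.Θ * ((s + D) * D * s)
      + R.Θ * (s * D * D) :=
    (norm_sub_le_of_le (norm_sub_le_of_le (norm_sub_le_of_le (norm_sub_le_of_le
      (norm_add_le_of_le t1 t2) t3) t4) t5) t6)
  refine htri.trans ?_
  have hDD : D ≤ D ^ 2 := by nlinarith
  have h1D : 1 ≤ D ^ 2 := by nlinarith
  have e1 : D * s ^ 2 ≤ D ^ 2 * s ^ 2 := by gcongr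
  have e2 : D * (s * r) ≤ D ^ 2 * (s * r) := by gcongr
  have e3 : 1 * (s ^ 2 * r) ≤ D ^ 2 * (s ^ 2 * r) := by gcongr
  have e4 : 0 ≤ D ^ 2 * (s * r) := by positivity
  have e5 : 0 ≤ D ^ 2 * (s ^ 2 * r) := by positivity
  have e6 : 0 ≤ D ^ 2 * s ^ 2 := by positivity
  have : (D * s + D * D) * s + D * s * D + s * r * D + (s + D) * r * s + (s + D) * D * s
      + s * D * D ≤ 4 * D ^ 2 * (s + s ^ 2) * (1 + r) := by linarith
  calc _ = R.Θ * ((D * s + D * D) * s + D * s * D + s * r * D + (s + D) * r * s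
      + (s + D) * D * s + s * D * D) := by ring
    _ ≤ R.Θ * (4 * D ^ 2 * (s + s ^ 2) * (1 + r)) := by gcongr
    _ = _ := by ring

/-- In the original coordinates this input is `η = 0`, for which the adaptation law `-Θ η (ηᵀϑ - π)`
vanishes whatever `ϑ` is. -/
theorem thetaRhs_neg_theta (ϑ : Vec n) :
    R.thetaRhs (-R.theta v σ w) 0 0 ϑ v σ w = 0 := by
  simp only [thetaRhs, gammaBar, varpi, neg_add_cancel, inner_zero_left, inner_neg_left, mul_zero,
    add_zero, zero_smul, sub_zero, zero_add, real_inner_comm (R.rho σ), inner_neg_right, inner_zero_right]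
  module

/-- Supplies the local bound, uniform in time, that `isIntegralISS_of_dissipation` requires. The
factor `3` counts the components of the input. -/
theorem norm_thetaRhs_le (hΘ : 0 < R.Θ) (hD : 1 ≤ D) (hb : |(R.b w v)⁻¹| ≤ D)
    (hθ : ‖R.theta v σ w‖ ≤ D) (hρ : ‖R.rho σ‖ ≤ D) {r : ℝ} {η : Vec n} {π e : ℝ} {ϑ : Vec n}
    (hϑ : ‖ϑ‖ ≤ r) (hu : ‖(η, π, e)‖ ≤ r) :
    ‖R.thetaRhs η π e ϑ v σ w‖ ≤
      R.Θ * (D * r) * D + 4 * R.Θ * D ^ 2 * (3 * r + (3 * r) ^ 2) * (1 + r) := by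
  have hr : 0 ≤ r := (norm_nonneg _).trans hϑ
  have h1 : ‖η‖ ≤ r := (norm_fst_le (η, π, e)).trans hu
  have h2 : ‖(π, e)‖ ≤ r := (norm_snd_le (η, π, e)).trans hu
  have h3 : |π| ≤ r := (norm_fst_le (π, e)).trans h2
  have h4 : |e| ≤ r := (norm_snd_le (π, e)).trans h2
  have h5 : ‖η‖ + |π| + |e| ≤ 3 * r := by linarith
  refine norm_add_le_of_le ?_ ((norm_gammaBar_le hΘ hD hb hθ hρ η π e ϑ).trans (by gcongr))
  rw [norm_neg, norm_smul, Real.norm_eq_abs, abs_mul, abs_of_pos hΘ]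
  have := (abs_real_inner_le_norm (R.theta v σ w) ϑ).trans
    (mul_le_mul hθ hϑ (norm_nonneg _) (by linarith))
  gcongr

/-- The growth of a Lyapunov function of the `ϑ̄`-subsystem. -/
theorem dotAlong_thetaRhs_le (hΘ : 0 < R.Θ) (hD : 1 ≤ D) (hb : |(R.b w v)⁻¹| ≤ D)
    (hθ : ‖R.theta v σ w‖ ≤ D) (hρ : ‖R.rho σ‖ ≤ D) {W : ℝ → Vec n → ℝ} {c₂ c₃ c₄ t : ℝ} {ϑ : Vec n}
    (hc₂ : 0 < c₂) (hc₃ : 0 < c₃) (hc₄ : 0 < c₄)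
    (hW : 1 * ‖ϑ‖ ^ 2 ≤ W t ϑ ∧ W t ϑ ≤ c₂ * ‖ϑ‖ ^ 2) (hdW : ‖fderiv ℝ (W t) ϑ‖ ≤ c₃ * ‖ϑ‖)
    (hdot : dotAlong W t ϑ (-((R.Θ * inner ℝ (R.theta v σ w) ϑ) • R.theta v σ w)) ≤
      -c₄ * ‖ϑ‖ ^ 2) (η : Vec n) (π e : ℝ) :
    dotAlong W t ϑ (R.thetaRhs η π e ϑ v σ w) ≤ -(c₄ / c₂) * W t ϑ +
      8 * c₃ * R.Θ * D ^ 2 * ((‖η‖ + |π| + |e|) + (‖η‖ + |π| + |e|) ^ 2) * (W t ϑ + 1) := by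
  set s := ‖η‖ + |π| + |e|
  have hγ := norm_gammaBar_le hΘ hD hb hθ hρ η π e ϑ
  have h1 : fderiv ℝ (W t) ϑ (R.gammaBar η π e ϑ v σ w) ≤
      c₃ * ‖ϑ‖ * (4 * R.Θ * D ^ 2 * (s + s ^ 2) * (1 + ‖ϑ‖)) :=
    (le_abs_self _).trans (((fderiv ℝ (W t) ϑ).le_opNorm _).trans (by gcongr))
  have h2 : dotAlong W t ϑ (R.thetaRhs η π e ϑ v σ w) =
      dotAlong W t ϑ (-((R.Θ * inner ℝ (R.theta v σ w) ϑ) • R.theta v σ w)) +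
        fderiv ℝ (W t) ϑ (R.gammaBar η π e ϑ v σ w) := by
    rw [dotAlong, dotAlong, thetaRhs, map_add, add_assoc]
  have h3 : ‖ϑ‖ * (1 + ‖ϑ‖) ≤ 2 * (W t ϑ + 1) := by nlinarith [sq_nonneg (‖ϑ‖ - 1), hW.1]
  have h4 : c₄ / c₂ * W t ϑ ≤ c₄ * ‖ϑ‖ ^ 2 := by
    calc _ ≤ c₄ / c₂ * (c₂ * ‖ϑ‖ ^ 2) := by gcongr; exact hW.2
      _ = _ := by field_simp
  have h5 : c₃ * ‖ϑ‖ * (4 * R.Θ * D ^ 2 * (s + s ^ 2) * (1 + ‖ϑ‖)) ≤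
      4 * c₃ * R.Θ * D ^ 2 * (s + s ^ 2) * (2 * (W t ϑ + 1)) := by
    calc _ = 4 * c₃ * R.Θ * D ^ 2 * (s + s ^ 2) * (‖ϑ‖ * (1 + ‖ϑ‖)) := by ring
      _ ≤ _ := by gcongr
  rw [h2]
  linarith

end Parametric

/-- The saturated function is bounded and Lipschitz, uniformly over the parameters. -/
theorem exists_chiBar_bound (hSat : R.IsSaturation Vs Ws Ss) :
    ∃ L : ℝ, 0 < L ∧ ∀ (η ϑ : Vec n) (v : Vec nv) (σ : Vec nσ) (w : Vec nw),
      R.chiBar η ϑ v σ w ^ 2 ≤ L * (‖η‖ ^ 2 + ‖ϑ‖ ^ 2) ∧ R.chiBar η ϑ v σ w ^ 2 ≤ L := by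
  obtain ⟨hsm, -, δ, -, -, -, -, hvan⟩ := hSat
  -- Outside the ball of radius `|δ| + 1` one has `‖p.1‖² + ‖p.2‖² ≥ (|δ| + 1)² ≥ δ + 1`, where the
  -- saturated function vanishes.
  have hcs : HasCompactSupport fun p : Vec n × Vec n => R.chiS p.1 p.2 := by
    refine HasCompactSupport.of_support_subset_isCompact
      (isCompact_closedBall (0 : Vec n × Vec n) (|δ| + 1)) fun p hp => ?_
    rw [mem_closedBall_zero_iff]
    by_contra! hlt
    apply hp
    refine hvan p.1 p.2 ?_
    have h1 : ‖p‖ ^ 2 ≤ ‖p.1‖ ^ 2 + ‖p.2‖ ^ 2 := by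
      rcases max_choice ‖p.1‖ ‖p.2‖ with h | h <;> rw [Prod.norm_def, h] <;>
        nlinarith [sq_nonneg ‖p.1‖, sq_nonneg ‖p.2‖]
    have := le_abs_self δ
    have := abs_nonneg δ
    nlinarith
  obtain ⟨C, hC⟩ := hsm.lipschitzWith_of_hasCompactSupport hcs (by simp)
  obtain ⟨S, hS⟩ := hcs.exists_bound_of_continuous hsm.continuous
  refine ⟨(C : ℝ) ^ 2 + 4 * S ^ 2 + 1, by positivity, fun η ϑ v σ w => ⟨?_, ?_⟩⟩
  · have h1 := hC.dist_le_mul (η + R.theta v σ w, ϑ + R.rho σ) (R.theta v σ w, R.rho σ)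
    rw [dist_eq_norm, dist_eq_norm, Prod.mk_sub_mk, add_sub_cancel_right, add_sub_cancel_right,
      Real.norm_eq_abs] at h1
    have h2 : ‖(η, ϑ)‖ ^ 2 ≤ ‖η‖ ^ 2 + ‖ϑ‖ ^ 2 := by
      rcases max_choice ‖η‖ ‖ϑ‖ with h | h <;> rw [Prod.norm_mk, h] <;>
        nlinarith [sq_nonneg ‖η‖, sq_nonneg ‖ϑ‖]
    calc R.chiBar η ϑ v σ w ^ 2 ≤ (C * ‖(η, ϑ)‖) ^ 2 := by
          rw [← sq_abs]
          exact pow_le_pow_left₀ (abs_nonneg _) h1 2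
      _ = (C : ℝ) ^ 2 * ‖(η, ϑ)‖ ^ 2 := by ring
      _ ≤ ((C : ℝ) ^ 2 + 4 * S ^ 2 + 1) * (‖η‖ ^ 2 + ‖ϑ‖ ^ 2) := by
        gcongr
        linarith [sq_nonneg S]
  · have h1 := hS (η + R.theta v σ w, ϑ + R.rho σ)
    have h2 := hS (R.theta v σ w, R.rho σ)
    rw [Real.norm_eq_abs] at h1 h2
    have h3 : |R.chiBar η ϑ v σ w| ≤ 2 * S := by
      have := abs_sub (R.chiS (η + R.theta v σ w) (ϑ + R.rho σ)) (R.chiS (R.theta v σ w) (R.rho σ))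
      rw [chiBar]
      linarith
    have h4 : R.chiBar η ϑ v σ w ^ 2 ≤ (2 * S) ^ 2 := by
      rw [← sq_abs]
      exact pow_le_pow_left₀ (abs_nonneg _) h3 2
    nlinarith [sq_nonneg (C : ℝ)]

/-- Here `τ` stands for `W`. The Lipschitz bound serves for `τ ≤ 1` and the uniform bound for `τ ≥
1`; `min τ 1 ≤ 2τ/(τ+1)` merges them. -/
theorem gBar_sq_le {v : Vec nv} {σ : Vec nσ} {w : Vec nw} {D L g e τ : ℝ} (hb : |R.b w v| ≤ D)
    (hH : ‖R.H w‖ ≤ D) (hK : R.Kbar e v w ^ 2 ≤ e ^ 2 * g) {η ϑ : Vec n} (hL : 0 < L)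
    (hχ : R.chiBar η ϑ v σ w ^ 2 ≤ L * (‖η‖ ^ 2 + ‖ϑ‖ ^ 2) ∧ R.chiBar η ϑ v σ w ^ 2 ≤ L)
    (hτ : 1 * ‖ϑ‖ ^ 2 ≤ τ) (z : Vec nz) :
    ‖R.gBar z e η ϑ v σ w‖ ^ 2 ≤ 3 * D ^ 2 * ‖z‖ ^ 2 + 3 * D ^ 2 * L * ‖η‖ ^ 2 +
      6 * D ^ 2 * L * (τ / (τ + 1)) + e ^ 2 * (3 * g) := by
  have hτ0 : 0 ≤ τ := by nlinarith [sq_nonneg ‖ϑ‖]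
  set χ := R.chiBar η ϑ v σ w
  have h1 : χ ^ 2 ≤ L * ‖η‖ ^ 2 + 2 * L * (τ / (τ + 1)) := by
    rcases le_total τ 1 with h | h
    · have h2 : τ ≤ 2 * (τ / (τ + 1)) := by
        rw [← mul_div_assoc, le_div_iff₀ (by positivity)]
        nlinarith
      nlinarith [hχ.1]
    · have h2 : 1 ≤ 2 * (τ / (τ + 1)) := by
        rw [← mul_div_assoc, le_div_iff₀ (by positivity)]
        linarith
      nlinarith [hχ.2, mul_nonneg hL.le (sq_nonneg ‖η‖)]
  set p := inner ℝ (R.H w) z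
  have hp2 : p ^ 2 ≤ D ^ 2 * ‖z‖ ^ 2 := by
    rw [← mul_pow, ← sq_abs]
    have := (abs_real_inner_le_norm (R.H w) z).trans
      (mul_le_mul_of_nonneg_right hH (norm_nonneg z))
    gcongr
  have hb2 : R.b w v ^ 2 ≤ D ^ 2 := sq_le_sq' (by linarith [abs_le.1 hb]) (abs_le.1 hb).2
  have h3 : (R.b w v * χ) ^ 2 ≤ D ^ 2 * (L * ‖η‖ ^ 2 + 2 * L * (τ / (τ + 1))) := by
    rw [mul_pow]
    gcongr
  have h4 : ∀ x y z : ℝ, (x + y + z) ^ 2 ≤ 3 * (x ^ 2 + y ^ 2 + z ^ 2) := fun x y z => by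
    nlinarith [sq_nonneg (x - y), sq_nonneg (x - z), sq_nonneg (y - z)]
  rw [Real.norm_eq_abs, sq_abs, gBar]
  have h5 := h4 p (R.Kbar e v w) (R.b w v * χ)
  linarith

end RegSetup

/-- Separates the input growth `s + s²` into a part in `V₁` and a part in `e²`. The square roots
account for the terms linear in the input. -/
theorem input_growth_le {a p e V : ℝ} (hV : 1 * (a ^ 2 + p ^ 2) ≤ V) :
    (a + |p| + |e|) + (a + |p| + |e|) ^ 2 ≤ 4 * (√V + V) + 2 * (√(e ^ 2) + e ^ 2) := by
  have hp := sq_abs p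
  have he := sq_abs e
  have h1 : (a + |p|) ^ 2 ≤ 2 * V := by nlinarith [sq_nonneg (a - |p|)]
  have hV0 : 0 ≤ V := by nlinarith [sq_nonneg a, sq_nonneg p]
  have h2 : a + |p| ≤ 2 * √V := by
    refine abs_le_of_sq_le_sq' ?_ (by positivity) |>.2
    rw [mul_pow, Real.sq_sqrt hV0]
    linarith
  rw [Real.sqrt_sq_eq_abs]
  have h3 := Real.sqrt_nonneg V
  have h4 := abs_nonneg e
  nlinarith [sq_nonneg (a + |p| - |e|)]

theorem input_growth_norm_le {X : Type*} [NormedAddCommGroup X] (u : X × ℝ × ℝ) :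
    (‖u.1‖ + |u.2.1| + |u.2.2|) + (‖u.1‖ + |u.2.1| + |u.2.2|) ^ 2 ≤
      9 * (√(‖u‖ ^ 2) + ‖u‖ ^ 2) := by
  have h1 : ‖u.1‖ ≤ ‖u‖ := norm_fst_le u
  have h2 : |u.2.1| ≤ ‖u‖ := (norm_fst_le u.2).trans (norm_snd_le u)
  have h3 : |u.2.2| ≤ ‖u‖ := (norm_snd_le u.2).trans (norm_snd_le u)
  rw [Real.sqrt_sq (norm_nonneg u)]
  have h4 : ‖u.1‖ + |u.2.1| + |u.2.2| ≤ 3 * ‖u‖ := by linarith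
  have h5 : (‖u.1‖ + |u.2.1| + |u.2.2|) ^ 2 ≤ (3 * ‖u‖) ^ 2 := by gcongr
  nlinarith [norm_nonneg u]

/-! ### Assembly of the estimates -/

theorem lemma1 {nz nv nw nσ n : ℕ} (hn : 0 < n)
    (R : RegSetup nz nv nw nσ n)
    (Vs : Set (Vec nv)) (Ws : Set (Vec nw)) (Ss : Set (Vec nσ))
    (hV : IsCompact Vs) (hW : IsCompact Ws) (hS : IsCompact Ss)
    (hVinv : ∀ σ ∈ Ss, ∀ v : ℝ → Vec nv, R.IsExoTrajectory σ v → v 0 ∈ Vs →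
      ∀ t, 0 ≤ t → v t ∈ Vs)
    (hExo : ∀ σ ∈ Ss, HasDistinctImaginaryEigenvalues (R.S σ))
    (hMin : R.MinimumPhaseWith Ws Ss R.zs)
    (hPoly : R.SteadyInputPolynomial Ws Ss R.zs)
    (hExc : R.AllModesExcited Vs Ws Ss R.zs R.freq)
    (hM : IsHurwitz R.M) (hΘ : 0 < R.Θ)
    (hSat : R.IsSaturation Vs Ws Ss) :
    ∃ (V₀ : Vec nw → QuadraticForm ℝ (Vec nz)) (V₁ : QuadraticForm ℝ (Vec n × ℝ))
      (a₀ A₀ a₁ A₁ k₀ k₁ β₁ c₁ c₂ c₃ c₄ φ₀ φ₁ φ₂ : ℝ)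
      (a₂ A₂ α₂ δ₀ δ₁ δ₂ δ₃ δ₅ : ℝ → ℝ),
      (0 < a₀ ∧ 0 < A₀ ∧ 0 < a₁ ∧ 0 < A₁ ∧ 0 < k₀ ∧ 0 < k₁ ∧ 0 < β₁) ∧
      (0 < c₁ ∧ 0 < c₂ ∧ 0 < c₃ ∧ 0 < c₄) ∧
      (0 < φ₀ ∧ 0 < φ₁ ∧ 0 < φ₂) ∧
      (IsClassKInf a₂ ∧ IsClassKInf A₂ ∧ IsClassKBdd α₂ ∧
        IsClassK δ₀ ∧ IsClassK δ₁ ∧ IsClassKInf δ₂ ∧ IsClassKInf δ₃ ∧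
        IsClassK δ₅ ∧ ContDiffOn ℝ ∞ δ₅ (Ici 0)) ∧
      -- the `z̄`-subsystem
      (∀ w ∈ Ws, ContDiff ℝ ∞ (fun z => V₀ w z) ∧
        (∀ z, a₀ * ‖z‖ ^ 2 ≤ V₀ w z ∧ V₀ w z ≤ A₀ * ‖z‖ ^ 2) ∧
        ∀ v ∈ Vs, ∀ (z : Vec nz) (e : ℝ),
          fderiv ℝ (fun z' => V₀ w z') z (R.zRhs z e v w) ≤ -k₀ * V₀ w z + δ₀ (e ^ 2)) ∧
      -- the `(η̄, π̄)`-subsystem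
      (ContDiff ℝ ∞ (fun p => V₁ p) ∧
        (∀ (η : Vec n) (π : ℝ), a₁ * (‖η‖ ^ 2 + π ^ 2) ≤ V₁ (η, π) ∧
          V₁ (η, π) ≤ A₁ * (‖η‖ ^ 2 + π ^ 2)) ∧
        ∀ v ∈ Vs, ∀ σ ∈ Ss, ∀ w ∈ Ws, ∀ (z : Vec nz) (η : Vec n) (π e : ℝ),
          fderiv ℝ (fun p => V₁ p) (η, π) (R.etaRhs η π e v w, R.piRhs z π e v σ w) ≤
            -k₁ * V₁ (η, π) + β₁ * V₀ w z + δ₁ (e ^ 2)) ∧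
      -- the `ϑ̄`-subsystem, along each exosystem trajectory, and the growth of `ḡ`
      ∀ σ ∈ Ss, ∀ w ∈ Ws, ∀ v : ℝ → Vec nv, R.IsExoTrajectory σ v → v 0 ∈ Vs →
        (∃ W : ℝ → Vec n → ℝ,
          ContDiff ℝ ∞ (fun p : ℝ × Vec n => W p.1 p.2) ∧
          (∀ t, 0 ≤ t → ∀ ϑ : Vec n,
            (c₁ * ‖ϑ‖ ^ 2 ≤ W t ϑ ∧ W t ϑ ≤ c₂ * ‖ϑ‖ ^ 2) ∧
            ‖fderiv ℝ (W t) ϑ‖ ≤ c₃ * ‖ϑ‖ ∧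
            dotAlong W t ϑ
              (-((R.Θ * inner ℝ (R.theta (v t) σ w) ϑ) • R.theta (v t) σ w)) ≤
                -c₄ * ‖ϑ‖ ^ 2) ∧
          (∀ t, 0 ≤ t → ∀ ϑ : Vec n,
            ContDiffAt ℝ ∞ (fun p : ℝ × Vec n => logLyap W p.1 p.2) (t, ϑ) ∧
            (a₂ (‖ϑ‖ ^ 2) ≤ logLyap W t ϑ ∧ logLyap W t ϑ ≤ A₂ (‖ϑ‖ ^ 2)) ∧
            ∀ (η : Vec n) (π e : ℝ),
              dotAlong (logLyap W) t ϑ (R.thetaRhs η π e ϑ (v t) σ w) ≤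
                -α₂ (logLyap W t ϑ) + δ₃ (V₁ (η, π)) + δ₂ (e ^ 2)) ∧
          (∀ t, 0 ≤ t → ∀ (z : Vec nz) (e : ℝ) (η ϑ : Vec n) (π : ℝ),
            ‖R.gBar z e η ϑ (v t) σ w‖ ^ 2 ≤
              φ₀ * V₀ w z + φ₁ * V₁ (η, π) + φ₂ * α₂ (logLyap W t ϑ) + δ₅ (e ^ 2))) ∧
        IsIntegralISS (R.thetaSystem v σ w) ∧ ¬ IsISS (R.thetaSystem v σ w) := by

  obtain ⟨V₀, A₀, k₀, δ₀, hA₀, hk₀, hδ₀, hz⟩ := R.exists_z_lyapunov hV hW hMin.1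
  obtain ⟨V₁, A₁, k₁, β₁, δ₁, hA₁, hk₁, hβ₁, hδ₁, hV₁s, hV₁b, hV₁d⟩ :=
    R.exists_xi_lyapunov hV hW hS hM
  obtain ⟨B, ε, hB, hε, hBd, hPE⟩ :=
    RegSetup.exists_uniform_excitation hn hV hW hS hVinv hMin.2.1 hExc hM
  obtain ⟨D₀, hD₀, hD₀b⟩ := R.exists_plant_bound hV hW hS
  obtain ⟨g, hg, hgm, hgp, hK⟩ := R.exists_Kbar_bound hV hW
  obtain ⟨L, hL, hχ⟩ := R.exists_chiBar_bound hSat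
  set D := max B D₀
  have hD : 1 ≤ D := hD₀.trans (le_max_right _ _)
  set κ := gradientWeight R.Θ B ε with hκ
  have hκB : B ^ 2 + 1 ≤ κ := gradientWeight_ge hε hΘ
  have hκ0 : 0 < κ := by nlinarith [sq_nonneg B]
  set k := ε / 2 / κ with hk
  have hk0 : 0 < k := by positivity
  set Q := 8 * (4 * κ) * R.Θ * D ^ 2 with hQ
  have hQ0 : 0 < Q := by positivity
  -- The factors `2` and `4` in `δ₂` and `δ₃` come from `input_growth_le`. The division by `k` in
  -- `φ₂` cancels the factor `k` of `α₂`.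
  refine ⟨V₀, V₁, 1, A₀, 1, A₁, k₀, k₁, β₁, 1, κ, 4 * κ, ε / 2, 3 * D ^ 2, 3 * D ^ 2 * L,
    6 * D ^ 2 * L / k, fun s => Real.log (1 * s + 1), fun s => Real.log (κ * s + 1),
    fun s => k * (1 - Real.exp (-s)), δ₀, δ₁, fun s => (Q * 2) * (√s + s),
    fun s => (Q * 4) * (√s + s), fun s => s * (3 * g s),
    ⟨one_pos, hA₀, one_pos, hA₁, hk₀, hk₁, hβ₁⟩, ⟨one_pos, hκ0, by positivity, by positivity⟩,
    ⟨by positivity, by positivity, by positivity⟩,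
    ⟨isClassKInf_log one_pos, isClassKInf_log hκ0, isClassKBdd_one_sub_exp hk0, hδ₀, hδ₁,
      isClassKInf_sqrt_add (by positivity), isClassKInf_sqrt_add (by positivity), ?_, ?_⟩,
    hz, ⟨hV₁s, hV₁b, ?_⟩, ?_⟩
  · exact (isClassKInf_mul (continuous_const.mul hg.continuous) (hgm.const_mul (by norm_num))
      fun s => mul_pos (by norm_num) (hgp s)).1
  · exact ContDiff.contDiffOn (by fun_prop)
  · intro v hv σ hσ w hw z η π e
    have h1 := hV₁d v hv σ hσ w hw z η π e
    have h2 := mul_le_mul_of_nonneg_left ((hz w hw).2.1 z).1 hβ₁.le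
    linarith
  intro σ hσ w hw v hv hv0
  set θ : ℝ → Vec n := fun t => R.theta (v t) σ w with hθdef
  have hvt : ∀ t, 0 ≤ t → v t ∈ Vs := hVinv σ hσ v hv hv0
  have hθ : ContDiff ℝ ∞ θ := RegSetup.contDiff_theta_trajectory hMin.2.1 hv w
  have hθB : ∀ t, 0 ≤ t → ‖θ t‖ ≤ B := fun t ht => (hBd (v t) (hvt t ht) σ hσ w hw).1
  have hpar : ∀ t, 0 ≤ t → |R.b w (v t)| ≤ D ∧ |(R.b w (v t))⁻¹| ≤ D ∧ ‖R.H w‖ ≤ D ∧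
      ‖R.theta (v t) σ w‖ ≤ D ∧ ‖R.rho σ‖ ≤ D := fun t ht => by
    obtain ⟨h1, h2, h3, -⟩ := hD₀b (v t) (hvt t ht) σ hσ w hw
    obtain ⟨h4, h5⟩ := hBd (v t) (hvt t ht) σ hσ w hw
    exact ⟨h1.trans (le_max_right _ _), h2.trans (le_max_right _ _), h3.trans (le_max_right _ _),
      h4.trans (le_max_left _ _), h5.trans (le_max_left _ _)⟩
  set W := gradientLyap κ θ with hWdef
  have hWs : ContDiff ℝ ∞ fun p : ℝ × Vec n => W p.1 p.2 := contDiff_gradientLyap hθ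
  have hWb : ∀ t, 0 ≤ t → ∀ ϑ, 1 * ‖ϑ‖ ^ 2 ≤ W t ϑ ∧ W t ϑ ≤ κ * ‖ϑ‖ ^ 2 := fun t ht ϑ =>
    gradientLyap_bounds hθ hθB hκB ht ϑ
  have hWf : ∀ t, 0 ≤ t → ∀ ϑ, ‖fderiv ℝ (W t) ϑ‖ ≤ 4 * κ * ‖ϑ‖ := fun t ht ϑ =>
    norm_fderiv_gradientLyap_le hθ hθB hκB ht ϑ
  have hWd : ∀ t, 0 ≤ t → ∀ ϑ, dotAlong W t ϑ
      (-((R.Θ * inner ℝ (R.theta (v t) σ w) ϑ) • R.theta (v t) σ w)) ≤ -(ε / 2) * ‖ϑ‖ ^ 2 :=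
    fun t ht ϑ => dotAlong_gradientLyap_le hθ hB hε hΘ hθB
      (fun t ht x => hPE σ hσ w hw v hv hv0 t ht x) ht ϑ
  have hWdot : ∀ t, 0 ≤ t → ∀ (ϑ η : Vec n) (π e : ℝ),
      dotAlong W t ϑ (R.thetaRhs η π e ϑ (v t) σ w) ≤ -k * W t ϑ +
        Q * ((‖η‖ + |π| + |e|) + (‖η‖ + |π| + |e|) ^ 2) * (W t ϑ + 1) := fun t ht ϑ η π e => by
    obtain ⟨-, h2, -, h4, h5⟩ := hpar t ht
    exact RegSetup.dotAlong_thetaRhs_le hΘ hD h2 h4 h5 hκ0 (by positivity) (half_pos hε)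
      (hWb t ht ϑ) (hWf t ht ϑ) (hWd t ht ϑ) η π e
  have hW1 : ∀ t, 0 ≤ t → ∀ ϑ, 0 < W t ϑ + 1 := fun t ht ϑ => by
    nlinarith [(hWb t ht ϑ).1, sq_nonneg ‖ϑ‖]
  -- The rate `k W/(W+1)` is a function of `V₂` alone, because `e^{-V₂} = 1/(W+1)`.
  have hα : ∀ t, 0 ≤ t → ∀ ϑ, k * (1 - Real.exp (-logLyap W t ϑ)) = k * (W t ϑ / (W t ϑ + 1)) :=
    fun t ht ϑ => by
      have := hW1 t ht ϑ
      rw [logLyap, Real.exp_neg, Real.exp_log this]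
      field_simp
      ring
  refine ⟨⟨W, hWs, fun t ht ϑ => ⟨hWb t ht ϑ, hWf t ht ϑ, hWd t ht ϑ⟩, fun t ht ϑ => ⟨
    contDiffAt_logLyap hWs (hW1 t ht ϑ).ne', ⟨?_, ?_⟩, fun η π e => ?_⟩,
    fun t ht z e η ϑ π => ?_⟩, ?_, ?_⟩
  · exact Real.log_le_log (by positivity) (by linarith [(hWb t ht ϑ).1])
  · exact Real.log_le_log (hW1 t ht ϑ) (by linarith [(hWb t ht ϑ).2])
  · have hpos := hW1 t ht ϑ
    beta_reduce
    rw [dotAlong_logLyap hWs hpos.ne', hα t ht, div_le_iff₀ hpos]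
    have h1 := hWdot t ht ϑ η π e
    have h2 := input_growth_le (e := e) (hV₁b η π).1
    have h3 : Q * ((‖η‖ + |π| + |e|) + (‖η‖ + |π| + |e|) ^ 2) * (W t ϑ + 1) ≤
        Q * (4 * (√(V₁ (η, π)) + V₁ (η, π)) + 2 * (√(e ^ 2) + e ^ 2)) * (W t ϑ + 1) := by
      gcongr
    have h4 : k * (W t ϑ / (W t ϑ + 1)) * (W t ϑ + 1) = k * W t ϑ := by field_simp
    rw [add_mul, add_mul, neg_mul, h4]
    linarith
  · obtain ⟨h1, -, h3, -, -⟩ := hpar t ht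
    have h := RegSetup.gBar_sq_le h1 h3 (hK (v t) (hvt t ht) w hw e) hL
      (hχ η ϑ (v t) σ w) (hWb t ht ϑ).1 z
    have h6 : 3 * D ^ 2 * ‖z‖ ^ 2 ≤ 3 * D ^ 2 * V₀ w z := by
      have := ((hz w hw).2.1 z).1
      gcongr
      linarith
    have h7 : 3 * D ^ 2 * L * ‖η‖ ^ 2 ≤ 3 * D ^ 2 * L * V₁ (η, π) := by
      have := (hV₁b η π).1
      gcongr
      nlinarith [sq_nonneg π]
    beta_reduce
    rw [hα t ht]
    have h8 : 6 * D ^ 2 * L / k * (k * (W t ϑ / (W t ϑ + 1))) =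
        6 * D ^ 2 * L * (W t ϑ / (W t ϑ + 1)) := by field_simp
    rw [h8]
    linarith
  -- The gain is a function of the sup norm of the input triple: `s ≤ 3‖u‖`, hence `s + s² ≤ 9(‖u‖ +
  -- ‖u‖²)`.
  · refine isIntegralISS_of_dissipation (W := W) (γ := fun r => (Q * 9) * (√(r ^ 2) + r ^ 2))
      one_pos hκ0 hk0 (isClassKInf_sqrt_add (by positivity)).comp_sq.1 (by fun_prop) hWs hWb
      (fun t ht ϑ u => (hWdot t ht ϑ u.1 u.2.1 u.2.2).trans ?_) fun r => ?_
    · have := hW1 t ht ϑ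
      have h2 := input_growth_norm_le u
      have h3 : Q * ((‖u.1‖ + |u.2.1| + |u.2.2|) + (‖u.1‖ + |u.2.1| + |u.2.2|) ^ 2) * (W t ϑ + 1) ≤
          Q * (9 * (√(‖u‖ ^ 2) + ‖u‖ ^ 2)) * (W t ϑ + 1) := by gcongr
      linarith
    · refine ⟨R.Θ * (D * r) * D + 4 * R.Θ * D ^ 2 * (3 * r + (3 * r) ^ 2) * (1 + r),
        fun t ht ϑ u hϑ hu => ?_⟩
      obtain ⟨-, h2, -, h4, h5⟩ := hpar t ht
      exact RegSetup.norm_thetaRhs_le hΘ hD h2 h4 h5 hϑ hu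
  · have : Nonempty (Fin n) := ⟨⟨0, hn⟩⟩
    have hc : Continuous fun s => ((-θ s, 0, 0) : Vec n × ℝ × ℝ) :=
      hθ.continuous.neg.prodMk continuous_const
    refine not_isISS_of_freezing_input (u := fun s => (-θ s, 0, 0)) ⟨hc.measurable, fun t₀ T => ?_⟩
      (r := B) (fun s hs => ?_) fun s ϑ => RegSetup.thetaRhs_neg_theta ϑ
    · exact isCompact_Icc.exists_bound_of_continuousOn hc.continuousOn
    · simpa [Prod.norm_def] using hθB s hs
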